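/- **Setup.** Let $(R,\mathfrak m)$ be a commutative noetherian local ring which is $\mathfrak m$-adically complete, $Q$ a finite quiver, $\mathscr I$ an ideal of the path algebra $RQ$ generated by a set of paths of length two, and $\vartheta\colon RQ\to\Lambda$ a surjective $R$-algebra homomorphism with $\mathscr I\subseteq\ker\vartheta$ and $\vartheta(\gamma)\ne0$ for every path $\gamma\notin\mathscr I$; we write $\gamma$ for $\vartheta(\gamma)$. Paths are composed from right to left, $h$ and $t$ denote heads and tails, $\mathbf A$ is the set of arrows, $\mathbf P$ is the set of nontrivial paths outside $\mathscr I$, and $\mathrm f(\gamma),\mathrm l(\gamma)$ are the first and last arrows of $\gamma\in\mathbf P$. Assume that $\Lambda$ is a *complete gentle $R$-algebra*: at most two arrows start, and at most two end, at each vertex; for each arrow $y$ there is at most one arrow $x$ with $t(x)=h(y)$ and $xy\in\mathbf P$, at most one with $t(x)=h(y)$ and $xy\notin\mathbf P$, at most one arrow $z$ with $h(z)=t(y)$ and $yz\in\mathbf P$, and at most one with $h(z)=t(y)$ and $yz\notin\mathbf P$; each $\Lambda e_v$ has a unique maximal submodule, namely $\sum_{t(x)=v}\Lambda x$, and each $e_v\Lambda$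 has a unique maximal submodule, namely $\sum_{h(x)=v}x\Lambda$; $\Lambda x$ and $x\Lambda$ are finitely generated over $R$ for $x\in\mathbf A$; and $\Lambda x\cap\Lambda y=0=x\Lambda\cap y\Lambda$ for distinct $x,y\in\mathbf A$. **Words.** Letters are $x,x^{-1}$ with $x\in\mathbf A$, where $h(x^{-1})=t(x)$, $t(x^{-1})=h(x)$. For $I=\{0,\dots,m\}$ with $m>0$, $\mathbb N$, $-\mathbb N$ or $\mathbb Z$, an $I$-word is a sequence of letters $C_i$ (for $i-1,i\in I$) with $t(C_i)=h(C_{i+1})$ and $C_i^{-1}\ne C_{i+1}$, in which every consecutive subsequence of the form $\gamma$ or $\gamma^{-1}$, with $\gamma$ a nontrivial path, has $\gamma\in\mathbf P$. For $I=\{0\}$ the words are $1_{v,\pm1}$ for the vertices $v$, with $(1_{v,\delta})^{-1}=1_{v,-\delta}$. Fix signs $s(l)=\pm1$ of the letters such that distinct letters with the same head and sign are $x^{-1}$ and $y$ for some $xy\in\mathscr I$; put $s(1_{v,\delta})=\delta$ and $s(C)=s(C_1)$. Products $BD$ are formed when $h(B^{-1})=h(D)$ and $s(B^{-1})=-s(D)$.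 A *string word* is a word $C=B^{-1}(AD)$ where $B$ and $D$ are words each of which is trivial or consists of inverse letters, and $A$ is either a trivial word $1_{v,\varepsilon}$ (put $n=0$) or an *alternating* word $\gamma_1^{-1}\sigma_1\cdots\gamma_n^{-1}\sigma_n$ with $n\ge1$ and $\gamma_i,\sigma_i\in\mathbf P$. A *band word* is a word $C={}^\infty A^\infty=\cdots A\mid AA\cdots$ where $A=\gamma_1^{-1}\sigma_1\cdots\gamma_n^{-1}\sigma_n$ is alternating, $A^2$ is a word, and $A$ is not a proper power of a word. **Modules.** For a string word let $N(C)=\bigoplus_{i=0}^n\Lambda g_{C,i}$, where $g_{C,i}$ is a copy of $e_{t(\gamma_{i+1})}$ for $i<n$ and of $e_{t(\sigma_n)}$ for $i=n$ (if $A=1_{v,\varepsilon}$, then $g_{C,0}$ is a copy of $e_v$). Let $M(C)=N(C)/L(C)$, where $L(C)$ is generated by $\gamma_{i+1}g_{C,i}-\sigma_{i+1}g_{C,i+1}$ ($0\le i<n$), by $bB^{-1}g_{C,0}$ if there is an arrow $b$ such that $Bb^{-1}$ is a word, and by $dD^{-1}g_{C,n}$ if there is an arrow $d$ such that $Dd^{-1}$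 is a word; such $b$, $d$ are unique, and exist only if $B$, respectively $D$, is finite. For a band word put $\gamma_{i+n}=\gamma_i$, $\sigma_{i+n}=\sigma_i$ for all $i\in\mathbb Z$, and let $M(C)=\bigoplus_{i\in\mathbb Z}\Lambda g_{C,i}\big/\sum_{i\in\mathbb Z}\Lambda(\gamma_{i+1}g_{C,i}-\sigma_{i+1}g_{C,i+1})$, where $g_{C,i}$ is a copy of $e_{t(\gamma_{i+1})}$, with $R[T,T^{-1}]$ acting by $Tg_{C,i}=g_{C,i-n}$; for an $R[T,T^{-1}]$-module $V$ which is projective over $R$ put $M(C,V)=M(C)\otimes_{R[T,T^{-1}]}V$. **Complexes.** A generalised word $\mathcal C$ is, for $I\neq\{0\}$ as above, a sequence of generalised letters $\mathcal C_i\in\{\langle\gamma\rangle,\langle\gamma\rangle^{-1}:\gamma\in\mathbf P\}$ in which each two consecutive letters have one of the forms $\langle\gamma\rangle\langle\sigma\rangle^{-1}$ with $h(\gamma)=h(\sigma)$, $\mathrm l(\gamma)\ne\mathrm l(\sigma)$; $\langle\gamma\rangle^{-1}\langle\sigma\rangle$ with $t(\gamma)=t(\sigma)$, $\mathrm f(\gamma)\ne\mathrm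 f(\sigma)$; $\langle\gamma\rangle^{-1}\langle\sigma\rangle^{-1}$ with $t(\gamma)=h(\sigma)$, $\mathrm f(\gamma)\mathrm l(\sigma)=0$; $\langle\gamma\rangle\langle\sigma\rangle$ with $h(\gamma)=t(\sigma)$, $\mathrm f(\sigma)\mathrm l(\gamma)=0$; for $I=\{0\}$ it is one of the symbols $\langle1_{v,\pm1}\rangle$. Let $\mathscr H_{\mathcal C}\colon I\to\mathbb Z$ be the function with $\mathscr H_{\mathcal C}(0)=0$ and $\mathscr H_{\mathcal C}(i)-\mathscr H_{\mathcal C}(i-1)=-1$ if $\mathcal C_i=\langle\gamma\rangle$, $=+1$ if $\mathcal C_i=\langle\gamma\rangle^{-1}$. The string complex $P(\mathcal C)$ has $P^m(\mathcal C)=\bigoplus_{\mathscr H_{\mathcal C}(i)=m}\Lambda g_{\mathcal C,i}$, where $g_{\mathcal C,i}$ is a copy of $e_v$ with $v$ the vertex of $\mathcal C$ at $i$ (the vertex $v$ itself for $\langle 1_{v,\pm1}\rangle$; otherwise $h(\gamma)$, $t(\gamma)$ if $\mathcal C_i=\langle\gamma\rangle$, $\langle\gamma\rangle^{-1}$, and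 $t(\gamma)$, $h(\gamma)$ if $\mathcal C_{i+1}=\langle\gamma\rangle$, $\langle\gamma\rangle^{-1}$), and differential $g_{\mathcal C,i}\mapsto g^-_{\mathcal C,i}+g^+_{\mathcal C,i}$, where $g^-_{\mathcal C,i}=\eta g_{\mathcal C,i-1}$ if $\mathcal C_i=\langle\eta\rangle$, $g^+_{\mathcal C,i}=\mu g_{\mathcal C,i+1}$ if $\mathcal C_{i+1}=\langle\mu\rangle^{-1}$, and these terms are $0$ otherwise. If $\mathcal C$ is a generalised $\mathbb Z$-word and $p>0$ is least with $\mathcal C_{i+p}=\mathcal C_i$ for all $i$ and $\mathscr H_{\mathcal C}(p)=0$ (the period of $\mathcal C$), the band complex is $P(\mathcal C,V)=P(\mathcal C)\otimes_{R[T,T^{-1}]}V$ with $Tg_{\mathcal C,i}=g_{\mathcal C,i-p}$. **The construction of $\mathcal R_C$.** For $\beta\in\mathbf P$ let $\langle\beta\rangle(\nearrow)=\langle\beta\rangle\langle a_1\rangle\langle a_2\rangle\cdots$, where $a_1$ is the arrow with $t(a_1)=h(\beta)$ and $a_1\mathrm l(\beta)=0$, and $a_{k+1}$ is the arrow with $t(a_{k+1})=h(a_k)$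 and $a_{k+1}a_k=0$ (each is unique if it exists); the sequence stops when there is no such arrow, and is infinite otherwise. Let $C=B^{-1}(AD)$ be a string word. Let $\mathcal B=\langle bB^{-1}\rangle(\nearrow)$ if the arrow $b$ above exists, and let $\mathcal B$ be absent otherwise; define $\mathcal D$ in the same way from $d$ and $D$. Let $\mathcal A=\langle1_{v,\varepsilon}\rangle$ if $A=1_{v,\varepsilon}$, and $\mathcal A=\langle\gamma_1\rangle\langle\sigma_1\rangle^{-1}\cdots\langle\gamma_n\rangle\langle\sigma_n\rangle^{-1}$ if $A$ is alternating. Put $\mathcal R_C=\mathcal B^{-1}(\mathcal A\mathcal D)$ (and $\mathcal R_C=\mathcal B^{-1}\mid\mathcal A\mathcal D$ if $\mathcal B$ and $\mathcal D$ are infinite), and let $\iota(-)\in I$ be the position between $\mathcal B^{-1}$ and $\mathcal A\mathcal D$. For a band word $C={}^\infty A^\infty$ put $\mathcal R_C={}^\infty\mathcal A^\infty$, with $\mathcal A$ as above. **Theorem.** Let $\Lambda$ be a complete gentle $R$-algebra. 1. Let $C$ be a string word. Then $\mathcal R_C$ is a generalised word and, with $t=\mathscr H_{\mathcal R_C}(\iota(-))$,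 the shifted string complex $P(\mathcal R_C)[t]$ (where $P[t]^m=P^{m+t}$) is a projective resolution of the string module $M(C)$. 2. Let $C$ be a band word with cycle $\gamma_1^{-1}\sigma_1\cdots\gamma_n^{-1}\sigma_n$. Then $\mathcal R_C$ is a generalised word of period $2n$ and, for every $R[T,T^{-1}]$-module $V$ which is projective over $R$, the band complex $P(\mathcal R_C,V')$ is a projective resolution of the band module $M(C,V)$, where $V'$ is $V$ with $T$ acting as $(-1)^nT$. If moreover $V\ne0$, then $M(C,V)$ has projective dimension exactly $1$. Here a complex $P$ is a projective resolution of $M$ if all its terms are projective, $P^l=0$ for $l>0$, $H^m(P)=0$ for $m\ne0$, and $H^0(P)\cong M$. -/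

import Mathlib

open CategoryTheory
open scoped TensorProduct LaurentPolynomial

universe u

namespace Gentle

/-! ## Quivers, path algebras, complete gentle algebras -/

/-- A quiver with vertex set `Q₀`, arrow set `Q₁`, and head and tail functions. -/
structure Quiv (Q₀ Q₁ : Type*) where
  head : Q₁ → Q₀
  tail : Q₁ → Q₀

section PathAlgebra

variable (R : Type*) [CommRing R] {Q₀ Q₁ : Type*} [Fintype Q₀] (Q : Quiv Q₀ Q₁)

/-- The defining relations of the path algebra of a quiver with finitely many vertices, on the
generators `e_v` (one for each vertex) and `x` (one for each arrow). Paths compose from right to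
left: `x * y` is a path when `tail x = head y`. -/
inductive PathRel : FreeAlgebra R (Q₀ ⊕ Q₁) → FreeAlgebra R (Q₀ ⊕ Q₁) → Prop
  | idem (v : Q₀) : PathRel
      (FreeAlgebra.ι R (Sum.inl v) * FreeAlgebra.ι R (Sum.inl v)) (FreeAlgebra.ι R (Sum.inl v))
  | orth (v w : Q₀) (hvw : v ≠ w) : PathRel
      (FreeAlgebra.ι R (Sum.inl v) * FreeAlgebra.ι R (Sum.inl w)) 0
  | one : PathRel (∑ v : Q₀, FreeAlgebra.ι R (Sum.inl v)) 1
  | head (x : Q₁) : PathRel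
      (FreeAlgebra.ι R (Sum.inl (Q.head x)) * FreeAlgebra.ι R (Sum.inr x))
      (FreeAlgebra.ι R (Sum.inr x))
  | tail (x : Q₁) : PathRel
      (FreeAlgebra.ι R (Sum.inr x) * FreeAlgebra.ι R (Sum.inl (Q.tail x)))
      (FreeAlgebra.ι R (Sum.inr x))

/-- The path algebra `RQ`. -/
abbrev PathAlgebra : Type _ := RingQuot (PathRel R Q)

/-- The trivial path at the vertex `v`, as an element of `RQ`. -/
noncomputable def vertexElt (v : Q₀) : PathAlgebra R Q :=
  RingQuot.mkAlgHom R (PathRel R Q) (FreeAlgebra.ι R (Sum.inl v))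

/-- The arrow `x`, as an element of `RQ`. -/
noncomputable def arrowElt (x : Q₁) : PathAlgebra R Q :=
  RingQuot.mkAlgHom R (PathRel R Q) (FreeAlgebra.ι R (Sum.inr x))

/-- The two-sided ideal of `RQ` generated by the products `x * y` with `(x, y) ∈ Z`. -/
noncomputable def relIdeal (Z : Set (Q₁ × Q₁)) : TwoSidedIdeal (PathAlgebra R Q) :=
  TwoSidedIdeal.span {a | ∃ p ∈ Z, a = arrowElt R Q p.1 * arrowElt R Q p.2}

end PathAlgebra

/-- A nonempty sequence of arrows, written as the product `last * rest₁ * rest₂ * ⋯`. -/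
structure NPath (Q₁ : Type*) where
  last : Q₁
  rest : List Q₁

namespace NPath

variable {Q₁ : Type*}

/-- The arrows of a path, from the last one to the first one, as they are written in a product. -/
def arrows (γ : NPath Q₁) : List Q₁ := γ.last :: γ.rest

/-- The first arrow `f(γ)`: the rightmost factor of `γ`. -/
def first (γ : NPath Q₁) : Q₁ := γ.arrows.getLast (List.cons_ne_nil _ _)

end NPath

namespace Quiv

variable {Q₀ Q₁ : Type*} (Q : Quiv Q₀ Q₁)

/-- Consecutive arrows of the sequence are composable, that is, the sequence is a path in `Q`. -/
def IsPath (γ : NPath Q₁) : Prop := γ.arrows.IsChain (fun x y => Q.tail x = Q.head y)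

/-- The head of a path. -/
def phead (γ : NPath Q₁) : Q₀ := Q.head γ.last

/-- The tail of a path. -/
def ptail (γ : NPath Q₁) : Q₀ := Q.tail γ.first

end Quiv

/-- A nontrivial path as an element of `RQ`. -/
noncomputable def pathElt (R : Type*) [CommRing R] {Q₀ Q₁ : Type*} [Fintype Q₀]
    (Q : Quiv Q₀ Q₁) (γ : NPath Q₁) : PathAlgebra R Q :=
  (γ.arrows.map (arrowElt R Q)).prod

/-- The standing data: a quiver `Q`, an ideal `𝓘` of `RQ` generated by a set `Z` of paths of
length two, and a surjective `R`-algebra homomorphism `ϑ : RQ → Λ` with `𝓘 ⊆ ker ϑ` and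
`ϑ(γ) ≠ 0` for every (trivial or nontrivial) path `γ ∉ 𝓘`. -/
structure Presentation (R Λ : Type*) [CommRing R] [Ring Λ] [Algebra R Λ]
    (Q₀ Q₁ : Type*) [Fintype Q₀] where
  Q : Quiv Q₀ Q₁
  Z : Set (Q₁ × Q₁)
  isPath_of_mem : ∀ p ∈ Z, Q.tail p.1 = Q.head p.2
  ϑ : PathAlgebra R Q →ₐ[R] Λ
  surjective : Function.Surjective ϑ
  map_ideal : ∀ a ∈ relIdeal R Q Z, ϑ a = 0
  map_vertex_ne : ∀ v : Q₀, vertexElt R Q v ∉ relIdeal R Q Z → ϑ (vertexElt R Q v) ≠ 0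
  map_path_ne : ∀ γ : NPath Q₁, Q.IsPath γ → pathElt R Q γ ∉ relIdeal R Q Z →
    ϑ (pathElt R Q γ) ≠ 0

/-- The left ideal `Λ a`. -/
abbrev leftIdeal {Λ : Type*} [Ring Λ] (a : Λ) : Submodule Λ Λ := Submodule.span Λ {a}

namespace Presentation

variable {R Λ : Type*} [CommRing R] [Ring Λ] [Algebra R Λ] {Q₀ Q₁ : Type*} [Fintype Q₀]
variable (𝔓 : Presentation R Λ Q₀ Q₁)

/-- The image in `Λ` of the trivial path at `v`. -/
noncomputable def e (v : Q₀) : Λ := 𝔓.ϑ (vertexElt R 𝔓.Q v)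

/-- The image in `Λ` of the arrow `x`. -/
noncomputable def arrow (x : Q₁) : Λ := 𝔓.ϑ (arrowElt R 𝔓.Q x)

/-- The image in `Λ` of a nontrivial path. -/
noncomputable def path (γ : NPath Q₁) : Λ := 𝔓.ϑ (pathElt R 𝔓.Q γ)

/-- `γ ∈ 𝐏`: the sequence `γ` is a nontrivial path of `Q` outside the ideal `𝓘`. -/
def IsP (γ : NPath Q₁) : Prop :=
  𝔓.Q.IsPath γ ∧ pathElt R 𝔓.Q γ ∉ relIdeal R 𝔓.Q 𝔓.Z

/-- `xy ∈ 𝐏`, for two arrows `x` and `y`. -/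
def PairP (x y : Q₁) : Prop := 𝔓.IsP ⟨x, [y]⟩

/-- `Λ` (with the presentation `𝔓`) is a complete gentle `R`-algebra. A submodule `M` is a maximal
submodule of `N` when `M ⋖ N`. Right modules are modules over `Λᵐᵒᵖ`. In `finite_left`,
`disjoint_left` (respectively `finite_right`, `disjoint_right`) the range of right (respectively
left) multiplication by `x` is `Λ x` (respectively `x Λ`). -/
structure IsCompleteGentle : Prop where
  card_tail : ∀ v : Q₀, {x : Q₁ | 𝔓.Q.tail x = v}.encard ≤ 2
  card_head : ∀ v : Q₀, {x : Q₁ | 𝔓.Q.head x = v}.encard ≤ 2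
  mem_left : ∀ y : Q₁, {x : Q₁ | 𝔓.Q.tail x = 𝔓.Q.head y ∧ 𝔓.PairP x y}.encard ≤ 1
  mem_right : ∀ y : Q₁, {z : Q₁ | 𝔓.Q.head z = 𝔓.Q.tail y ∧ 𝔓.PairP y z}.encard ≤ 1
  not_mem_left : ∀ y : Q₁, {x : Q₁ | 𝔓.Q.tail x = 𝔓.Q.head y ∧ ¬ 𝔓.PairP x y}.encard ≤ 1
  not_mem_right : ∀ y : Q₁, {z : Q₁ | 𝔓.Q.head z = 𝔓.Q.tail y ∧ ¬ 𝔓.PairP y z}.encard ≤ 1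
  maximal_left : ∀ (v : Q₀) (M : Submodule Λ Λ),
    M ⋖ Submodule.span Λ {𝔓.e v} ↔
      M = Submodule.span Λ {a | ∃ x : Q₁, 𝔓.Q.tail x = v ∧ a = 𝔓.arrow x}
  maximal_right : ∀ (v : Q₀) (M : Submodule Λᵐᵒᵖ Λ),
    M ⋖ Submodule.span Λᵐᵒᵖ {𝔓.e v} ↔
      M = Submodule.span Λᵐᵒᵖ {a | ∃ x : Q₁, 𝔓.Q.head x = v ∧ a = 𝔓.arrow x}
  finite_left : ∀ x : Q₁, (LinearMap.range (LinearMap.mulRight R (𝔓.arrow x))).FG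
  finite_right : ∀ x : Q₁, (LinearMap.range (LinearMap.mulLeft R (𝔓.arrow x))).FG
  disjoint_left : ∀ x y : Q₁, x ≠ y →
    LinearMap.range (LinearMap.mulRight R (𝔓.arrow x)) ⊓
      LinearMap.range (LinearMap.mulRight R (𝔓.arrow y)) = ⊥
  disjoint_right : ∀ x y : Q₁, x ≠ y →
    LinearMap.range (LinearMap.mulLeft R (𝔓.arrow x)) ⊓
      LinearMap.range (LinearMap.mulLeft R (𝔓.arrow y)) = ⊥

theorem e_mul_self (v : Q₀) : 𝔓.e v * 𝔓.e v = 𝔓.e v := by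
  unfold e vertexElt
  rw [← map_mul, ← map_mul]
  exact congrArg _ (RingQuot.mkAlgHom_rel R (PathRel.idem v))

theorem e_head_mul (x : Q₁) : 𝔓.e (𝔓.Q.head x) * 𝔓.arrow x = 𝔓.arrow x := by
  unfold e arrow vertexElt arrowElt
  rw [← map_mul, ← map_mul]
  exact congrArg _ (RingQuot.mkAlgHom_rel R (PathRel.head x))

theorem mul_e_tail (x : Q₁) : 𝔓.arrow x * 𝔓.e (𝔓.Q.tail x) = 𝔓.arrow x := by
  unfold e arrow vertexElt arrowElt
  rw [← map_mul, ← map_mul]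
  exact congrArg _ (RingQuot.mkAlgHom_rel R (PathRel.tail x))

theorem path_eq (γ : NPath Q₁) : 𝔓.path γ = (γ.arrows.map 𝔓.arrow).prod := by
  unfold path pathElt
  rw [map_list_prod, List.map_map]
  rfl

theorem path_eq_last (γ : NPath Q₁) :
    𝔓.path γ = 𝔓.arrow γ.last * (γ.rest.map 𝔓.arrow).prod := by
  rw [path_eq, NPath.arrows, List.map_cons, List.prod_cons]

theorem path_eq_first (γ : NPath Q₁) :
    𝔓.path γ = (γ.arrows.dropLast.map 𝔓.arrow).prod * 𝔓.arrow γ.first := by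
  rw [path_eq]
  conv_lhs => rw [← List.dropLast_append_getLast (l := γ.arrows) (List.cons_ne_nil _ _)]
  rw [List.map_append, List.prod_append]
  simp [NPath.first]

theorem e_mul_path (γ : NPath Q₁) : 𝔓.e (𝔓.Q.phead γ) * 𝔓.path γ = 𝔓.path γ := by
  rw [path_eq_last, Quiv.phead, ← mul_assoc, e_head_mul]

theorem path_mul_e (γ : NPath Q₁) : 𝔓.path γ * 𝔓.e (𝔓.Q.ptail γ) = 𝔓.path γ := by
  rw [path_eq_first, Quiv.ptail, mul_assoc, mul_e_tail]

theorem path_mul_path (γ σ : NPath Q₁) (h : 𝔓.arrow γ.first * 𝔓.arrow σ.last = 0) :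
    𝔓.path γ * 𝔓.path σ = 0 := by
  rw [path_eq_first 𝔓 γ, path_eq_last 𝔓 σ, mul_assoc, ← mul_assoc (𝔓.arrow γ.first), h]
  simp

end Presentation

/-! ## Sequences of letters -/

/-- The symbols `x` (direct) and `x⁻¹` (inverse). -/
inductive Letter (X : Type*)
  | dir (x : X)
  | inv (x : X)

namespace Letter

variable {X : Type*}

/-- The inverse of a letter. -/
def inverse : Letter X → Letter X
  | dir x => inv x
  | inv x => dir x

/-- The symbol underlying a letter. -/
def base : Letter X → X
  | dir x => x
  | inv x => x

end Letter

/-- Sequences of letters indexed by `I = {0}` (the symbols `1_{v,δ}`), `I = {0,…,m}` with `m > 0`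
(`C₁ ⋯ C_m`), `I = ℕ` (`C₁ C₂ ⋯`, where `right c` has `C_i = c (i - 1)`), `I = -ℕ`
(`⋯ C₋₁ C₀`, where `left c` has `C_i = c (-i)`) and `I = ℤ` (`⋯ C₋₁ C₀ ∣ C₁ C₂ ⋯`). -/
inductive Seq (Q₀ X : Type*)
  | triv (v : Q₀) (δ : ℤˣ)
  | fin (l : List (Letter X)) (h : l ≠ [])
  | right (c : ℕ → Letter X)
  | left (c : ℕ → Letter X)
  | bi (c : ℤ → Letter X)

namespace Seq

variable {Q₀ X : Type*}

/-- The index set `I`. -/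
def index : Seq Q₀ X → Set ℤ
  | triv _ _ => {0}
  | fin l _ => Set.Icc 0 (l.length : ℤ)
  | right _ => Set.Ici 0
  | left _ => Set.Iic 0
  | bi _ => Set.univ

/-- The letter `C_i`, if it exists (which is so exactly when `i - 1, i ∈ I`). -/
def letterAt : Seq Q₀ X → ℤ → Option (Letter X)
  | triv _ _, _ => none
  | fin l _, i => if 0 < i then l[(i - 1).toNat]? else none
  | right c, i => if 0 < i then some (c (i - 1).toNat) else none
  | left c, i => if i ≤ 0 then some (c (-i).toNat) else none
  | bi c, i => some (c i)

/-- The inverse of a sequence. -/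
def inverse : Seq Q₀ X → Seq Q₀ X
  | triv v δ => triv v (-δ)
  | fin l h => fin (l.reverse.map Letter.inverse) (by simpa using h)
  | right c => left (fun n => (c n).inverse)
  | left c => right (fun n => (c n).inverse)
  | bi c => bi (fun i => (c (1 - i)).inverse)

/-- Concatenation of a sequence indexed by a finite set or `-ℕ` with a sequence indexed by a finite
set or `ℕ`. The value in the remaining cases is irrelevant. -/
def comp : Seq Q₀ X → Seq Q₀ X → Seq Q₀ X
  | triv _ _, D => D
  | C, triv _ _ => C
  | fin l h, fin m _ => fin (l ++ m) (by simp [h])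
  | fin l _, right d => right (fun n => if h : n < l.length then l[n] else d (n - l.length))
  | left c, fin m _ => left (fun n => (m.reverse[n]?).getD (c (n - m.length)))
  | left c, right d => bi (fun i => if 0 < i then d (i - 1).toNat else c (-i).toNat)
  | C, _ => C

/-- The head of a sequence with `I ⊆ ℕ`, in terms of the heads of letters. -/
def headV (hd : Letter X → Q₀) : Seq Q₀ X → Option Q₀
  | triv v _ => some v
  | fin l _ => l.head?.map hd
  | right c => some (hd (c 0))
  | left _ => none
  | bi _ => none

/-- The sign of a sequence with `I ⊆ ℕ`, in terms of the signs of letters. -/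
def sign (s : Letter X → ℤˣ) : Seq Q₀ X → Option ℤˣ
  | triv _ δ => some δ
  | fin l _ => l.head?.map s
  | right c => some (s (c 0))
  | left _ => none
  | bi _ => none

/-- `B` and `D` are composable: `h(B⁻¹) = h(D)` and `s(B⁻¹) = -s(D)`. -/
def Composable (hd : Letter X → Q₀) (s : Letter X → ℤˣ) (B D : Seq Q₀ X) : Prop :=
  (∃ v, B.inverse.headV hd = some v ∧ D.headV hd = some v) ∧
    ∃ ε, B.inverse.sign s = some (-ε) ∧ D.sign s = some ε

/-- The vertex associated with `i ∈ I`: the tail of `C_i` or the head of `C_{i+1}`, whichever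
exists, and `v` for the sequence `1_{v,δ}`. It is `none` for `i ∉ I`. -/
def vertex (hd tl : Letter X → Q₀) (C : Seq Q₀ X) (i : ℤ) : Option Q₀ :=
  match C with
  | triv v _ => if i = 0 then some v else none
  | C => (C.letterAt i).elim ((C.letterAt (i + 1)).map hd) fun l => some (tl l)

/-- The `ℤ`-indexed periodic sequence `⋯ l ∣ l l ⋯`. -/
def periodic (l : List (Letter X)) (h : l ≠ []) (i : ℤ) : Letter X :=
  l[((i - 1) % (l.length : ℤ)).toNat]'(by
    have h1 : 0 < (l.length : ℤ) := by
      exact_mod_cast List.length_pos_iff.mpr h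
    have h2 := Int.emod_nonneg (i - 1) h1.ne'
    have h3 := Int.emod_lt_of_pos (i - 1) h1
    omega)

/-- All letters are inverse (in particular, this holds for a trivial sequence). -/
def IsTrivialOrInverse (B : Seq Q₀ X) : Prop :=
  ∀ (i : ℤ) (l : Letter X), B.letterAt i = some l → ∃ x, l = .inv x

end Seq

/-- Words: letters are direct or inverse arrows. -/
abbrev Word (Q₀ Q₁ : Type*) := Seq Q₀ Q₁

/-- Generalised words: the letters `⟨γ⟩` and `⟨γ⟩⁻¹` come from paths. -/
abbrev GWord (Q₀ Q₁ : Type*) := Seq Q₀ (NPath Q₁)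

namespace Quiv

variable {Q₀ Q₁ : Type*} (Q : Quiv Q₀ Q₁)

/-- The head of a letter. -/
def lhead : Letter Q₁ → Q₀
  | .dir x => Q.head x
  | .inv x => Q.tail x

/-- The tail of a letter. -/
def ltail : Letter Q₁ → Q₀
  | .dir x => Q.tail x
  | .inv x => Q.head x

/-- The head of a generalised letter: `h(⟨γ⟩) = t(γ)` and `h(⟨γ⟩⁻¹) = h(γ)`. -/
def ghead : Letter (NPath Q₁) → Q₀
  | .dir γ => Q.ptail γ
  | .inv γ => Q.phead γ

/-- The tail of a generalised letter: `t(⟨γ⟩) = h(γ)` and `t(⟨γ⟩⁻¹) = t(γ)`. -/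
def gtail : Letter (NPath Q₁) → Q₀
  | .dir γ => Q.phead γ
  | .inv γ => Q.ptail γ

end Quiv

/-! ## The data from which words are built -/

/-- The letters of the word `γ₁⁻¹ σ₁ ⋯ γₙ⁻¹ σₙ`. -/
def blockLetters {Q₁ : Type*} (bs : List (NPath Q₁ × NPath Q₁)) : List (Letter Q₁) :=
  bs.flatMap fun p => p.1.arrows.reverse.map Letter.inv ++ p.2.arrows.map Letter.dir

/-- The generalised letters of `⟨γ₁⟩ ⟨σ₁⟩⁻¹ ⋯ ⟨γₙ⟩ ⟨σₙ⟩⁻¹`. -/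
def blockGLetters {Q₁ : Type*} (bs : List (NPath Q₁ × NPath Q₁)) : List (Letter (NPath Q₁)) :=
  bs.flatMap fun p => [Letter.dir p.1, Letter.inv p.2]

theorem blockLetters_ne_nil {Q₁ : Type*} {bs : List (NPath Q₁ × NPath Q₁)} (h : bs ≠ []) :
    blockLetters bs ≠ [] := by
  cases bs with
  | nil => exact absurd rfl h
  | cons p t => simp [blockLetters, NPath.arrows]

theorem blockGLetters_ne_nil {Q₁ : Type*} {bs : List (NPath Q₁ × NPath Q₁)} (h : bs ≠ []) :
    blockGLetters bs ≠ [] := by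
  cases bs with
  | nil => exact absurd rfl h
  | cons p t => simp [blockGLetters]

/-- The middle part of a string word: either a trivial word `1_{v,ε}`, or the list
`(γ₁, σ₁), …, (γₙ, σₙ)` with `n ≥ 1` describing an alternating word `γ₁⁻¹ σ₁ ⋯ γₙ⁻¹ σₙ`. -/
inductive Core (Q₀ Q₁ : Type*)
  | triv (v : Q₀) (ε : ℤˣ)
  | alt (bs : List (NPath Q₁ × NPath Q₁)) (h : bs ≠ [])

namespace Core

variable {Q₀ Q₁ : Type*}

/-- The list `(γ₁, σ₁), …, (γₙ, σₙ)`; it is empty for a trivial word. -/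
def blocks : Core Q₀ Q₁ → List (NPath Q₁ × NPath Q₁)
  | triv _ _ => []
  | alt bs _ => bs

/-- The word `A`. -/
def toWord : Core Q₀ Q₁ → Word Q₀ Q₁
  | triv v ε => .triv v ε
  | alt bs h => .fin (blockLetters bs) (blockLetters_ne_nil h)

/-- The generalised word `𝒜`: it is `⟨1_{v,ε}⟩` if `A = 1_{v,ε}`, and
`⟨γ₁⟩ ⟨σ₁⟩⁻¹ ⋯ ⟨γₙ⟩ ⟨σₙ⟩⁻¹` if `A = γ₁⁻¹ σ₁ ⋯ γₙ⁻¹ σₙ`. -/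
def toGWord : Core Q₀ Q₁ → GWord Q₀ Q₁
  | triv v ε => .triv v ε
  | alt bs h => .fin (blockGLetters bs) (blockGLetters_ne_nil h)

/-- The vertex at the `i`-th peak, `0 ≤ i ≤ n`. The peaks of `B⁻¹ A D` are the two ends of `A` and
the places between `σᵢ` and `γᵢ₊₁⁻¹`; the vertex there is `t(γᵢ₊₁)` if `i < n`, and `t(σₙ)` if
`i = n`. -/
def peakVertex (Q : Quiv Q₀ Q₁) (A : Core Q₀ Q₁) (i : ℕ) : Q₀ :=
  match A with
  | triv v _ => v
  | alt bs h =>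
    match bs[i]? with
    | some p => Q.ptail p.1
    | none => Q.ptail (bs.getLast h).2

end Core

/-! ## Words and generalised words over a complete gentle algebra -/

namespace Presentation

variable {R Λ : Type*} [CommRing R] [Ring Λ] [Algebra R Λ] {Q₀ Q₁ : Type*} [Fintype Q₀]
variable (𝔓 : Presentation R Λ Q₀ Q₁)

/-- A choice of signs: distinct letters with the same head and the same sign are `x⁻¹` and `y` with
`xy ∈ 𝓘` a path of length two. -/
def IsSign (s : Letter Q₁ → ℤˣ) : Prop :=
  ∀ l l' : Letter Q₁, l ≠ l' → 𝔓.Q.lhead l = 𝔓.Q.lhead l' → s l = s l' →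
    ∃ x y : Q₁, (l = .inv x ∧ l' = .dir y ∨ l = .dir y ∧ l' = .inv x) ∧
      𝔓.Q.tail x = 𝔓.Q.head y ∧ arrowElt R 𝔓.Q x * arrowElt R 𝔓.Q y ∈ relIdeal R 𝔓.Q 𝔓.Z

/-- The sequence `C` is a word. In `path_mem` (respectively `path_inv_mem`) the consecutive letters
`C_i ⋯ C_{i+n}` form a path `γ` (respectively the inverse of a path `γ`). -/
structure IsWord (C : Word Q₀ Q₁) : Prop where
  adjacent : ∀ (i : ℤ) (l l' : Letter Q₁), C.letterAt i = some l → C.letterAt (i + 1) = some l' →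
    𝔓.Q.ltail l = 𝔓.Q.lhead l' ∧ l.inverse ≠ l'
  path_mem : ∀ (i : ℤ) (γ : NPath Q₁),
    (∀ (j : ℕ) (hj : j < γ.arrows.length),
      C.letterAt (i + j) = some (.dir γ.arrows[j])) → 𝔓.IsP γ
  path_inv_mem : ∀ (i : ℤ) (γ : NPath Q₁),
    (∀ (j : ℕ) (hj : j < γ.arrows.reverse.length),
      C.letterAt (i + j) = some (.inv γ.arrows.reverse[j])) → 𝔓.IsP γ

/-- The condition on two consecutive generalised letters of a generalised word. -/
def GAdjacent : Letter (NPath Q₁) → Letter (NPath Q₁) → Prop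
  | .dir γ, .inv σ => 𝔓.Q.phead γ = 𝔓.Q.phead σ ∧ γ.last ≠ σ.last
  | .inv γ, .inv σ => 𝔓.Q.ptail γ = 𝔓.Q.phead σ ∧ 𝔓.arrow γ.first * 𝔓.arrow σ.last = 0
  | .inv γ, .dir σ => 𝔓.Q.ptail γ = 𝔓.Q.ptail σ ∧ γ.first ≠ σ.first
  | .dir γ, .dir σ => 𝔓.Q.phead γ = 𝔓.Q.ptail σ ∧ 𝔓.arrow σ.first * 𝔓.arrow γ.last = 0

/-- The sequence `𝒞` is a generalised word. -/
structure IsGWord (𝒞 : GWord Q₀ Q₁) : Prop where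
  mem : ∀ (i : ℤ) (l : Letter (NPath Q₁)), 𝒞.letterAt i = some l → 𝔓.IsP l.base
  adjacent : ∀ (i : ℤ) (l l' : Letter (NPath Q₁)), 𝒞.letterAt i = some l →
    𝒞.letterAt (i + 1) = some l' → 𝔓.GAdjacent l l'

/-- `C` is a string word with decomposition `(B, A, D)`: `C = B⁻¹ (A D)` is a word, where `A` is
trivial or alternating, and each of `B` and `D` is trivial or inverse. -/
structure IsStringWord (s : Letter Q₁ → ℤˣ) (C B : Word Q₀ Q₁) (A : Core Q₀ Q₁)
    (D : Word Q₀ Q₁) : Prop where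
  word_left : 𝔓.IsWord B
  word_core : 𝔓.IsWord A.toWord
  word_right : 𝔓.IsWord D
  inverse_left : B.IsTrivialOrInverse
  inverse_right : D.IsTrivialOrInverse
  blocks_mem : ∀ p ∈ A.blocks, 𝔓.IsP p.1 ∧ 𝔓.IsP p.2
  composable_right : Seq.Composable 𝔓.Q.lhead s A.toWord D
  composable_left : Seq.Composable 𝔓.Q.lhead s B.inverse (A.toWord.comp D)
  eq : C = B.inverse.comp (A.toWord.comp D)
  word : 𝔓.IsWord C

/-- The word `A` is cyclic: `A²` is a word, and `A` is not a proper power of a word. -/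
def IsCyclic (l : List (Letter Q₁)) (h : l ≠ []) : Prop :=
  𝔓.IsWord (Seq.fin (Q₀ := Q₀) (l ++ l) (by simp [h])) ∧
    ¬ ∃ (m : List (Letter Q₁)) (hm : m ≠ []) (k : ℕ), 𝔓.IsWord (Seq.fin (Q₀ := Q₀) m hm) ∧ 2 ≤ k ∧
      l = (List.replicate k m).flatten

/-- `C` is a band word with cycle `γ₁⁻¹ σ₁ ⋯ γₙ⁻¹ σₙ`, the list `bs` consisting of the pairs
`(γᵢ, σᵢ)`. (As the cycle has both direct and inverse letters, such a `C` is automatically periodic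
and not primitive.) -/
structure IsBandWord (C : Word Q₀ Q₁) (bs : List (NPath Q₁ × NPath Q₁)) (h : bs ≠ []) : Prop where
  blocks_mem : ∀ p ∈ bs, 𝔓.IsP p.1 ∧ 𝔓.IsP p.2
  cyclic : 𝔓.IsCyclic (blockLetters bs) (blockLetters_ne_nil h)
  eq : C = .bi (Seq.periodic (blockLetters bs) (blockLetters_ne_nil h))
  word : 𝔓.IsWord C

/-- `B b⁻¹` is a word. -/
def Extends (s : Letter Q₁ → ℤˣ) (B : Word Q₀ Q₁) (b : Q₁) : Prop :=
  Seq.Composable 𝔓.Q.lhead s B (.fin [.inv b] (by simp)) ∧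
    𝔓.IsWord (B.comp (.fin [.inv b] (by simp)))

end Presentation

/-- For a finite trivial or inverse word `B = b₁⁻¹ ⋯ b_m⁻¹`, the path `b B⁻¹ = b b_m ⋯ b₁`. -/
def extPath {Q₀ Q₁ : Type*} (B : Word Q₀ Q₁) (b : Q₁) : NPath Q₁ :=
  ⟨b, match B with
    | .fin l _ => (l.map Letter.base).reverse
    | _ => []⟩

/-! ## Direct sums of modules `Λ e` -/

section FreeOn

variable {Λ : Type*} [Ring Λ] {ι : Type*}

/-- The left module `⨁ᵢ Λ eᵢ`. -/
abbrev FreeOn (e : ι → Λ) : Type _ := DirectSum ι fun i => leftIdeal (e i)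

namespace FreeOn

variable {e : ι → Λ} {X : Type*} [AddCommGroup X] [Module Λ X]

open Classical in
/-- The generator `gᵢ = eᵢ` of the summand `Λ eᵢ`. -/
noncomputable def gen (e : ι → Λ) (i : ι) : FreeOn e :=
  DirectSum.lof Λ ι (fun i => leftIdeal (e i)) i ⟨e i, Submodule.mem_span_singleton_self _⟩

open Classical in
/-- The `Λ`-linear map which sends `λ ∈ Λ eᵢ` to `λ • y i`. When `eᵢ` is idempotent and
`eᵢ • y i = y i`, this is the `Λ`-linear extension of `gᵢ ↦ y i`. -/
noncomputable def lift (e : ι → Λ) (y : ι → X) : FreeOn e →ₗ[Λ] X :=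
  DirectSum.toModule Λ ι X fun i =>
    (LinearMap.toSpanSingleton Λ X (y i)).comp (Submodule.subtype (leftIdeal (e i)))

theorem lift_gen (y : ι → X) (i : ι) : lift e y (gen e i) = e i • y i := by
  classical
  simp [lift, gen]

theorem hom_ext {f g : FreeOn e →ₗ[Λ] X} (h : ∀ i, f (gen e i) = g (gen e i)) : f = g := by
  classical
  refine DirectSum.linearMap_ext Λ fun i => ?_
  ext ⟨a, ha⟩
  obtain ⟨r, rfl⟩ := Submodule.mem_span_singleton.mp ha
  have h1 : (⟨r • e i, ha⟩ : leftIdeal (e i)) =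
      r • ⟨e i, Submodule.mem_span_singleton_self _⟩ := rfl
  have h2 : DirectSum.lof Λ ι (fun i => leftIdeal (e i)) i ⟨r • e i, ha⟩ = r • gen e i := by
    rw [h1, map_smul]; rfl
  simp only [LinearMap.comp_apply, h2, map_smul, h i]

theorem smul_gen (he : ∀ i, e i * e i = e i) (i : ι) : e i • gen e i = gen e i := by
  classical
  rw [gen, ← map_smul]
  congr 1
  exact Subtype.ext (he i)

end FreeOn

end FreeOn

/-! ## Bimodules over `Λ` and `R[T;T⁻¹]` -/

section Laurent

variable (R : Type*) {Λ : Type*} [CommRing R] [Ring Λ] [Algebra R Λ]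
variable {X : Type*} [AddCommGroup X] [Module Λ X]
variable {Y : Type*} [AddCommGroup Y] [Module Λ Y]
variable {Z : Type*} [AddCommGroup Z] [Module Λ Z]

/-- Multiplication by elements of `R` on a `Λ`-module. -/
def scalarEnd (X : Type*) [AddCommGroup X] [Module Λ X] : R →+* Module.End Λ X where
  toFun r :=
    { toFun := fun x => algebraMap R Λ r • x
      map_add' := fun x y => smul_add _ x y
      map_smul' := fun a x => by
        simp only [RingHom.id_apply, smul_smul, Algebra.commutes] }
  map_one' := by ext; simp
  map_mul' r r' := by
    ext x
    change algebraMap R Λ (r * r') • x = algebraMap R Λ r • algebraMap R Λ r' • x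
    rw [map_mul, mul_smul]
  map_zero' := by ext; simp
  map_add' r r' := by ext; simp [add_smul]

/-- The ring homomorphism `R[T;T⁻¹] → End_Λ(X)` which sends `T` to the automorphism `τ`. -/
noncomputable def laurentEnd (τ : X ≃ₗ[Λ] X) : R[T;T⁻¹] →+* Module.End Λ X :=
  AddMonoidAlgebra.liftNCRingHom (scalarEnd R X)
    ((Units.coeHom (Module.End Λ X)).comp
      (zpowersHom (Module.End Λ X)ˣ ((LinearMap.GeneralLinearGroup.generalLinearEquiv Λ X).symm τ)))
    (fun r n => by
      ext x
      exact (((((zpowersHom (Module.End Λ X)ˣ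
        ((LinearMap.GeneralLinearGroup.generalLinearEquiv Λ X).symm τ)) n :
          (Module.End Λ X)ˣ) : Module.End Λ X)).map_smul (algebraMap R Λ r) x).symm)

/-- The `Λ`-module `X`, on which `R[T;T⁻¹]` acts so that `T` acts by the automorphism `τ`. -/
@[nolint unusedArguments]
def Laurent (_R : Type*) {Λ : Type*} [Ring Λ] {X : Type*} [AddCommGroup X] [Module Λ X]
    (_τ : X ≃ₗ[Λ] X) : Type _ := X

variable (τ : X ≃ₗ[Λ] X) (τ' : Y ≃ₗ[Λ] Y) (τ'' : Z ≃ₗ[Λ] Z)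

instance : AddCommGroup (Laurent R τ) := inferInstanceAs (AddCommGroup X)

instance : Module Λ (Laurent R τ) := inferInstanceAs (Module Λ X)

noncomputable instance : Module R[T;T⁻¹] (Laurent R τ) :=
  Module.compHom X (laurentEnd R τ)

theorem laurent_smul_def (a : R[T;T⁻¹]) (x : Laurent R τ) :
    a • x = (laurentEnd R τ a : X →ₗ[Λ] X) x := rfl

theorem laurentEnd_C (r : R) (x : X) :
    laurentEnd R τ (LaurentPolynomial.C r) x = algebraMap R Λ r • x := by
  change laurentEnd R τ (AddMonoidAlgebra.single 0 r) x = _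
  rw [laurentEnd]
  erw [AddMonoidAlgebra.liftNCRingHom_single]
  simp [scalarEnd]

theorem laurentEnd_T (x : X) : laurentEnd R τ (LaurentPolynomial.T 1) x = τ x := by
  change laurentEnd R τ (AddMonoidAlgebra.single 1 1) x = _
  rw [laurentEnd]
  erw [AddMonoidAlgebra.liftNCRingHom_single]
  simp
  rfl

instance : SMulCommClass R[T;T⁻¹] Λ (Laurent R τ) where
  smul_comm a l x := (laurentEnd R τ a).map_smul l x

variable {R}

theorem laurent_map_smul (f : X →ₗ[Λ] Y) (hf : ∀ x, f (τ x) = τ' (f x)) (a : R[T;T⁻¹]) (x : X) :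
    f (laurentEnd R τ a x) = laurentEnd R τ' a (f x) := by
  have hT : ∀ x, f (laurentEnd R τ (LaurentPolynomial.T (-1)) x) =
      laurentEnd R τ' (LaurentPolynomial.T (-1)) (f x) := by
    intro x
    have h1 : ∀ x, laurentEnd R τ (LaurentPolynomial.T 1)
        (laurentEnd R τ (LaurentPolynomial.T (-1)) x) = x := by
      intro x
      rw [← Module.End.mul_apply, ← map_mul, ← LaurentPolynomial.T_add]
      simp
    have h2 : ∀ y, laurentEnd R τ' (LaurentPolynomial.T 1)
        (laurentEnd R τ' (LaurentPolynomial.T (-1)) y) = y := by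
      intro x
      rw [← Module.End.mul_apply, ← map_mul, ← LaurentPolynomial.T_add]
      simp
    apply τ'.injective
    rw [← hf, ← laurentEnd_T R τ, h1, ← laurentEnd_T R τ', h2]
  have key : ∀ (n : ℤ) (x : X), f (laurentEnd R τ (LaurentPolynomial.T n) x) =
      laurentEnd R τ' (LaurentPolynomial.T n) (f x) := by
    intro n
    induction n using Int.induction_on with
    | zero => intro x; simp
    | succ n ih =>
      intro x
      rw [LaurentPolynomial.T_add, map_mul, map_mul, Module.End.mul_apply, Module.End.mul_apply,
        ih, laurentEnd_T, laurentEnd_T, hf]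
    | pred n ih =>
      intro x
      rw [sub_eq_add_neg, LaurentPolynomial.T_add, map_mul, map_mul, Module.End.mul_apply,
        Module.End.mul_apply, ih, hT]
  induction a using LaurentPolynomial.induction_on' generalizing x with
  | add p q hp hq => simp [hp, hq]
  | C_mul_T n r =>
    rw [map_mul, map_mul, Module.End.mul_apply, Module.End.mul_apply, laurentEnd_C, laurentEnd_C,
      map_smul, key]

variable (W : Type*) [AddCommGroup W] [Module R[T;T⁻¹] W]

/-- The left `Λ`-linear map `f ⊗ 1 : X ⊗ W → Y ⊗ W`, the tensor products being over `R[T;T⁻¹]`, for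
a `Λ`-linear map `f : X → Y` which commutes with the action of `T`. -/
noncomputable def laurentMap (f : X →ₗ[Λ] Y) (hf : ∀ x, f (τ x) = τ' (f x)) :
    (Laurent R τ ⊗[R[T;T⁻¹]] W) →ₗ[Λ] (Laurent R τ' ⊗[R[T;T⁻¹]] W) :=
  let g : Laurent R τ →ₗ[R[T;T⁻¹]] Laurent R τ' :=
    { toFun := fun x => f x
      map_add' := fun x y => map_add f x y
      map_smul' := fun a x => laurent_map_smul τ τ' f hf a x }
  { toFun := g.rTensor W
    map_add' := map_add _
    map_smul' := fun l z => by
      induction z using TensorProduct.induction_on with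
      | zero => simp
      | tmul x w =>
        simp only [TensorProduct.smul_tmul', LinearMap.rTensor_tmul, RingHom.id_apply]
        congr 1
        exact map_smul f l x
      | add x y hx hy => rw [smul_add, map_add, hx, hy, map_add, smul_add] }

theorem laurentMap_tmul (f : X →ₗ[Λ] Y) (hf : ∀ x, f (τ x) = τ' (f x)) (x : X) (w : W) :
    laurentMap (R := R) τ τ' W f hf ((show Laurent R τ from x) ⊗ₜ w) =
      (show Laurent R τ' from f x) ⊗ₜ w := rfl

theorem laurentMap_comp_eq_zero (f : X →ₗ[Λ] Y) (hf : ∀ x, f (τ x) = τ' (f x))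
    (g : Y →ₗ[Λ] Z) (hg : ∀ y, g (τ' y) = τ'' (g y)) (h : ∀ x, g (f x) = 0) :
    (laurentMap (R := R) τ' τ'' W g hg).comp (laurentMap (R := R) τ τ' W f hf) = 0 := by
  refine LinearMap.ext fun z => ?_
  induction z using TensorProduct.induction_on with
  | zero => simp
  | tmul x w =>
    have h1 : (show Laurent R τ'' from g (f x)) = 0 := h x
    exact (congrArg (fun y => y ⊗ₜ[R[T;T⁻¹]] w) h1).trans (TensorProduct.zero_tmul _ _)
  | add x y hx hy => rw [map_add, hx, hy, map_add]

/-- The ring endomorphism of `R[T;T⁻¹]` which fixes `R` and sends `T` to `(-1)ⁿ T`. -/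
noncomputable def signHom (R : Type*) [CommRing R] (n : ℕ) : R[T;T⁻¹] →+* R[T;T⁻¹] :=
  (AddMonoidAlgebra.lift R R[T;T⁻¹] ℤ
    ((Units.coeHom R[T;T⁻¹]).comp (zpowersHom R[T;T⁻¹]ˣ
      ((-1) ^ n * (LaurentPolynomial.isUnit_T (R := R) 1).unit)))).toRingHom

/-- The module `W` over `R[T;T⁻¹]`, with the action of `T` replaced by that of `(-1)ⁿ T`. -/
@[nolint unusedArguments]
def SignTwist (_R : Type*) (_n : ℕ) (W : Type*) : Type _ := W

instance (n : ℕ) : AddCommGroup (SignTwist R n W) := inferInstanceAs (AddCommGroup W)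

noncomputable instance (n : ℕ) : Module R[T;T⁻¹] (SignTwist R n W) :=
  Module.compHom W (signHom R n)

theorem signTwist_smul_def (n : ℕ) (a : R[T;T⁻¹]) (w : SignTwist R n W) :
    a • w = (signHom R n a • (show W from w) : W) := rfl

theorem signHom_T (R : Type*) [CommRing R] (n : ℕ) :
    signHom R n (LaurentPolynomial.T 1) = (-1) ^ n * LaurentPolynomial.T 1 := by
  change AddMonoidAlgebra.lift R R[T;T⁻¹] ℤ _ (AddMonoidAlgebra.single 1 1) = _
  erw [AddMonoidAlgebra.lift_single]
  simp

theorem signHom_C (R : Type*) [CommRing R] (n : ℕ) (r : R) :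
    signHom R n (LaurentPolynomial.C r) = LaurentPolynomial.C r := by
  change AddMonoidAlgebra.lift R R[T;T⁻¹] ℤ _ (AddMonoidAlgebra.single 0 r) = _
  erw [AddMonoidAlgebra.lift_single]
  simp [LaurentPolynomial.smul_eq_C_mul]

end Laurent

/-! ## String modules and band modules -/

namespace Presentation

variable {R Λ : Type*} [CommRing R] [Ring Λ] [Algebra R Λ] {Q₀ Q₁ : Type*} [Fintype Q₀]
variable (𝔓 : Presentation R Λ Q₀ Q₁)

/-- The idempotents `g_{C,0}, …, g_{C,n}` attached to the peaks of a string word. -/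
noncomputable def peakIdem (A : Core Q₀ Q₁) (i : Fin (A.blocks.length + 1)) : Λ :=
  𝔓.e (A.peakVertex 𝔓.Q i)

/-- `N(C) = ⨁ Λ g_{C,i}`, the sum over the peaks of a string word. -/
abbrev stringN (A : Core Q₀ Q₁) : Type _ := FreeOn (𝔓.peakIdem A)

/-- `L₋(C)`: it is `Λ w B⁻¹ g_{C,0}` if `w` is an arrow such that `B w⁻¹` is a word, and zero if
there is no such arrow. -/
noncomputable def stringLeft (s : Letter Q₁ → ℤˣ) (B : Word Q₀ Q₁) (A : Core Q₀ Q₁) :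
    Submodule Λ (𝔓.stringN A) :=
  Submodule.span Λ {z | ∃ w : Q₁, 𝔓.Extends s B w ∧
    z = 𝔓.path (extPath B w) • FreeOn.gen (𝔓.peakIdem A) 0}

/-- `L₊(C)`: it is `Λ z D⁻¹ g_{C,n}` if `z` is an arrow such that `D z⁻¹` is a word, and zero if
there is no such arrow. -/
noncomputable def stringRight (s : Letter Q₁ → ℤˣ) (A : Core Q₀ Q₁) (D : Word Q₀ Q₁) :
    Submodule Λ (𝔓.stringN A) :=
  Submodule.span Λ {z | ∃ d : Q₁, 𝔓.Extends s D d ∧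
    z = 𝔓.path (extPath D d) • FreeOn.gen (𝔓.peakIdem A) (Fin.last _)}

/-- `L₀(C) = ∑ Λ (γᵢ₊₁ g_{C,i} - σᵢ₊₁ g_{C,i+1})`. -/
noncomputable def stringMiddle (A : Core Q₀ Q₁) : Submodule Λ (𝔓.stringN A) :=
  Submodule.span Λ {z | ∃ i : Fin A.blocks.length,
    z = 𝔓.path (A.blocks[i]).1 • FreeOn.gen (𝔓.peakIdem A) i.castSucc -
      𝔓.path (A.blocks[i]).2 • FreeOn.gen (𝔓.peakIdem A) i.succ}

/-- The string module `M(C) = N(C) / L(C)` of the string word with decomposition `(B, A, D)`. -/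
abbrev StringModule (s : Letter Q₁ → ℤˣ) (B : Word Q₀ Q₁) (A : Core Q₀ Q₁) (D : Word Q₀ Q₁) :
    Type _ :=
  𝔓.stringN A ⧸ (𝔓.stringLeft s B A ⊔ 𝔓.stringMiddle A ⊔ 𝔓.stringRight s A D)

end Presentation

/-- For a nonempty list `(γ₁, σ₁), …, (γₙ, σₙ)` and `i ∈ ℤ`, the pair `(γᵢ₊₁, σᵢ₊₁)`, where indices
are read modulo `n`. -/
def blockAt {Q₁ : Type*} (bs : List (NPath Q₁ × NPath Q₁)) (h : bs ≠ []) (i : ℤ) :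
    NPath Q₁ × NPath Q₁ :=
  bs[(i % (bs.length : ℤ)).toNat]'(by
    have h1 : 0 < (bs.length : ℤ) := by
      exact_mod_cast List.length_pos_iff.mpr h
    have h2 := Int.emod_nonneg i h1.ne'
    have h3 := Int.emod_lt_of_pos i h1
    omega)

theorem blockAt_add {Q₁ : Type*} (bs : List (NPath Q₁ × NPath Q₁)) (h : bs ≠ []) (i : ℤ) :
    blockAt bs h (i + bs.length) = blockAt bs h i := by
  simp [blockAt]

theorem blockAt_sub {Q₁ : Type*} (bs : List (NPath Q₁ × NPath Q₁)) (h : bs ≠ []) (i : ℤ) :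
    blockAt bs h (i - bs.length) = blockAt bs h i := by
  rw [← blockAt_add, sub_add_cancel]

namespace Presentation

variable {R Λ : Type*} [CommRing R] [Ring Λ] [Algebra R Λ] {Q₀ Q₁ : Type*} [Fintype Q₀]
variable (𝔓 : Presentation R Λ Q₀ Q₁)
variable (bs : List (NPath Q₁ × NPath Q₁)) (h : bs ≠ [])

/-- The idempotents `g_{C,i}`, `i ∈ ℤ`, attached to the peaks of a band word: the `i`-th peak is the
place before `γᵢ₊₁⁻¹`, and the vertex there is `t(γᵢ₊₁)`. -/
noncomputable def bandIdem (i : ℤ) : Λ := 𝔓.e (𝔓.Q.ptail (blockAt bs h i).1)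

/-- `N(C) = ⨁_{i ∈ ℤ} Λ g_{C,i}` for a band word. -/
abbrev bandN : Type _ := FreeOn (𝔓.bandIdem bs h)

/-- The element `γᵢ₊₁ g_{C,i} - σᵢ₊₁ g_{C,i+1}`. -/
noncomputable def bandRel (i : ℤ) : 𝔓.bandN bs h :=
  𝔓.path (blockAt bs h i).1 • FreeOn.gen (𝔓.bandIdem bs h) i -
    𝔓.path (blockAt bs h i).2 • FreeOn.gen (𝔓.bandIdem bs h) (i + 1)

/-- `L(C) = ∑_{i ∈ ℤ} Λ (γᵢ₊₁ g_{C,i} - σᵢ₊₁ g_{C,i+1})` for a band word. -/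
noncomputable def bandL : Submodule Λ (𝔓.bandN bs h) :=
  Submodule.span Λ (Set.range (𝔓.bandRel bs h))

theorem band_smul_gen_add (i : ℤ) :
    𝔓.bandIdem bs h i • FreeOn.gen (𝔓.bandIdem bs h) (i + bs.length) =
      FreeOn.gen (𝔓.bandIdem bs h) (i + bs.length) := by
  have : 𝔓.bandIdem bs h i = 𝔓.bandIdem bs h (i + bs.length) := by
    rw [bandIdem, bandIdem, blockAt_add]
  rw [this]
  exact FreeOn.smul_gen (fun _ => 𝔓.e_mul_self _) _

theorem band_smul_gen_sub (i : ℤ) :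
    𝔓.bandIdem bs h i • FreeOn.gen (𝔓.bandIdem bs h) (i - bs.length) =
      FreeOn.gen (𝔓.bandIdem bs h) (i - bs.length) := by
  have : 𝔓.bandIdem bs h i = 𝔓.bandIdem bs h (i - bs.length) := by
    rw [bandIdem, bandIdem, blockAt_sub]
  rw [this]
  exact FreeOn.smul_gen (fun _ => 𝔓.e_mul_self _) _

/-- The automorphism `g_{C,i} ↦ g_{C,i-n}` of `N(C)`. -/
noncomputable def bandShiftN : 𝔓.bandN bs h ≃ₗ[Λ] 𝔓.bandN bs h :=
  LinearEquiv.ofLinearMap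
    (FreeOn.lift _ fun i => FreeOn.gen (𝔓.bandIdem bs h) (i - bs.length))
    (FreeOn.lift _ fun i => FreeOn.gen (𝔓.bandIdem bs h) (i + bs.length))
    (FreeOn.hom_ext fun i => by
      rw [LinearMap.comp_apply, FreeOn.lift_gen, band_smul_gen_add, FreeOn.lift_gen,
        band_smul_gen_sub, add_sub_cancel_right, LinearMap.id_apply])
    (FreeOn.hom_ext fun i => by
      rw [LinearMap.comp_apply, FreeOn.lift_gen, band_smul_gen_sub, FreeOn.lift_gen,
        band_smul_gen_add, sub_add_cancel, LinearMap.id_apply])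

theorem bandShiftN_gen (i : ℤ) : 𝔓.bandShiftN bs h (FreeOn.gen (𝔓.bandIdem bs h) i) =
    FreeOn.gen (𝔓.bandIdem bs h) (i - bs.length) := by
  rw [bandShiftN, LinearEquiv.coe_ofLinearMap, FreeOn.lift_gen, band_smul_gen_sub]

theorem bandShiftN_rel (i : ℤ) : 𝔓.bandShiftN bs h (𝔓.bandRel bs h i) =
    𝔓.bandRel bs h (i - bs.length) := by
  rw [bandRel, bandRel, map_sub, map_smul, map_smul, bandShiftN_gen, bandShiftN_gen, blockAt_sub,
    sub_add_eq_add_sub]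

theorem bandL_map :
    (𝔓.bandL bs h).map (𝔓.bandShiftN bs h : 𝔓.bandN bs h →ₗ[Λ] 𝔓.bandN bs h) = 𝔓.bandL bs h := by
  rw [bandL, Submodule.map_span, ← Set.range_comp]
  congr 1
  ext z
  constructor
  · rintro ⟨i, rfl⟩
    exact ⟨i - bs.length, (𝔓.bandShiftN_rel bs h i).symm⟩
  · rintro ⟨i, rfl⟩
    refine ⟨i + bs.length, ?_⟩
    rw [Function.comp_apply, LinearEquiv.coe_coe, bandShiftN_rel, add_sub_cancel_right]

/-- The `Λ`-module `M(C) = N(C) / L(C)` for a band word. -/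
abbrev BandModuleZ : Type _ := 𝔓.bandN bs h ⧸ 𝔓.bandL bs h

/-- The action of `T` on `M(C)`: `g_{C,i} + L(C) ↦ g_{C,i-n} + L(C)`. -/
noncomputable def bandT : 𝔓.BandModuleZ bs h ≃ₗ[Λ] 𝔓.BandModuleZ bs h :=
  Submodule.Quotient.equiv _ _ (𝔓.bandShiftN bs h) (𝔓.bandL_map bs h)

/-- The band module `M(C, W) = M(C) ⊗_{R[T;T⁻¹]} W` of the band word with cycle
`γ₁⁻¹ σ₁ ⋯ γₙ⁻¹ σₙ`. -/
abbrev BandModule (W : Type*) [AddCommGroup W] [Module R[T;T⁻¹] W] : Type _ :=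
  Laurent R (𝔓.bandT bs h) ⊗[R[T;T⁻¹]] W

end Presentation

/-! ## String complexes -/

/-- The degree of a generalised letter: `-1` for `⟨γ⟩` and `1` for `⟨γ⟩⁻¹`. -/
def Letter.deg {X : Type*} : Letter X → ℤ
  | .dir _ => -1
  | .inv _ => 1

namespace Seq

variable {Q₀ X : Type*}

/-- The degree of `𝒞_i`, and `0` if there is no such letter. -/
def degAt (𝒞 : Seq Q₀ X) (i : ℤ) : ℤ := (𝒞.letterAt i).elim 0 Letter.deg

/-- The function `ℋ_𝒞` on `I`: it is `deg 𝒞₁ + ⋯ + deg 𝒞_i` for `i > 0`, zero for `i = 0`, and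
`-(deg 𝒞₀ + ⋯ + deg 𝒞_{i+1})` for `i < 0`. -/
def ht (𝒞 : Seq Q₀ X) (i : ℤ) : ℤ :=
  ∑ k ∈ Finset.range i.toNat, 𝒞.degAt (k + 1) - ∑ k ∈ Finset.range (-i).toNat, 𝒞.degAt (-k)

theorem ht_succ (𝒞 : Seq Q₀ X) (i : ℤ) : 𝒞.ht (i + 1) = 𝒞.ht i + 𝒞.degAt (i + 1) := by
  unfold ht
  rcases le_or_gt 0 i with h | h
  · have h1 : (i + 1).toNat = i.toNat + 1 := by omega
    have h2 : (-(i + 1)).toNat = 0 := by omega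
    have h3 : (-i).toNat = 0 := by omega
    have h4 : (i.toNat : ℤ) = i := by omega
    rw [h1, h2, h3, Finset.sum_range_succ, h4]
    simp only [Finset.range_zero, Finset.sum_empty]; ring
  · have h1 : (-i).toNat = (-(i + 1)).toNat + 1 := by omega
    have h2 : (i + 1).toNat = 0 := by omega
    have h3 : i.toNat = 0 := by omega
    have h4 : -((-(i + 1)).toNat : ℤ) = i + 1 := by omega
    rw [h1, h2, h3, Finset.sum_range_succ, h4]
    simp only [Finset.range_zero, Finset.sum_empty]; ring

end Seq

namespace Presentation

variable {R Λ : Type*} [CommRing R] [Ring Λ] [Algebra R Λ] {Q₀ Q₁ : Type*} [Fintype Q₀]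
variable (𝔓 : Presentation R Λ Q₀ Q₁) (𝒞 : GWord Q₀ Q₁)

/-- The idempotent `e_{v_𝒞(i)}`, for `i ∈ I`. -/
noncomputable def gIdem (i : ℤ) : Λ := (𝒞.vertex 𝔓.Q.ghead 𝔓.Q.gtail i).elim 0 𝔓.e

theorem gIdem_mul_self (i : ℤ) : 𝔓.gIdem 𝒞 i * 𝔓.gIdem 𝒞 i = 𝔓.gIdem 𝒞 i := by
  unfold gIdem
  cases 𝒞.vertex 𝔓.Q.ghead 𝔓.Q.gtail i with
  | none => simp
  | some v => exact 𝔓.e_mul_self v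

/-- The idempotents of the generators of `Pⁿ(𝒞)`, indexed by the `i ∈ I` with `ℋ_𝒞(i) = n`. -/
noncomputable def strIdem (n : ℤ) (i : {i : ℤ // i ∈ 𝒞.index ∧ 𝒞.ht i = n}) : Λ := 𝔓.gIdem 𝒞 i

/-- `Pⁿ(𝒞) = ⨁ Λ e_{v_𝒞(i)}`, the sum over the `i ∈ I` with `ℋ_𝒞(i) = n`. -/
abbrev StrX (n : ℤ) : Type _ := FreeOn (𝔓.strIdem 𝒞 n)

open Classical in
/-- The generator `g_{𝒞,i}` of `Pⁿ(𝒞)`, if `i ∈ I` and `ℋ_𝒞(i) = n`. -/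
noncomputable def strGen (n i : ℤ) : 𝔓.StrX 𝒞 n :=
  if h : i ∈ 𝒞.index ∧ 𝒞.ht i = n then FreeOn.gen (𝔓.strIdem 𝒞 n) ⟨i, h⟩ else 0

theorem gIdem_smul_strGen (n i : ℤ) : 𝔓.gIdem 𝒞 i • 𝔓.strGen 𝒞 n i = 𝔓.strGen 𝒞 n i := by
  unfold strGen
  split_ifs with h
  · exact FreeOn.smul_gen (e := 𝔓.strIdem 𝒞 n) (fun _ => 𝔓.gIdem_mul_self 𝒞 _) ⟨i, h⟩
  · exact smul_zero _

/-- `g⁻_{𝒞,i}`: it is `η g_{𝒞,i-1}` if `𝒞_i = ⟨η⟩`, and zero otherwise. -/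
noncomputable def strBdLeft (n i : ℤ) : 𝔓.StrX 𝒞 n :=
  match 𝒞.letterAt i with
  | some (.dir η) => 𝔓.path η • 𝔓.strGen 𝒞 n (i - 1)
  | _ => 0

/-- `g⁺_{𝒞,i}`: it is `μ g_{𝒞,i+1}` if `𝒞_{i+1} = ⟨μ⟩⁻¹`, and zero otherwise. -/
noncomputable def strBdRight (n i : ℤ) : 𝔓.StrX 𝒞 n :=
  match 𝒞.letterAt (i + 1) with
  | some (.inv μ) => 𝔓.path μ • 𝔓.strGen 𝒞 n (i + 1)
  | _ => 0

/-- The differential `g_{𝒞,i} ↦ g⁻_{𝒞,i} + g⁺_{𝒞,i}` from `Pⁿ(𝒞)` to `Pⁿ⁺¹(𝒞)`. -/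
noncomputable def strD (n : ℤ) : 𝔓.StrX 𝒞 n →ₗ[Λ] 𝔓.StrX 𝒞 (n + 1) :=
  FreeOn.lift (𝔓.strIdem 𝒞 n) fun i => 𝔓.strBdLeft 𝒞 (n + 1) i + 𝔓.strBdRight 𝒞 (n + 1) i

theorem vertex_of_letterAt {i : ℤ} {l : Letter (NPath Q₁)} (h : 𝒞.letterAt i = some l) :
    𝒞.vertex 𝔓.Q.ghead 𝔓.Q.gtail i = some (𝔓.Q.gtail l) := by
  cases 𝒞 <;> simp_all [Seq.vertex, Seq.letterAt]

variable {𝒞}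

/-- The head of `𝒞_{i+1}` is the vertex at `i`. -/
theorem vertex_of_letterAt_succ (h𝒞 : 𝔓.IsGWord 𝒞) {i : ℤ} {l : Letter (NPath Q₁)}
    (h : 𝒞.letterAt (i + 1) = some l) :
    𝒞.vertex 𝔓.Q.ghead 𝔓.Q.gtail i = some (𝔓.Q.ghead l) := by
  cases h' : 𝒞.letterAt i with
  | some l' =>
    rw [vertex_of_letterAt 𝔓 𝒞 h']
    have := h𝒞.adjacent i l' l h' h
    cases l' <;> cases l <;>
      simp_all [Quiv.gtail, Quiv.ghead, GAdjacent]
  | none =>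
    have key : (𝒞.letterAt i).elim ((𝒞.letterAt (i + 1)).map 𝔓.Q.ghead)
        (fun l => some (𝔓.Q.gtail l)) = some (𝔓.Q.ghead l) := by
      rw [h', h]; rfl
    cases 𝒞 with
    | triv v δ => simp [Seq.letterAt] at h
    | fin | right | left | bi => exact key

/-- Each of `g^±_{𝒞,i}` is fixed by `e_{v_𝒞(i)}`. -/
theorem gIdem_smul_strBd (h𝒞 : 𝔓.IsGWord 𝒞) (n i : ℤ) :
    𝔓.gIdem 𝒞 i • (𝔓.strBdLeft 𝒞 n i + 𝔓.strBdRight 𝒞 n i) =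
      𝔓.strBdLeft 𝒞 n i + 𝔓.strBdRight 𝒞 n i := by
  rw [smul_add]
  congr 1
  · unfold strBdLeft
    split
    · rename_i η h
      rw [gIdem, vertex_of_letterAt 𝔓 𝒞 h, smul_smul]
      exact congrArg (· • _) (𝔓.e_mul_path η)
    · exact smul_zero _
  · unfold strBdRight
    split
    · rename_i μ h
      rw [gIdem, vertex_of_letterAt_succ 𝔓 h𝒞 h, smul_smul]
      exact congrArg (· • _) (𝔓.e_mul_path μ)
    · exact smul_zero _

open Classical in
theorem strD_strGen (h𝒞 : 𝔓.IsGWord 𝒞) (n i : ℤ) :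
    𝔓.strD 𝒞 n (𝔓.strGen 𝒞 n i) =
      if i ∈ 𝒞.index ∧ 𝒞.ht i = n then
        𝔓.strBdLeft 𝒞 (n + 1) i + 𝔓.strBdRight 𝒞 (n + 1) i else 0 := by
  unfold strGen
  split_ifs with h
  · rw [strD, FreeOn.lift_gen]
    exact 𝔓.gIdem_smul_strBd h𝒞 _ i
  · exact map_zero _

theorem strD_strD_gen (h𝒞 : 𝔓.IsGWord 𝒞) (n i : ℤ) :
    𝔓.strD 𝒞 (n + 1) (𝔓.strBdLeft 𝒞 (n + 1) i + 𝔓.strBdRight 𝒞 (n + 1) i) = 0 := by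
  classical
  rw [map_add]
  have h1 : 𝔓.strD 𝒞 (n + 1) (𝔓.strBdLeft 𝒞 (n + 1) i) = 0 := by
    unfold strBdLeft
    split
    · rename_i η h
      rw [map_smul, strD_strGen 𝔓 h𝒞]
      split_ifs
      · have h2 : 𝔓.strBdRight 𝒞 (n + 1 + 1) (i - 1) = 0 := by
          unfold strBdRight
          rw [sub_add_cancel, h]
        rw [h2, add_zero]
        unfold strBdLeft
        split
        · rename_i η' h'
          have := h𝒞.adjacent (i - 1) _ _ h' (by rw [sub_add_cancel]; exact h)
          rw [smul_smul, 𝔓.path_mul_path η η' this.2, zero_smul]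
        · exact smul_zero _
      · exact smul_zero _
    · exact map_zero _
  have h2 : 𝔓.strD 𝒞 (n + 1) (𝔓.strBdRight 𝒞 (n + 1) i) = 0 := by
    unfold strBdRight
    split
    · rename_i μ h
      rw [map_smul, strD_strGen 𝔓 h𝒞]
      split_ifs
      · have h2 : 𝔓.strBdLeft 𝒞 (n + 1 + 1) (i + 1) = 0 := by
          unfold strBdLeft
          rw [h]
        rw [h2, zero_add]
        unfold strBdRight
        split
        · rename_i μ' h'
          have := h𝒞.adjacent (i + 1) _ _ h h'
          rw [smul_smul, 𝔓.path_mul_path μ μ' this.2, zero_smul]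
        · exact smul_zero _
      · exact smul_zero _
    · exact map_zero _
  rw [h1, h2, add_zero]

theorem strD_strD (h𝒞 : 𝔓.IsGWord 𝒞) (n : ℤ) (x : 𝔓.StrX 𝒞 n) :
    𝔓.strD 𝒞 (n + 1) (𝔓.strD 𝒞 n x) = 0 := by
  have : (𝔓.strD 𝒞 (n + 1)).comp (𝔓.strD 𝒞 n) = 0 := by
    refine FreeOn.hom_ext fun i => ?_
    rw [LinearMap.comp_apply, LinearMap.zero_apply]
    conv_lhs => rw [strD, strD, FreeOn.lift_gen, ← strD, map_smul]
    rw [𝔓.strD_strD_gen h𝒞, smul_zero]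
  exact LinearMap.congr_fun this x

end Presentation

/-- The string complex `P(𝒞)` of a generalised word. -/
noncomputable def stringComplex {R Λ : Type u} [CommRing R] [Ring Λ] [Algebra R Λ] {Q₀ Q₁ : Type*}
    [Fintype Q₀] (𝔓 : Presentation R Λ Q₀ Q₁) (𝒞 : GWord Q₀ Q₁) (h𝒞 : 𝔓.IsGWord 𝒞) :
    CochainComplex (ModuleCat.{u} Λ) ℤ :=
  CochainComplex.of (fun n => ModuleCat.of Λ (𝔓.StrX 𝒞 n)) (fun n => ModuleCat.ofHom (𝔓.strD 𝒞 n))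
    (fun n => by
      refine ModuleCat.hom_ext (LinearMap.ext fun x => ?_)
      exact 𝔓.strD_strD h𝒞 n x)

/-! ## The resolution of a string word -/

namespace Presentation

variable {R Λ : Type*} [CommRing R] [Ring Λ] [Algebra R Λ] {Q₀ Q₁ : Type*} [Fintype Q₀]
variable (𝔓 : Presentation R Λ Q₀ Q₁)

open Classical in
/-- The arrow `c` with `t(c) = h(a)` and `c a = 0` in `Λ`, if it exists (it is unique when `Λ` is
complete gentle). -/
noncomputable def next (a : Q₁) : Option Q₁ :=
  if h : ∃ c : Q₁, 𝔓.Q.tail c = 𝔓.Q.head a ∧ 𝔓.arrow c * 𝔓.arrow a = 0 then some h.choose else none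

/-- The arrows `a₀ = a, a₁, a₂, …` where `aₖ₊₁` is the arrow with `aₖ₊₁ aₖ = 0`, as long as they
exist. -/
noncomputable def nextIter (a : Q₁) : ℕ → Option Q₁
  | 0 => some a
  | k + 1 => (nextIter a k).bind 𝔓.next

open Classical in
/-- The generalised word `⟨β⟩ ⟨a₁⟩ ⟨a₂⟩ ⋯` where the `aₖ` are arrows with `a₁ l(β) = 0` and
`aₖ₊₁ aₖ = 0`. It stops only where it cannot be prolonged by a generalised letter `⟨c⟩` with `c` an
arrow. -/
noncomputable def upSeq (β : NPath Q₁) : GWord Q₀ Q₁ :=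
  if h : ∃ k, 𝔓.nextIter β.last (k + 1) = none then
    .fin (.dir β :: (List.range (Nat.find h)).filterMap fun k =>
      (𝔓.nextIter β.last (k + 1)).map fun a => .dir ⟨a, []⟩) (List.cons_ne_nil _ _)
  else
    .right fun k =>
      match k with
      | 0 => .dir β
      | k + 1 => .dir ⟨(𝔓.nextIter β.last (k + 1)).getD β.last, []⟩

open Classical in
/-- The generalised word `ℬ = ⟨b B⁻¹⟩ ⟨b₁⟩ ⟨b₂⟩ ⋯`, where `b` is the arrow such that `B b⁻¹` is a
word (it is unique when `Λ` is complete gentle), and `none` if there is no such arrow. -/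
noncomputable def upExt (s : Letter Q₁ → ℤˣ) (B : Word Q₀ Q₁) : Option (GWord Q₀ Q₁) :=
  if h : ∃ b : Q₁, 𝔓.Extends s B b then some (𝔓.upSeq (extPath B h.choose)) else none

/-- The resolution `𝓡_C = ℬ⁻¹ (𝒜 𝒟)` of the string word with decomposition `(B, A, D)`, where `𝒜`
is `⟨1_{v,ε}⟩` or `⟨γ₁⟩ ⟨σ₁⟩⁻¹ ⋯ ⟨γₙ⟩ ⟨σₙ⟩⁻¹`, and where `ℬ` (respectively `𝒟`) is the upward
extension of `⟨b B⁻¹⟩` (respectively `⟨d D⁻¹⟩`), or is absent if `b` (respectively `d`) does not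
exist. If `ℬ` and `𝒟` are infinite then `𝓡_C = ℬ⁻¹ ∣ 𝒜 𝒟`. -/
noncomputable def resString (s : Letter Q₁ → ℤˣ) (B : Word Q₀ Q₁) (A : Core Q₀ Q₁)
    (D : Word Q₀ Q₁) : GWord Q₀ Q₁ :=
  match 𝔓.upExt s B, 𝔓.upExt s D with
  | none, none => A.toGWord
  | none, some 𝒟 => A.toGWord.comp 𝒟
  | some ℬ, none => ℬ.inverse.comp A.toGWord
  | some ℬ, some 𝒟 => ℬ.inverse.comp (A.toGWord.comp 𝒟)

/-- The left end `ι(-)` of the interval of `𝓡_C`: the element of `I` between `ℬ⁻¹` and `𝒜 𝒟`. It is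
the length of `ℬ` if `ℬ` is finite or absent; it is minus the length of `𝒜 𝒟` if `ℬ` is infinite and
`𝒟` is finite or absent; and it is `0` if `ℬ` and `𝒟` are infinite. -/
noncomputable def resStringStart (s : Letter Q₁ → ℤˣ) (B : Word Q₀ Q₁) (A : Core Q₀ Q₁)
    (D : Word Q₀ Q₁) : ℤ :=
  match 𝔓.upExt s B, 𝔓.upExt s D with
  | none, _ => 0
  | some (.fin l _), _ => l.length
  | some (.right _), none => -(2 * A.blocks.length)
  | some (.right _), some (.fin m _) => -(2 * A.blocks.length + m.length)
  | _, _ => 0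

end Presentation

/-! ## Band complexes -/

/-- The `ℤ`-indexed generalised word with letters `c i` is periodic, of period `p`: `p` is the
least positive integer such that `𝒞 = 𝒞[p]` and `ℋ_𝒞(p) = 0`. -/
structure IsPeriod (Q₀ : Type*) {X : Type*} (c : ℤ → Letter X) (p : ℤ) : Prop where
  pos : 0 < p
  shift : ∀ i, c (i + p) = c i
  ht_eq : (Seq.bi (Q₀ := Q₀) c).ht p = 0
  minimal : ∀ q : ℤ, 0 < q → (∀ i, c (i + q) = c i) → (Seq.bi (Q₀ := Q₀) c).ht q = 0 → p ≤ q

namespace IsPeriod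

variable {Q₀ X : Type*} {c : ℤ → Letter X} {p : ℤ}

theorem ht_add (hp : IsPeriod Q₀ c p) (i : ℤ) :
    (Seq.bi (Q₀ := Q₀) c).ht (i + p) = (Seq.bi (Q₀ := Q₀) c).ht i := by
  have key : ∀ i : ℤ, (Seq.bi (Q₀ := Q₀) c).degAt (i + p) = (Seq.bi (Q₀ := Q₀) c).degAt i := by
    intro i
    simp only [Seq.degAt, Seq.letterAt, hp.shift]
  induction i using Int.induction_on with
  | zero => rw [zero_add, hp.ht_eq]; simp [Seq.ht]
  | succ n ih => rw [add_right_comm, Seq.ht_succ, Seq.ht_succ, ih, add_right_comm, key]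
  | pred n ih =>
    have h1 := Seq.ht_succ (Seq.bi (Q₀ := Q₀) c) (-(n : ℤ) - 1 + p)
    have h2 := Seq.ht_succ (Seq.bi (Q₀ := Q₀) c) (-(n : ℤ) - 1)
    rw [add_right_comm, key, sub_add_cancel, ih] at h1
    rw [sub_add_cancel] at h2
    linarith

theorem ht_sub (hp : IsPeriod Q₀ c p) (i : ℤ) :
    (Seq.bi (Q₀ := Q₀) c).ht (i - p) = (Seq.bi (Q₀ := Q₀) c).ht i := by
  rw [← hp.ht_add, sub_add_cancel]

theorem shift_sub (hp : IsPeriod Q₀ c p) (i : ℤ) : c (i - p) = c i := by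
  rw [← hp.shift, sub_add_cancel]

end IsPeriod

namespace Presentation

variable {R Λ : Type*} [CommRing R] [Ring Λ] [Algebra R Λ] {Q₀ Q₁ : Type*} [Fintype Q₀]
variable (𝔓 : Presentation R Λ Q₀ Q₁) {c : ℤ → Letter (NPath Q₁)} {p : ℤ}

theorem gIdem_add (hp : IsPeriod Q₀ c p) (i : ℤ) : 𝔓.gIdem (.bi c) (i + p) = 𝔓.gIdem (.bi c) i := by
  simp only [gIdem, Seq.vertex, Seq.letterAt, hp.shift, Option.elim_some]

theorem gIdem_sub (hp : IsPeriod Q₀ c p) (i : ℤ) : 𝔓.gIdem (.bi c) (i - p) = 𝔓.gIdem (.bi c) i := by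
  rw [← 𝔓.gIdem_add hp, sub_add_cancel]

theorem strGen_of_mem (n : ℤ) (i : {i : ℤ // i ∈ (Seq.bi (Q₀ := Q₀) c).index ∧
    (Seq.bi (Q₀ := Q₀) c).ht i = n}) :
    FreeOn.gen (𝔓.strIdem (.bi c) n) i = 𝔓.strGen (.bi c) n i := by
  rw [strGen, dif_pos i.2]

theorem lift_add_strGen (hp : IsPeriod Q₀ c p) (n i : ℤ) :
    FreeOn.lift (𝔓.strIdem (.bi c) n) (fun i => 𝔓.strGen (.bi c) n (i + p))
      (𝔓.strGen (.bi c) n i) = 𝔓.strGen (.bi c) n (i + p) := by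
  by_cases h : i ∈ (Seq.bi (Q₀ := Q₀) c).index ∧ (Seq.bi (Q₀ := Q₀) c).ht i = n
  · rw [← 𝔓.strGen_of_mem n ⟨i, h⟩, FreeOn.lift_gen, strIdem, ← 𝔓.gIdem_add hp]
    exact 𝔓.gIdem_smul_strGen _ n (i + p)
  · rw [strGen, strGen, dif_neg h, dif_neg, map_zero]
    rw [hp.ht_add]
    exact h

theorem lift_sub_strGen (hp : IsPeriod Q₀ c p) (n i : ℤ) :
    FreeOn.lift (𝔓.strIdem (.bi c) n) (fun i => 𝔓.strGen (.bi c) n (i - p))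
      (𝔓.strGen (.bi c) n i) = 𝔓.strGen (.bi c) n (i - p) := by
  by_cases h : i ∈ (Seq.bi (Q₀ := Q₀) c).index ∧ (Seq.bi (Q₀ := Q₀) c).ht i = n
  · rw [← 𝔓.strGen_of_mem n ⟨i, h⟩, FreeOn.lift_gen, strIdem, ← 𝔓.gIdem_sub hp]
    exact 𝔓.gIdem_smul_strGen _ n (i - p)
  · rw [strGen, strGen, dif_neg h, dif_neg, map_zero]
    rw [hp.ht_sub]
    exact h

/-- The automorphism `g_{𝒞,i} ↦ g_{𝒞,i-p}` of `Pⁿ(𝒞)`, for a generalised word of period `p`. -/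
noncomputable def strShift (hp : IsPeriod Q₀ c p) (n : ℤ) :
    𝔓.StrX (.bi c) n ≃ₗ[Λ] 𝔓.StrX (.bi c) n :=
  LinearEquiv.ofLinearMap
    (FreeOn.lift _ fun i => 𝔓.strGen (.bi c) n (i - p))
    (FreeOn.lift _ fun i => 𝔓.strGen (.bi c) n (i + p))
    (FreeOn.hom_ext fun i => by
      rw [LinearMap.comp_apply, strGen_of_mem, lift_add_strGen 𝔓 hp, lift_sub_strGen 𝔓 hp,
        add_sub_cancel_right, LinearMap.id_apply])
    (FreeOn.hom_ext fun i => by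
      rw [LinearMap.comp_apply, strGen_of_mem, lift_sub_strGen 𝔓 hp, lift_add_strGen 𝔓 hp,
        sub_add_cancel, LinearMap.id_apply])

theorem strShift_strGen (hp : IsPeriod Q₀ c p) (n i : ℤ) :
    𝔓.strShift hp n (𝔓.strGen (.bi c) n i) = 𝔓.strGen (.bi c) n (i - p) :=
  𝔓.lift_sub_strGen hp n i

theorem strShift_strBdLeft (hp : IsPeriod Q₀ c p) (n i : ℤ) :
    𝔓.strShift hp n (𝔓.strBdLeft (.bi c) n i) = 𝔓.strBdLeft (.bi c) n (i - p) := by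
  unfold strBdLeft
  simp only [Seq.letterAt, hp.shift_sub]
  cases c i with
  | dir η =>
    simp only [map_smul, strShift_strGen]
    rw [sub_right_comm]
  | inv μ => exact map_zero _

theorem strShift_strBdRight (hp : IsPeriod Q₀ c p) (n i : ℤ) :
    𝔓.strShift hp n (𝔓.strBdRight (.bi c) n i) = 𝔓.strBdRight (.bi c) n (i - p) := by
  unfold strBdRight
  simp only [Seq.letterAt, sub_add_eq_add_sub, hp.shift_sub]
  cases c (i + 1) with
  | inv η => simp only [map_smul, strShift_strGen]
  | dir μ => exact map_zero _

theorem strD_strShift (hc : 𝔓.IsGWord (.bi c)) (hp : IsPeriod Q₀ c p) (n : ℤ)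
    (x : 𝔓.StrX (.bi c) n) :
    𝔓.strD (.bi c) n (𝔓.strShift hp n x) = 𝔓.strShift hp (n + 1) (𝔓.strD (.bi c) n x) := by
  classical
  have : (𝔓.strD (.bi c) n).comp (𝔓.strShift hp n : 𝔓.StrX (.bi c) n →ₗ[Λ] 𝔓.StrX (.bi c) n) =
      (𝔓.strShift hp (n + 1) : 𝔓.StrX (.bi c) (n + 1) →ₗ[Λ] 𝔓.StrX (.bi c) (n + 1)).comp
        (𝔓.strD (.bi c) n) := by
    refine FreeOn.hom_ext fun i => ?_
    rw [LinearMap.comp_apply, LinearMap.comp_apply, strGen_of_mem, LinearEquiv.coe_coe,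
      LinearEquiv.coe_coe, strShift_strGen, strD_strGen 𝔓 hc, strD_strGen 𝔓 hc, if_pos i.2, map_add,
      strShift_strBdLeft, strShift_strBdRight, if_pos]
    rw [hp.ht_sub]
    exact i.2
  exact LinearMap.congr_fun this x

end Presentation

/-- The band complex `P(𝒞, W) = P(𝒞) ⊗_{R[T;T⁻¹]} W` of a generalised word `𝒞` of period `p`, where
`T` acts on `P(𝒞)` by `g_{𝒞,i} ↦ g_{𝒞,i-p}`. -/
noncomputable def bandComplex {R Λ : Type u} [CommRing R] [Ring Λ] [Algebra R Λ] {Q₀ Q₁ : Type*}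
    [Fintype Q₀] (𝔓 : Presentation R Λ Q₀ Q₁) {c : ℤ → Letter (NPath Q₁)} {p : ℤ}
    (hc : 𝔓.IsGWord (.bi c)) (hp : IsPeriod Q₀ c p) (W : Type u) [AddCommGroup W]
    [Module R[T;T⁻¹] W] : CochainComplex (ModuleCat.{u} Λ) ℤ :=
  CochainComplex.of
    (fun n => ModuleCat.of Λ (Laurent R (𝔓.strShift hp n) ⊗[R[T;T⁻¹]] W))
    (fun n => ModuleCat.ofHom (laurentMap (R := R) (𝔓.strShift hp n) (𝔓.strShift hp (n + 1)) W
      (𝔓.strD (.bi c) n) (𝔓.strD_strShift hc hp n)))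
    (fun n => by
      rw [← ModuleCat.ofHom_comp, laurentMap_comp_eq_zero _ _ _ _ _ _ _ _ (𝔓.strD_strD hc n)]
      rfl)

/-! ## Projective resolutions -/

/-- The complex `P` is a projective resolution of `M`: its terms are projective, `Pˡ = 0` for
`l > 0`, the cohomology of `P` vanishes in nonzero degrees, and `H⁰(P) ≅ M`. -/
structure IsProjectiveResolution {Λ : Type u} [Ring Λ] (P : CochainComplex (ModuleCat.{u} Λ) ℤ)
    (M : ModuleCat.{u} Λ) : Prop where
  projective : ∀ n : ℤ, Projective (P.X n)
  isZero : ∀ l : ℤ, 0 < l → Limits.IsZero (P.X l)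
  homology_isZero : ∀ m : ℤ, m ≠ 0 → Limits.IsZero (P.homology m)
  homology_zero : Nonempty (P.homology 0 ≅ M)

end Gentle

/-! The theorem rests on how left ideals sit inside `Λx` for an arrow `x`. Every nonzero left ideal
in `Λx` contains a path of `𝐏` with first arrow `x` (`exists_path_generator`). The reason is that an
element without this property would lie in `Λγ` for an infinite, strictly descending chain of
prolongations `γ` of `x`, and the Krull intersection theorem, together with the finiteness of `Λx`
over `R`, forces the intersection of such a chain to be zero. Hence right multiplication by `γ` is
injective on `Λx` whenever `xγ ∈ 𝐏`, and what annihilates `γ` in `Λe_{h(γ)}` lies in `Λc`, where `c`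
is the arrow with `c l(γ) = 0`, or is zero if there is no such arrow (`mem_of_mul_path_eq_zero`).
Two paths with the same head and different last arrows therefore have no common nonzero annihilator,
and multiples of two paths with different first arrows cancel only if both vanish
(`mul_path_eq_zero_of_add`).

Consequently the cycles of a string complex can be studied one coordinate at a time. In `𝓡_C` the
part `𝒜` is a zigzag with its peaks at the top height `t` and its valleys at height `t - 1`, and
from the two outer peaks the extensions `ℬ` and `𝒟` descend. At a valley, the coordinate of a cycle
annihilates two paths and is zero. On an extension, it annihilates one path, so it is a multiple of
the arrow that forms the next letter, and hence gives a boundary (`locallyExact`, `strD_exact`). In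
the top degree the complex is `N(C)` by way of `g_k ↦ (-1)ᵏ g_k`. These signs turn the boundary `γ
g_k + σ g_{k+1}` of a valley into a relation of `M(C)`, and the first positions of the extensions
give the two remaining generators of `L(C)`; so the cokernel is `M(C)`.

For a band word only peaks and valleys occur, and the complex has two terms. A linear form on `V`
unrolls an element of `P(𝒞) ⊗ V` into a family indexed by `ℤ`, on which the differential is given by
the same formula `famD` as for strings (`bandCoord_bandD`). The valley argument kills every such
family, and as `V` is projective over `R` the linear forms detect all elements
(`eq_zero_of_bandCoord`), so the differential is injective. Its cokernel is identified by a
universal property. A shift by `n` peaks changes the sign `(-1)ᵏ` by `(-1)ⁿ`, which is why the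
action of `T` is twisted.

If a nonzero band module were projective, the differential would have a retraction. Its coefficients
are nontrivial paths, so composing with the retraction has coordinates in the radical; for a linear
form taking a unit value this would put an `e_v` into the radical (`bandD_not_split`). -/

namespace Gentle

namespace Presentation

variable {R Λ : Type*} [CommRing R] [Ring Λ] [Algebra R Λ] {Q₀ Q₁ : Type*} [Fintype Q₀]
variable (𝔓 : Presentation R Λ Q₀ Q₁)

/-! ### Paths outside the ideal -/

/-- `xy` is a path of length two which is not one of the chosen relations. -/
def Adm (x y : Q₁) : Prop := 𝔓.Q.tail x = 𝔓.Q.head y ∧ (x, y) ∉ 𝔓.Z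

open Classical in
/-- The vertex at position `j` of a list of arrows. -/
noncomputable def listVertex (l : List Q₁) (v₀ : Q₀) (j : ℕ) : Q₀ :=
  (l[j]?).elim v₀ 𝔓.Q.head

open Classical in
/-- The action of the generators of `RQ` on the uniserial representation given by a list of arrows,
with basis the positions in the list. -/
noncomputable def listGen (l : List Q₁) (v₀ : Q₀) : Q₀ ⊕ Q₁ → Module.End R (ℕ → R)
  | .inl v => LinearMap.pi fun j => if 𝔓.listVertex l v₀ j = v then LinearMap.proj j else 0
  | .inr x => LinearMap.pi fun j => if l[j]? = some x then LinearMap.proj (j + 1) else 0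

open Classical in
theorem listGen_inl (l : List Q₁) (v₀ v : Q₀) (f : ℕ → R) (j : ℕ) :
    𝔓.listGen l v₀ (.inl v) f j = if 𝔓.listVertex l v₀ j = v then f j else 0 := by
  simp only [listGen, LinearMap.pi_apply]
  split_ifs <;> rfl

open Classical in
theorem listGen_inr (l : List Q₁) (v₀ : Q₀) (x : Q₁) (f : ℕ → R) (j : ℕ) :
    𝔓.listGen l v₀ (.inr x) f j = if l[j]? = some x then f (j + 1) else 0 := by
  simp only [listGen, LinearMap.pi_apply]
  split_ifs <;> rfl

/-- Each relation is checked position by position. The relation at the tail of an arrow needs the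
vertex at the following position: inside the list it comes from the chain condition, and after the
last arrow from `hv`, since `listVertex` takes its default value `v₀` there. -/
theorem listGen_rel {l : List Q₁} {v₀ : Q₀} (hl : l.IsChain 𝔓.Adm)
    (hv : ∀ x ∈ l.getLast?, 𝔓.Q.tail x = v₀) ⦃a b : FreeAlgebra R (Q₀ ⊕ Q₁)⦄
    (h : PathRel R 𝔓.Q a b) :
    FreeAlgebra.lift R (𝔓.listGen l v₀) a = FreeAlgebra.lift R (𝔓.listGen l v₀) b := by
  classical
  refine LinearMap.ext fun f => funext fun j => ?_
  cases h with
  | idem v =>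
    simp only [map_mul, FreeAlgebra.lift_ι_apply, Module.End.mul_apply, listGen_inl]
    split_ifs <;> rfl
  | orth v w hvw =>
    simp only [map_mul, FreeAlgebra.lift_ι_apply, Module.End.mul_apply, listGen_inl, map_zero,
      LinearMap.zero_apply, Pi.zero_apply]
    split_ifs with h1 h2
    · exact absurd (h1.symm.trans h2) hvw
    · rfl
    · rfl
  | one =>
    simp [map_sum, LinearMap.sum_apply, Finset.sum_apply, listGen_inl]
  | head x =>
    simp only [map_mul, FreeAlgebra.lift_ι_apply, Module.End.mul_apply, listGen_inl, listGen_inr]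
    by_cases h : l[j]? = some x
    · simp [listVertex, h]
    · simp [h]
  | tail x =>
    simp only [map_mul, FreeAlgebra.lift_ι_apply, Module.End.mul_apply, listGen_inl, listGen_inr]
    by_cases h : l[j]? = some x
    · have key : 𝔓.listVertex l v₀ (j + 1) = 𝔓.Q.tail x := by
        obtain ⟨hj, hjx⟩ := List.getElem?_eq_some_iff.mp h
        unfold listVertex
        by_cases h1 : j + 1 < l.length
        · rw [List.getElem?_eq_getElem h1]
          have := (List.isChain_iff_getElem.mp hl j h1).1
          rw [hjx] at this
          exact this.symm
        · rw [List.getElem?_eq_none (by omega)]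
          refine (hv x ?_).symm
          have : j = l.length - 1 := by omega
          rw [List.getLast?_eq_getElem?, ← this, h]
          rfl
      simp [key, h]
    · simp [h]

/-- The uniserial representation of `RQ` attached to a path. -/
noncomputable def listRep {l : List Q₁} {v₀ : Q₀} (hl : l.IsChain 𝔓.Adm)
    (hv : ∀ x ∈ l.getLast?, 𝔓.Q.tail x = v₀) : PathAlgebra R 𝔓.Q →ₐ[R] Module.End R (ℕ → R) :=
  RingQuot.liftAlgHom R ⟨FreeAlgebra.lift R (𝔓.listGen l v₀), 𝔓.listGen_rel hl hv⟩

open Classical in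
theorem listRep_arrow {l : List Q₁} {v₀ : Q₀} (hl : l.IsChain 𝔓.Adm)
    (hv : ∀ x ∈ l.getLast?, 𝔓.Q.tail x = v₀) (x : Q₁) (f : ℕ → R) (j : ℕ) :
    𝔓.listRep hl hv (arrowElt R 𝔓.Q x) f j = if l[j]? = some x then f (j + 1) else 0 := by
  rw [listRep, arrowElt, RingQuot.liftAlgHom_mkAlgHom_apply, FreeAlgebra.lift_ι_apply, listGen_inr]

/-- A product of two arrows acts nontrivially only if they are consecutive in the list, and
consecutive arrows never form a pair in `Z`. So the generators of the ideal act as zero. -/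
theorem listRep_relIdeal {l : List Q₁} {v₀ : Q₀} (hl : l.IsChain 𝔓.Adm)
    (hv : ∀ x ∈ l.getLast?, 𝔓.Q.tail x = v₀) {a : PathAlgebra R 𝔓.Q}
    (ha : a ∈ relIdeal R 𝔓.Q 𝔓.Z) : 𝔓.listRep hl hv a = 0 := by
  classical
  have : relIdeal R 𝔓.Q 𝔓.Z ≤ TwoSidedIdeal.ker (𝔓.listRep hl hv) := by
    refine TwoSidedIdeal.span_le.mpr ?_
    rintro _ ⟨p, hp, rfl⟩
    rw [SetLike.mem_coe, TwoSidedIdeal.mem_ker, map_mul]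
    refine LinearMap.ext fun f => funext fun j => ?_
    rw [Module.End.mul_apply, listRep_arrow]
    split_ifs with h
    · rw [listRep_arrow, if_neg]
      · rfl
      · intro h'
        obtain ⟨hj, hjx⟩ := List.getElem?_eq_some_iff.mp h
        obtain ⟨hj', hjx'⟩ := List.getElem?_eq_some_iff.mp h'
        have := (List.isChain_iff_getElem.mp hl j hj').2
        rw [hjx, hjx'] at this
        exact this hp
    · rfl
  exact (TwoSidedIdeal.mem_ker _).mp (this ha)

/-- Each arrow of the list moves the place of evaluation one step to the right. The arrows from
position `j` on therefore evaluate `f` at the end of the list. -/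
theorem listRep_drop {l : List Q₁} {v₀ : Q₀} (hl : l.IsChain 𝔓.Adm)
    (hv : ∀ x ∈ l.getLast?, 𝔓.Q.tail x = v₀) (f : ℕ → R) (k j : ℕ) (hk : j + k = l.length) :
    𝔓.listRep hl hv ((l.drop j).map (arrowElt R 𝔓.Q)).prod f j = f l.length := by
  classical
  induction k generalizing j with
  | zero => simp at hk; subst hk; simp
  | succ k ih =>
    rw [List.drop_eq_getElem_cons (by omega), List.map_cons, List.prod_cons, map_mul,
      Module.End.mul_apply, listRep_arrow, if_pos (List.getElem?_eq_getElem _), ih (j + 1) (by omega)]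

/-- The path sends the constant function `1` to a function with value `1` at `0`, whereas elements
of the ideal act as zero. -/
theorem isP_of_chain [Nontrivial R] {γ : NPath Q₁} (h : γ.arrows.IsChain 𝔓.Adm) : 𝔓.IsP γ := by
  refine ⟨h.imp fun _ _ h => h.1, fun hmem => ?_⟩
  have hv : ∀ x ∈ γ.arrows.getLast?, 𝔓.Q.tail x = 𝔓.Q.tail γ.first := by
    intro x hx
    rw [NPath.arrows, List.getLast?_eq_some_getLast (List.cons_ne_nil _ _)] at hx
    cases hx
    rfl
  have h1 := 𝔓.listRep_relIdeal h hv hmem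
  have h2 := 𝔓.listRep_drop h hv (fun _ => 1) γ.arrows.length 0 (by simp)
  rw [List.drop_zero, ← pathElt, h1] at h2
  exact zero_ne_one h2

theorem chain_of_isP {γ : NPath Q₁} (h : 𝔓.IsP γ) : γ.arrows.IsChain 𝔓.Adm := by
  rw [List.isChain_iff_getElem]
  intro i hi
  refine ⟨List.isChain_iff_getElem.mp h.1 i hi, fun hZ => h.2 ?_⟩
  have h1 : γ.arrows = γ.arrows.take i ++ (γ.arrows[i] :: γ.arrows[i + 1] :: γ.arrows.drop (i + 2)) := by
    rw [← List.drop_eq_getElem_cons, ← List.drop_eq_getElem_cons, List.take_append_drop]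
  unfold pathElt
  rw [h1, List.map_append, List.prod_append, List.map_cons, List.map_cons, List.prod_cons,
    List.prod_cons, ← mul_assoc (arrowElt R 𝔓.Q _)]
  refine TwoSidedIdeal.mul_mem_left _ _ _ (TwoSidedIdeal.mul_mem_right _ _ _ ?_)
  exact TwoSidedIdeal.subset_span ⟨_, hZ, rfl⟩

theorem pairP_iff [Nontrivial R] {x y : Q₁} : 𝔓.PairP x y ↔ 𝔓.Adm x y := by
  constructor
  · intro h
    simpa [NPath.arrows] using 𝔓.chain_of_isP h
  · intro h
    refine 𝔓.isP_of_chain ?_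
    simpa [NPath.arrows] using h

/-- Membership in `𝐏` is a local condition. Hence paths can be prolonged or concatenated by looking
only at the junction. -/
theorem isP_iff [Nontrivial R] {γ : NPath Q₁} : 𝔓.IsP γ ↔ γ.arrows.IsChain 𝔓.PairP := by
  have : 𝔓.PairP = 𝔓.Adm := by
    ext x y
    exact 𝔓.pairP_iff
  rw [this]
  exact ⟨𝔓.chain_of_isP, 𝔓.isP_of_chain⟩

theorem isP_arrow [Nontrivial R] (x : Q₁) : 𝔓.IsP ⟨x, []⟩ := by
  rw [isP_iff]
  simp [NPath.arrows]

theorem path_ne_zero {γ : NPath Q₁} (h : 𝔓.IsP γ) : 𝔓.path γ ≠ 0 := 𝔓.map_path_ne γ h.1 h.2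

theorem path_arrow (x : Q₁) : 𝔓.path ⟨x, []⟩ = 𝔓.arrow x := by
  simp [path_eq, NPath.arrows]

theorem e_mul_e_of_ne {v w : Q₀} (h : v ≠ w) : 𝔓.e v * 𝔓.e w = 0 := by
  unfold e vertexElt
  rw [← map_mul, ← map_mul, RingQuot.mkAlgHom_rel R (PathRel.orth v w h), map_zero, map_zero]

theorem arrow_mul_e_of_ne {x : Q₁} {v : Q₀} (h : 𝔓.Q.tail x ≠ v) : 𝔓.arrow x * 𝔓.e v = 0 := by
  rw [← mul_e_tail, mul_assoc, 𝔓.e_mul_e_of_ne h, mul_zero]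

theorem pairP_tail {x y : Q₁} (h : 𝔓.PairP x y) : 𝔓.Q.tail x = 𝔓.Q.head y := by
  have := h.1
  simpa [Quiv.IsPath, NPath.arrows] using this

/-- The right side covers both reasons for a zero product: the arrows are not composable, or their
composite lies in the ideal. -/
theorem arrow_mul_arrow_eq_zero {x y : Q₁} : 𝔓.arrow x * 𝔓.arrow y = 0 ↔ ¬ 𝔓.PairP x y := by
  constructor
  · intro h hp
    refine 𝔓.path_ne_zero hp ?_
    simpa [path_eq, NPath.arrows] using h
  · intro h
    by_cases ht : 𝔓.Q.tail x = 𝔓.Q.head y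
    · have h1 : pathElt R 𝔓.Q ⟨x, [y]⟩ ∈ relIdeal R 𝔓.Q 𝔓.Z := by
        by_contra h2
        exact h ⟨by simpa [Quiv.IsPath, NPath.arrows] using ht, h2⟩
      have := 𝔓.map_ideal _ h1
      simpa [pathElt, NPath.arrows, arrow] using this
    · rw [← e_head_mul _ y, ← mul_assoc, 𝔓.arrow_mul_e_of_ne ht, zero_mul]

end Presentation

end Gentle

/-! ### Descending chains, and the radical of `Λe_v`. -/

namespace Gentle

/-- By Krull it suffices that the intersection lies in every `𝔪ʲM`. Otherwise comparability puts all
of the chain above some `𝔪ʲM`; but `M/𝔪ʲM` has finite length, so a strictly descending chain cannot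
live there. -/
theorem iInf_eq_bot_of_antitone {R M : Type*} [CommRing R] [IsLocalRing R]
    [IsNoetherianRing R] [AddCommGroup M] [Module R M] [Module.Finite R M] (F : ℕ → Submodule R M)
    (hF : Antitone F) (hne : ∀ k, F (k + 1) ≠ F k)
    (hcomp : ∀ j k, IsLocalRing.maximalIdeal R ^ j • (⊤ : Submodule R M) ≤ F k ∨
      F k ≤ IsLocalRing.maximalIdeal R ^ j • (⊤ : Submodule R M)) : ⨅ k, F k = ⊥ := by
  rw [eq_bot_iff, ← Ideal.iInf_pow_smul_eq_bot_of_isLocalRing (R := R) (M := M) (IsLocalRing.maximalIdeal R)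
    (IsLocalRing.maximalIdeal.isMaximal R).ne_top]
  refine le_iInf fun j => ?_
  by_cases hj : j = 0
  · subst hj; simp
  set I := IsLocalRing.maximalIdeal R ^ j with hI
  by_contra hcon
  -- No member of the chain lies in `𝔪ʲM`, since the intersection would then lie in it too; so
  -- comparability always gives the first alternative.
  have hle : ∀ k, I • (⊤ : Submodule R M) ≤ F k := fun k =>
    (hcomp j k).resolve_right fun h => hcon ((iInf_le _ _).trans h)
  have hIle : I ≤ IsLocalRing.maximalIdeal R := Ideal.pow_le_self hj
  have : Nontrivial (R ⧸ I) := Ideal.Quotient.nontrivial_iff.mpr fun h =>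
    (IsLocalRing.maximalIdeal.isMaximal R).ne_top (top_le_iff.mp (h ▸ hIle))
  have : IsLocalRing (R ⧸ I) := IsLocalRing.of_surjective' (Ideal.Quotient.mk I)
    Ideal.Quotient.mk_surjective
  -- A noetherian local ring whose maximal ideal is nilpotent is artinian.
  have hart : IsArtinianRing (R ⧸ I) := by
    rw [isArtinianRing_iff_isNilpotent_maximalIdeal]
    refine ⟨j, ?_⟩
    have : IsLocalRing.maximalIdeal (R ⧸ I) ≤ (IsLocalRing.maximalIdeal R).map (Ideal.Quotient.mk I) := by
      intro x hx
      obtain ⟨r, rfl⟩ := Ideal.Quotient.mk_surjective x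
      refine Ideal.mem_map_of_mem _ ?_
      rw [IsLocalRing.mem_maximalIdeal, mem_nonunits_iff] at hx ⊢
      exact fun h => hx (h.map _)
    refine le_bot_iff.mp ((Ideal.pow_right_mono this j).trans ?_)
    rw [← Ideal.map_pow, ← hI, Ideal.map_quotient_self]
  have h1 : Module.Finite (R ⧸ I) (M ⧸ (I • ⊤ : Submodule R M)) :=
    Module.Finite.of_restrictScalars_finite R _ _
  have h2 : IsArtinian R (M ⧸ (I • ⊤ : Submodule R M)) :=
    isArtinian_of_surjective_algebraMap (R := R ⧸ I) Ideal.Quotient.mk_surjective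
  obtain ⟨n, hn⟩ := IsArtinian.monotone_stabilizes
    (R := R) (M := M ⧸ (I • ⊤ : Submodule R M))
    ⟨fun k => OrderDual.toDual ((F k).map (Submodule.mkQ _)), fun a b hab =>
      Submodule.map_mono (hF hab)⟩
  -- All members of the chain contain `IM`, so two of them with the same image in `M/IM` are equal.
  have h3 := congrArg (Submodule.comap (Submodule.mkQ _)) (hn (n + 1) (by omega))
  change Submodule.comap _ (Submodule.map _ (F n)) = Submodule.comap _ (Submodule.map _ (F (n + 1)))
    at h3
  rw [Submodule.comap_map_mkQ, Submodule.comap_map_mkQ, sup_eq_right.mpr (hle _),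
    sup_eq_right.mpr (hle _)] at h3
  exact hne n h3.symm

namespace Presentation

variable {R Λ : Type*} [CommRing R] [Ring Λ] [Algebra R Λ] {Q₀ Q₁ : Type*} [Fintype Q₀]
variable (𝔓 : Presentation R Λ Q₀ Q₁)

/-- The radical of `Λ e_v`: the left ideal generated by the arrows with tail `v`. -/
def rad (v : Q₀) : Submodule Λ Λ :=
  Submodule.span Λ {a | ∃ x : Q₁, 𝔓.Q.tail x = v ∧ a = 𝔓.arrow x}

theorem arrow_mem_rad (x : Q₁) : 𝔓.arrow x ∈ 𝔓.rad (𝔓.Q.tail x) :=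
  Submodule.subset_span ⟨x, rfl, rfl⟩

theorem mul_e_mem (a : Λ) (v : Q₀) : a * 𝔓.e v ∈ leftIdeal (𝔓.e v) :=
  Submodule.smul_mem _ a (Submodule.mem_span_singleton_self _)

theorem mem_leftIdeal_e {v : Q₀} {a : Λ} : a ∈ leftIdeal (𝔓.e v) ↔ a * 𝔓.e v = a := by
  constructor
  · intro h
    obtain ⟨b, rfl⟩ := Submodule.mem_span_singleton.mp h
    rw [smul_eq_mul, mul_assoc, e_mul_self]
  · intro h
    rw [← h]
    exact 𝔓.mul_e_mem a v

theorem leftIdeal_le {a b : Λ} : leftIdeal a ≤ leftIdeal b ↔ a ∈ leftIdeal b :=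
  Submodule.span_singleton_le_iff_mem _ _

theorem mul_mem_leftIdeal (a b : Λ) : a * b ∈ leftIdeal b :=
  Submodule.smul_mem _ a (Submodule.mem_span_singleton_self _)

/-- Every element of `Λ e_v` is congruent to a scalar multiple of `e_v` modulo the radical. -/
theorem exists_scalar (a : Λ) (v : Q₀) :
    ∃ r : R, a * 𝔓.e v - algebraMap R Λ r * 𝔓.e v ∈ 𝔓.rad v := by
  classical
  obtain ⟨b, rfl⟩ := 𝔓.surjective a
  obtain ⟨b, rfl⟩ := RingQuot.mkAlgHom_surjective R (PathRel R 𝔓.Q) b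
  induction b using FreeAlgebra.induction with
  | grade0 r => exact ⟨r, by simp⟩
  | grade1 w =>
    cases w with
    | inl w =>
      change ∃ r : R, 𝔓.e w * 𝔓.e v - _ ∈ _
      by_cases h : w = v
      · subst h
        exact ⟨1, by simp [e_mul_self]⟩
      · exact ⟨0, by simp [𝔓.e_mul_e_of_ne h]⟩
    | inr x =>
      change ∃ r : R, 𝔓.arrow x * 𝔓.e v - _ ∈ _
      refine ⟨0, ?_⟩
      rw [map_zero, zero_mul, sub_zero]
      by_cases h : 𝔓.Q.tail x = v
      · subst h
        rw [mul_e_tail]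
        exact 𝔓.arrow_mem_rad x
      · simp [𝔓.arrow_mul_e_of_ne h]
  | mul a b ha hb =>
    obtain ⟨r, hr⟩ := ha
    obtain ⟨t, ht⟩ := hb
    rw [map_mul, map_mul]
    set a' := 𝔓.ϑ (RingQuot.mkAlgHom R (PathRel R 𝔓.Q) a)
    set b' := 𝔓.ϑ (RingQuot.mkAlgHom R (PathRel R 𝔓.Q) b)
    -- As `t` is central, `a'b'e - tre = a'(b'e - te) + t(a'e - re)`, with both terms in the
    -- radical.
    refine ⟨t * r, ?_⟩
    have h1 := Submodule.smul_mem _ a' ht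
    have h2 := Submodule.smul_mem _ (algebraMap R Λ t) hr
    have h3 := Submodule.add_mem _ h1 h2
    convert! h3 using 1
    have := Algebra.commutes t a'
    simp only [smul_eq_mul, mul_sub, map_mul]
    rw [← mul_assoc a' (algebraMap R Λ t), ← this]
    noncomm_ring
  | add a b ha hb =>
    obtain ⟨r, hr⟩ := ha
    obtain ⟨t, ht⟩ := hb
    refine ⟨r + t, ?_⟩
    convert! Submodule.add_mem _ hr ht using 1
    simp only [map_add]
    noncomm_ring



end Presentation

end Gentle

/-! ### Annihilators of paths in a gentle algebra. -/

namespace Gentle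

namespace NPath

variable {Q₁ : Type*}

/-- The path `y γ`. -/
def cons (y : Q₁) (γ : NPath Q₁) : NPath Q₁ := ⟨y, γ.arrows⟩

/-- The path `γ σ`. -/
def append (γ σ : NPath Q₁) : NPath Q₁ := ⟨γ.last, γ.rest ++ σ.arrows⟩

theorem arrows_append (γ σ : NPath Q₁) : (γ.append σ).arrows = γ.arrows ++ σ.arrows := rfl

theorem arrows_cons (y : Q₁) (γ : NPath Q₁) : (cons y γ).arrows = y :: γ.arrows := rfl

theorem first_cons (y : Q₁) (γ : NPath Q₁) : (cons y γ).first = γ.first :=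
  List.getLast_cons (List.cons_ne_nil _ _)

theorem getLast?_arrows (γ : NPath Q₁) : γ.arrows.getLast? = some γ.first :=
  List.getLast?_eq_some_getLast _

end NPath

namespace Presentation

variable {R Λ : Type*} [CommRing R] [Ring Λ] [Algebra R Λ] {Q₀ Q₁ : Type*} [Fintype Q₀]
variable {𝔓 : Presentation R Λ Q₀ Q₁}

theorem path_cons (y : Q₁) (γ : NPath Q₁) : 𝔓.path (.cons y γ) = 𝔓.arrow y * 𝔓.path γ := by
  simp [path_eq, NPath.arrows_cons]

theorem path_append (γ σ : NPath Q₁) : 𝔓.path (γ.append σ) = 𝔓.path γ * 𝔓.path σ := by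
  simp [path_eq, NPath.arrows_append]

theorem isP_cons [Nontrivial R] {y : Q₁} {γ : NPath Q₁} (hγ : 𝔓.IsP γ) (h : 𝔓.PairP y γ.last) :
    𝔓.IsP (.cons y γ) := by
  rw [isP_iff] at hγ ⊢
  exact List.isChain_cons_cons.mpr ⟨h, hγ⟩

theorem isP_append [Nontrivial R] {γ σ : NPath Q₁} (hγ : 𝔓.IsP γ) (hσ : 𝔓.IsP σ)
    (h : 𝔓.PairP γ.first σ.last) : 𝔓.IsP (γ.append σ) := by
  rw [isP_iff] at hγ hσ ⊢
  rw [NPath.arrows_append, List.isChain_append]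
  refine ⟨hγ, hσ, fun x hx y hy => ?_⟩
  rw [NPath.getLast?_arrows] at hx
  cases hx
  cases hy
  exact h

theorem path_mem_first (γ : NPath Q₁) : 𝔓.path γ ∈ leftIdeal (𝔓.arrow γ.first) := by
  rw [path_eq_first]
  exact mul_mem_leftIdeal _ _

theorem rad_covBy (h𝔓 : 𝔓.IsCompleteGentle) (v : Q₀) : 𝔓.rad v ⋖ leftIdeal (𝔓.e v) :=
  (h𝔓.maximal_left v _).mpr rfl

theorem e_notMem_rad (h𝔓 : 𝔓.IsCompleteGentle) (v : Q₀) : 𝔓.e v ∉ 𝔓.rad v := fun h =>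
  (rad_covBy h𝔓 v).lt.not_ge ((Submodule.span_singleton_le_iff_mem _ _).mpr h)

/-- An element of `Λ e_v` outside the radical generates `Λ e_v`. -/
theorem exists_mul_eq_e (h𝔓 : 𝔓.IsCompleteGentle) {v : Q₀} {a : Λ} (ha : a ∈ leftIdeal (𝔓.e v))
    (har : a ∉ 𝔓.rad v) : ∃ b, b * a = 𝔓.e v := by
  by_contra hcon
  have : Module.Finite Λ (leftIdeal (𝔓.e v)) := inferInstance
  -- `Λe_v` is cyclic, so if `Λa` were proper in it, it would lie in a maximal submodule, which can
  -- only be the radical.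
  rcases eq_top_or_exists_le_coatom ((leftIdeal a).comap (leftIdeal (𝔓.e v)).subtype) with h | ⟨N, hN, hle⟩
  · apply hcon
    have h1 : (⟨𝔓.e v, Submodule.mem_span_singleton_self _⟩ : leftIdeal (𝔓.e v)) ∈
      (leftIdeal a).comap (leftIdeal (𝔓.e v)).subtype := by rw [h]; trivial
    exact Submodule.mem_span_singleton.mp h1
  · have h1 := ((Submodule.mapIic (leftIdeal (𝔓.e v))).isCoatom_iff N).mpr hN
    have h2 := (covBy_iff_coatom_Iic ((Submodule.mapIic (leftIdeal (𝔓.e v))) N).2).mpr h1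
    have h3 := (h𝔓.maximal_left v _).mp h2
    apply har
    change a ∈ Submodule.span Λ _
    rw [← h3]
    exact ⟨⟨a, ha⟩, hle (Submodule.mem_span_singleton_self a), rfl⟩

theorem pairP_unique (h𝔓 : 𝔓.IsCompleteGentle) {x x' y : Q₁} (h : 𝔓.PairP x y)
    (h' : 𝔓.PairP x' y) : x = x' :=
  Set.encard_le_one_iff.mp (h𝔓.mem_left y) _ _ ⟨pairP_tail _ h, h⟩ ⟨pairP_tail _ h', h'⟩

/-- The radical is spanned by arrows, and every arrow other than `y` annihilates `γ`. -/
theorem rad_mul_path_mem (h𝔓 : 𝔓.IsCompleteGentle) {γ : NPath Q₁} {y : Q₁}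
    (hy : 𝔓.PairP y γ.last) {a : Λ} (ha : a ∈ 𝔓.rad (𝔓.Q.phead γ)) :
    a * 𝔓.path γ ∈ leftIdeal (𝔓.path (.cons y γ)) := by
  have : 𝔓.rad (𝔓.Q.phead γ) ≤
      (leftIdeal (𝔓.path (.cons y γ))).comap (LinearMap.toSpanSingleton Λ Λ (𝔓.path γ)) := by
    refine Submodule.span_le.mpr ?_
    rintro _ ⟨x, hx, rfl⟩
    change 𝔓.arrow x * 𝔓.path γ ∈ leftIdeal (𝔓.path (.cons y γ))
    by_cases hp : 𝔓.PairP x γ.last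
    · rw [pairP_unique h𝔓 hp hy, ← path_cons]
      exact Submodule.mem_span_singleton_self _
    · rw [path_eq_last 𝔓 γ, ← mul_assoc, 𝔓.arrow_mul_arrow_eq_zero.mpr hp, zero_mul]
      exact zero_mem _
  exact this ha

theorem rad_mul_path_eq_zero {γ : NPath Q₁} (hy : ∀ y, ¬ 𝔓.PairP y γ.last) {a : Λ}
    (ha : a ∈ 𝔓.rad (𝔓.Q.phead γ)) : a * 𝔓.path γ = 0 := by
  have : 𝔓.rad (𝔓.Q.phead γ) ≤ LinearMap.ker (LinearMap.toSpanSingleton Λ Λ (𝔓.path γ)) := by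
    refine Submodule.span_le.mpr ?_
    rintro _ ⟨x, hx, rfl⟩
    change 𝔓.arrow x * 𝔓.path γ = 0
    rw [path_eq_last, ← mul_assoc, 𝔓.arrow_mul_arrow_eq_zero.mpr (hy x), zero_mul]
  exact this ha

/-- Write `a = cγ` with `c ∈ Λe_{h(γ)}`. If `c` is not in the radical, then some multiple of `c` is
`e_{h(γ)}`, and the same multiple of `a` is `γ`. -/
theorem leftIdeal_path_dichotomy (h𝔓 : 𝔓.IsCompleteGentle) (γ : NPath Q₁) {a : Λ}
    (ha : a ∈ leftIdeal (𝔓.path γ)) :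
    𝔓.path γ ∈ leftIdeal a ∨ ∃ b ∈ 𝔓.rad (𝔓.Q.phead γ), b * 𝔓.path γ = a := by
  obtain ⟨c, rfl⟩ := Submodule.mem_span_singleton.mp ha
  have hc : c • 𝔓.path γ = c * 𝔓.e (𝔓.Q.phead γ) * 𝔓.path γ := by
    rw [mul_assoc, e_mul_path, smul_eq_mul]
  rw [hc]
  by_cases h : c * 𝔓.e (𝔓.Q.phead γ) ∈ 𝔓.rad (𝔓.Q.phead γ)
  · exact Or.inr ⟨_, h, rfl⟩
  · obtain ⟨b, hb⟩ := exists_mul_eq_e h𝔓 (𝔓.mul_e_mem _ _) h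
    left
    refine Submodule.mem_span_singleton.mpr ⟨b, ?_⟩
    rw [smul_eq_mul, ← mul_assoc, hb, e_mul_path]

/-- A Nakayama argument: from `γ = cyγ` it follows that `(e - cy)γ = 0`; but `e - cy` is outside the
radical and so generates `Λe`, giving `γ = 0`. This makes the chain of the ideals `Λγ` strictly
descending. -/
theorem path_notMem_cons (h𝔓 : 𝔓.IsCompleteGentle) {γ : NPath Q₁} (hγ : 𝔓.IsP γ) {y : Q₁}
    (hy : 𝔓.PairP y γ.last) : 𝔓.path γ ∉ leftIdeal (𝔓.path (.cons y γ)) := by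
  intro h
  obtain ⟨c, hc⟩ := Submodule.mem_span_singleton.mp h
  have ht := pairP_tail _ hy
  have h1 : 𝔓.e (𝔓.Q.phead γ) - c * 𝔓.arrow y ∈ leftIdeal (𝔓.e (𝔓.Q.phead γ)) := by
    rw [mem_leftIdeal_e, sub_mul, e_mul_self, mul_assoc, Quiv.phead, ← ht, mul_e_tail]
  have h2 : c * 𝔓.arrow y ∈ 𝔓.rad (𝔓.Q.phead γ) := by
    rw [Quiv.phead, ← ht]
    exact Submodule.smul_mem _ c (𝔓.arrow_mem_rad y)
  obtain ⟨b, hb⟩ := exists_mul_eq_e h𝔓 h1 fun h3 => e_notMem_rad h𝔓 _ (by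
    simpa using Submodule.add_mem _ h3 h2)
  apply 𝔓.path_ne_zero hγ
  rw [← e_mul_path, ← hb, mul_assoc, sub_mul, e_mul_path, mul_assoc, ← path_cons]
  rw [smul_eq_mul] at hc
  rw [hc, sub_self, mul_zero]

theorem leftIdeal_fg (h𝔓 : 𝔓.IsCompleteGentle) (x : Q₁) :
    Module.Finite R (leftIdeal (𝔓.arrow x)) := by
  have h := h𝔓.finite_left x
  have h1 : LinearMap.range (LinearMap.mulRight R (𝔓.arrow x)) =
      (leftIdeal (𝔓.arrow x)).restrictScalars R := by
    ext a
    rw [LinearMap.mem_range, Submodule.restrictScalars_mem, Submodule.mem_span_singleton]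
    rfl
  rw [h1] at h
  exact Module.Finite.iff_fg.mpr h

/-- Every nonzero submodule of `Λ x` for an arrow `x`, being cyclic, is generated by a path. -/
theorem exists_path_generator [IsLocalRing R] [IsNoetherianRing R] (h𝔓 : 𝔓.IsCompleteGentle)
    {x : Q₁} {a : Λ} (ha : a ∈ leftIdeal (𝔓.arrow x)) (ha0 : a ≠ 0) :
    ∃ γ, 𝔓.IsP γ ∧ γ.first = x ∧ 𝔓.path γ ∈ leftIdeal a := by
  by_contra! hcon
  -- The paths with first arrow `x` whose left ideal contains `a`. If no path lies in `Λa`, the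
  -- dichotomy allows each of them to be prolonged within `T`, so there is an infinite chain
  -- starting with `x`.
  let T := {γ : NPath Q₁ // 𝔓.IsP γ ∧ γ.first = x ∧ a ∈ leftIdeal (𝔓.path γ)}
  have step : ∀ γ : T, ∃ (γ' : T) (y : Q₁), 𝔓.PairP y γ.1.last ∧ γ'.1 = .cons y γ.1 := by
    rintro ⟨γ, hγ, hx, hmem⟩
    rcases leftIdeal_path_dichotomy h𝔓 γ hmem with h | ⟨b, hb, hba⟩
    · exact absurd h (hcon γ hγ hx)
    · by_cases hy : ∃ y, 𝔓.PairP y γ.last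
      · obtain ⟨y, hy⟩ := hy
        refine ⟨⟨.cons y γ, isP_cons hγ hy, (NPath.first_cons y γ).trans hx, ?_⟩, y, hy, rfl⟩
        rw [← hba]
        exact rad_mul_path_mem h𝔓 hy hb
      · exact absurd (hba.symm.trans (rad_mul_path_eq_zero (not_exists.mp hy) hb)) ha0
  choose f y hy hf using step
  let t₀ : T := ⟨⟨x, []⟩, 𝔓.isP_arrow x, rfl, by rwa [path_arrow]⟩
  let p : ℕ → T := fun k => f^[k] t₀
  have hp : ∀ k, (p (k + 1)).1 = .cons (y (p k)) (p k).1 := fun k => by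
    simp only [p]
    rw [Function.iterate_succ_apply', hf]
  have hfin := leftIdeal_fg h𝔓 x
  let F : ℕ → Submodule R (leftIdeal (𝔓.arrow x)) := fun k =>
    ((leftIdeal (𝔓.path (p k).1)).comap (leftIdeal (𝔓.arrow x)).subtype).restrictScalars R
  have hmemF : ∀ k (z : leftIdeal (𝔓.arrow x)), z ∈ F k ↔ (z : Λ) ∈ leftIdeal (𝔓.path (p k).1) :=
    fun k z => Iff.rfl
  have hanti : Antitone F := by
    refine antitone_nat_of_succ_le fun k z hz => ?_
    rw [hmemF] at hz ⊢
    refine leftIdeal_le.mpr ?_ hz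
    rw [hp, path_cons]
    exact mul_mem_leftIdeal _ _
  have hpx : ∀ k, 𝔓.path (p k).1 ∈ leftIdeal (𝔓.arrow x) := fun k => by
    have := path_mem_first (𝔓 := 𝔓) (p k).1
    rwa [(p k).2.2.1] at this
  -- The chain is strict because a path is never a left multiple of its own prolongation.
  have hbot := iInf_eq_bot_of_antitone F hanti (fun k h => by
    refine path_notMem_cons h𝔓 (p k).2.1 (hy (p k)) ?_
    rw [← hp]
    have : (⟨_, hpx k⟩ : leftIdeal (𝔓.arrow x)) ∈ F k := Submodule.mem_span_singleton_self _
    rw [← h] at this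
    exact this) (fun j k => by
    set K := IsLocalRing.maximalIdeal R ^ j • (⊤ : Submodule R (leftIdeal (𝔓.arrow x))) with hK
    -- The scalars from `R` are central, so `𝔪ʲ(Λx)` is a left ideal. Only for this reason can it be
    -- compared with the ideals `Λγ`.
    have hstab : ∀ (c : Λ) (z : leftIdeal (𝔓.arrow x)), z ∈ K → c • z ∈ K := by
      intro c z hz
      refine Submodule.smul_induction_on hz ?_ ?_
      · intro r hr n _
        rw [smul_comm]
        exact Submodule.smul_mem_smul hr trivial
      · intro z w hz hw
        rw [smul_add]
        exact Submodule.add_mem _ hz hw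
    induction k with
    | zero =>
      left
      intro z _
      rw [hmemF]
      simp [p, t₀, path_arrow]
    | succ k ih =>
      rcases ih with ih | ih
      · by_cases hle : K ≤ F (k + 1)
        · exact Or.inl hle
        · right
          obtain ⟨z, hz, hz'⟩ := Set.not_subset.mp hle
          -- An element of `K` in `Λγ` outside the next member of the chain cannot be a radical
          -- multiple of `γ`, so `γ` is a multiple of it and `K` contains `Λγ`.
          rcases leftIdeal_path_dichotomy h𝔓 _ ((hmemF _ _).mp (ih hz)) with h | ⟨b, hb, hbz⟩
          · refine (hanti (Nat.le_succ k)).trans fun w hw => ?_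
            obtain ⟨c, hc⟩ := Submodule.mem_span_singleton.mp (leftIdeal_le.mpr h hw)
            have : w = c • z := Subtype.ext hc.symm
            rw [this]
            exact hstab c z hz
          · refine absurd ?_ hz'
            rw [SetLike.mem_coe, hmemF, ← hbz, hp]
            exact rad_mul_path_mem h𝔓 (hy (p k)) hb
      · exact Or.inr ((hanti (Nat.le_succ k)).trans ih))
  have hz : (⟨a, ha⟩ : leftIdeal (𝔓.arrow x)) ∈ ⨅ k, F k :=
    (Submodule.mem_iInf _).mpr fun k => (p k).2.2.2
  rw [hbot, Submodule.mem_bot] at hz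
  exact ha0 (congrArg Subtype.val hz)

/-- Right multiplication by `γ` is injective on `Λ x` if `xγ ∈ 𝐏`. -/
theorem eq_zero_of_mul_path_eq_zero [IsLocalRing R] [IsNoetherianRing R]
    (h𝔓 : 𝔓.IsCompleteGentle) {x : Q₁} {γ : NPath Q₁} (hγ : 𝔓.IsP γ) (hx : 𝔓.PairP x γ.last)
    {a : Λ} (ha : a ∈ leftIdeal (𝔓.arrow x)) (h : a * 𝔓.path γ = 0) : a = 0 := by
  by_contra ha0
  -- There is a path `σ = ca` with first arrow `x`. Then `σγ ∈ 𝐏` is nonzero, while `σγ = caγ = 0`.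
  obtain ⟨σ, hσ, rfl, hmem⟩ := exists_path_generator h𝔓 ha ha0
  obtain ⟨c, hc⟩ := Submodule.mem_span_singleton.mp hmem
  refine 𝔓.path_ne_zero (isP_append hσ hγ hx) ?_
  rw [path_append, ← hc, smul_eq_mul, mul_assoc, h, mul_zero]

/-- The arrow `c` with `t(c) = h(a)` and `c a = 0` is unique. -/
theorem next_eq_some (h𝔓 : 𝔓.IsCompleteGentle) {a c : Q₁} :
    𝔓.next a = some c ↔ 𝔓.Q.tail c = 𝔓.Q.head a ∧ 𝔓.arrow c * 𝔓.arrow a = 0 := by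
  unfold next
  split_ifs with h
  · constructor
    · intro h1
      cases h1
      exact h.choose_spec
    · intro h1
      refine congrArg some (Set.encard_le_one_iff.mp (h𝔓.not_mem_left a) _ _ ?_ ?_)
      · exact ⟨h.choose_spec.1, 𝔓.arrow_mul_arrow_eq_zero.mp h.choose_spec.2⟩
      · exact ⟨h1.1, 𝔓.arrow_mul_arrow_eq_zero.mp h1.2⟩
  · simp only [false_iff]
    exact fun h1 => h ⟨c, h1⟩

/-- This uses the gentle condition on the other side: at most one arrow ending at `t(c)` has zero
product with `c`. It makes the annihilators of paths with different last arrows different. -/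
theorem next_injective (h𝔓 : 𝔓.IsCompleteGentle) {a b c : Q₁} (ha : 𝔓.next a = some c)
    (hb : 𝔓.next b = some c) : a = b := by
  rw [next_eq_some h𝔓] at ha hb
  exact Set.encard_le_one_iff.mp (h𝔓.not_mem_right c) _ _
    ⟨ha.1.symm, 𝔓.arrow_mul_arrow_eq_zero.mp ha.2⟩ ⟨hb.1.symm, 𝔓.arrow_mul_arrow_eq_zero.mp hb.2⟩

/-- The annihilator in `Λ e_{h(γ)}` of a path `γ ∈ 𝐏`. -/
theorem mem_of_mul_path_eq_zero [IsLocalRing R] [IsNoetherianRing R] (h𝔓 : 𝔓.IsCompleteGentle)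
    {γ : NPath Q₁} (hγ : 𝔓.IsP γ) {a : Λ} (ha : a ∈ leftIdeal (𝔓.e (𝔓.Q.phead γ)))
    (h : a * 𝔓.path γ = 0) : a ∈ (𝔓.next γ.last).elim ⊥ fun c => leftIdeal (𝔓.arrow c) := by
  -- Outside the radical, `a` would generate `Λe`, and `e` does not annihilate `γ`.
  have har : a ∈ 𝔓.rad (𝔓.Q.phead γ) := by
    by_contra har
    obtain ⟨b, hb⟩ := exists_mul_eq_e h𝔓 ha har
    refine 𝔓.path_ne_zero hγ ?_
    rw [← e_mul_path, ← hb, mul_assoc, h, mul_zero]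
  set K := (𝔓.next γ.last).elim ⊥ fun c => leftIdeal (𝔓.arrow c) with hK
  have hmem : ∀ c, 𝔓.Q.tail c = 𝔓.Q.phead γ → ¬ 𝔓.PairP c γ.last → 𝔓.arrow c ∈ K := by
    intro c hc hp
    have : 𝔓.next γ.last = some c := (next_eq_some h𝔓).mpr
      ⟨hc, 𝔓.arrow_mul_arrow_eq_zero.mpr hp⟩
    rw [hK, this]
    exact Submodule.mem_span_singleton_self _
  have hK0 : ∀ b ∈ K, b * 𝔓.path γ = 0 := by
    intro b hb
    rw [hK] at hb
    cases hn : 𝔓.next γ.last with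
    | none =>
      rw [hn] at hb
      rw [(Submodule.mem_bot _).mp hb, zero_mul]
    | some c =>
      rw [hn] at hb
      obtain ⟨d, rfl⟩ := Submodule.mem_span_singleton.mp hb
      rw [path_eq_last, smul_eq_mul, mul_assoc, ← mul_assoc (𝔓.arrow c),
        ((next_eq_some h𝔓).mp hn).2, zero_mul, mul_zero]
  by_cases hy : ∃ y, 𝔓.PairP y γ.last
  · obtain ⟨y, hy⟩ := hy
    -- An arrow starting at `h(γ)` either prolongs `γ`, and is then `y`, or annihilates it. The
    -- summand in `Λy` vanishes by injectivity of multiplication by `γ`.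
    have hle : 𝔓.rad (𝔓.Q.phead γ) ≤ leftIdeal (𝔓.arrow y) ⊔ K := by
      refine Submodule.span_le.mpr ?_
      rintro _ ⟨x, hx, rfl⟩
      by_cases hp : 𝔓.PairP x γ.last
      · rw [pairP_unique h𝔓 hp hy]
        exact Submodule.mem_sup_left (Submodule.mem_span_singleton_self _)
      · exact Submodule.mem_sup_right (hmem x hx hp)
    obtain ⟨b, hb, c, hc, rfl⟩ := Submodule.mem_sup.mp (hle har)
    rw [add_mul, hK0 c hc, add_zero] at h
    rw [eq_zero_of_mul_path_eq_zero h𝔓 hγ hy hb h, zero_add]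
    exact hc
  · have hle : 𝔓.rad (𝔓.Q.phead γ) ≤ K := by
      refine Submodule.span_le.mpr ?_
      rintro _ ⟨x, hx, rfl⟩
      exact hmem x hx fun hp => hy ⟨x, hp⟩
    exact hle har

theorem eq_zero_of_mem_leftIdeal_of_ne (h𝔓 : 𝔓.IsCompleteGentle) {x y : Q₁} (hxy : x ≠ y) {a : Λ}
    (hx : a ∈ leftIdeal (𝔓.arrow x)) (hy : a ∈ leftIdeal (𝔓.arrow y)) : a = 0 := by
  have h := h𝔓.disjoint_left x y hxy
  have : a ∈ LinearMap.range (LinearMap.mulRight R (𝔓.arrow x)) ⊓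
      LinearMap.range (LinearMap.mulRight R (𝔓.arrow y)) :=
    ⟨Submodule.mem_span_singleton.mp hx, Submodule.mem_span_singleton.mp hy⟩
  rw [h] at this
  exact this

/-- No nonzero element of `Λ e_v` annihilates two paths of `𝐏` with head `v` and different last
arrows. -/
theorem eq_zero_of_mul_path_eq_zero_of_ne [IsLocalRing R] [IsNoetherianRing R]
    (h𝔓 : 𝔓.IsCompleteGentle) {γ σ : NPath Q₁} (hγ : 𝔓.IsP γ) (hσ : 𝔓.IsP σ)
    (hh : 𝔓.Q.phead γ = 𝔓.Q.phead σ) (hne : γ.last ≠ σ.last) {a : Λ}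
    (ha : a ∈ leftIdeal (𝔓.e (𝔓.Q.phead γ))) (h1 : a * 𝔓.path γ = 0) (h2 : a * 𝔓.path σ = 0) :
    a = 0 := by
  have h3 := mem_of_mul_path_eq_zero h𝔓 hγ ha h1
  rw [hh] at ha
  have h4 := mem_of_mul_path_eq_zero h𝔓 hσ ha h2
  cases hc : 𝔓.next γ.last with
  | none => rw [hc] at h3; exact h3
  | some c =>
    cases hd : 𝔓.next σ.last with
    | none => rw [hd] at h4; exact h4
    | some d =>
      rw [hc] at h3
      rw [hd] at h4
      refine eq_zero_of_mem_leftIdeal_of_ne h𝔓 ?_ h3 h4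
      rintro rfl
      exact hne (next_injective h𝔓 hc hd)

/-- Multiples of paths with different first arrows cancel only trivially. -/
theorem mul_path_eq_zero_of_add (h𝔓 : 𝔓.IsCompleteGentle) {γ σ : NPath Q₁}
    (hne : γ.first ≠ σ.first) {a b : Λ} (h : a * 𝔓.path γ + b * 𝔓.path σ = 0) :
    a * 𝔓.path γ = 0 ∧ b * 𝔓.path σ = 0 := by
  have h1 : a * 𝔓.path γ ∈ leftIdeal (𝔓.arrow γ.first) :=
    Submodule.smul_mem _ a (path_mem_first γ)
  have h2 : b * 𝔓.path σ ∈ leftIdeal (𝔓.arrow σ.first) :=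
    Submodule.smul_mem _ b (path_mem_first σ)
  have h3 : a * 𝔓.path γ = 0 := by
    refine eq_zero_of_mem_leftIdeal_of_ne h𝔓 hne h1 ?_
    rw [eq_neg_of_add_eq_zero_left h]
    exact neg_mem h2
  rw [h3, zero_add] at h
  exact ⟨h3, h⟩

end Presentation

end Gentle

/-! ### Coordinates in string complexes, and cycles coordinate by coordinate. -/

namespace Gentle

namespace FreeOn

variable {Λ : Type*} [Ring Λ] {ι : Type*} {e : ι → Λ}

open Classical in
/-- The coordinates of an element of `⨁ᵢ Λ eᵢ`. -/
noncomputable def coord (i : ι) : FreeOn e →ₗ[Λ] Λ :=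
  (leftIdeal (e i)).subtype.comp (DirectSum.component Λ ι (fun i => leftIdeal (e i)) i)

open Classical in
theorem coord_gen (i j : ι) : coord j (gen e i) = if i = j then e i else 0 := by
  rw [coord, gen, LinearMap.comp_apply, DirectSum.component.of]
  split_ifs with h
  · subst h; rfl
  · rfl

theorem coord_mem (i : ι) (x : FreeOn e) : coord i x ∈ leftIdeal (e i) :=
  (DirectSum.component Λ ι (fun i => leftIdeal (e i)) i x).2

theorem ext_coord {x y : FreeOn e} (h : ∀ i, coord i x = coord i y) : x = y :=
  DFinsupp.ext fun i => Subtype.ext (h i)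

/-- A submodule contains every element whose components it contains. -/
theorem mem_of_coord_smul_gen_mem (he : ∀ i, e i * e i = e i) {N : Submodule Λ (FreeOn e)}
    {x : FreeOn e} (h : ∀ i, coord i x • gen e i ∈ N) : x ∈ N := by
  classical
  rw [← DirectSum.sum_support_of x]
  refine Submodule.sum_mem _ fun i _ => ?_
  have := h i
  obtain ⟨a, ha⟩ := Submodule.mem_span_singleton.mp (x i).2
  have h1 : coord i x = a * e i := ha.symm
  have h2 : DirectSum.of (fun i => leftIdeal (e i)) i (x i) = coord i x • gen e i := by
    rw [gen, ← map_smul]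
    refine congrArg (DirectSum.lof Λ ι (fun i => leftIdeal (e i)) i) (Subtype.ext ?_)
    change ((x i : leftIdeal (e i)) : Λ) = coord i x * e i
    rw [h1, mul_assoc, he, ← ha]
    rfl
  rw [h2]
  exact this

/-- Right multiplication by the idempotent retracts `Λ` onto `Λa`. -/
theorem projective_leftIdeal {a : Λ} (ha : a * a = a) : Module.Projective Λ (leftIdeal a) := by
  refine Module.Projective.of_split (leftIdeal a).subtype
    ((LinearMap.toSpanSingleton Λ Λ a).codRestrict _ fun b =>
      Submodule.smul_mem _ b (Submodule.mem_span_singleton_self _)) ?_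
  refine LinearMap.ext fun x => Subtype.ext ?_
  obtain ⟨b, hb⟩ := Submodule.mem_span_singleton.mp x.2
  change (x : Λ) * a = x
  rw [← hb, smul_eq_mul, mul_assoc, ha]

theorem projective (he : ∀ i, e i * e i = e i) : Module.Projective Λ (FreeOn e) := by
  classical
  have := fun i => projective_leftIdeal (he i)
  exact inferInstanceAs (Module.Projective Λ (Π₀ i, leftIdeal (e i)))

end FreeOn

namespace Seq

variable {Q₀ X : Type*}

theorem mem_index_of_letterAt {C : Seq Q₀ X} {i : ℤ} {l : Letter X} (h : C.letterAt i = some l) :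
    i ∈ C.index ∧ i - 1 ∈ C.index := by
  cases C with
  | triv => simp [letterAt] at h
  | fin l _ =>
    simp only [letterAt] at h
    split_ifs at h with hi
    obtain ⟨h1, -⟩ := List.getElem?_eq_some_iff.mp h
    simp only [index, Set.mem_Icc]
    omega
  | right c =>
    simp only [letterAt] at h
    split_ifs at h with hi
    simp only [index, Set.mem_Ici]
    omega
  | left c =>
    simp only [letterAt] at h
    split_ifs at h with hi
    simp only [index, Set.mem_Iic]
    omega
  | bi c => simp [index]

/-- Except for trivial sequences, the index set is recovered from the letters, so that knowing
`letterAt` is enough for questions about positions. -/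
theorem mem_index_iff {C : Seq Q₀ X} {i : ℤ} : i ∈ C.index ↔
    (C.letterAt i).isSome ∨ (C.letterAt (i + 1)).isSome ∨ (∃ v δ, C = triv v δ) ∧ i = 0 := by
  constructor
  · intro h
    cases C with
    | triv v δ => exact Or.inr (Or.inr ⟨⟨v, δ, rfl⟩, h⟩)
    | fin l hl =>
      have := List.length_pos_iff.mpr hl
      simp only [index, Set.mem_Icc] at h
      rcases h.1.eq_or_lt with h0 | h0
      · subst h0
        right; left
        simp [letterAt, this]
      · left
        simp only [letterAt, if_pos h0, isSome_getElem?]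
        omega
    | right c =>
      simp only [index, Set.mem_Ici] at h
      right; left
      simp only [letterAt]
      rw [if_pos (by omega)]
      rfl
    | left c =>
      simp only [index, Set.mem_Iic] at h
      left
      simp only [letterAt]
      rw [if_pos (by omega)]
      rfl
    | bi c => exact Or.inl rfl
  · rintro (h | h | ⟨⟨v, δ, rfl⟩, rfl⟩)
    · obtain ⟨l, hl⟩ := Option.isSome_iff_exists.mp h
      exact (mem_index_of_letterAt hl).1
    · obtain ⟨l, hl⟩ := Option.isSome_iff_exists.mp h
      have := (mem_index_of_letterAt hl).2
      rwa [add_sub_cancel_right] at this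
    · rfl

/-- The differential raises the degree by one, and a direct letter sends the generator on its right
to the one on its left. -/
theorem ht_of_dir {C : Seq Q₀ X} {i : ℤ} {η : X} (h : C.letterAt i = some (.dir η)) :
    C.ht (i - 1) = C.ht i + 1 := by
  have := C.ht_succ (i - 1)
  rw [sub_add_cancel, degAt, h] at this
  simp only [Option.elim_some, Letter.deg] at this
  omega

theorem ht_of_inv {C : Seq Q₀ X} {i : ℤ} {η : X} (h : C.letterAt (i + 1) = some (.inv η)) :
    C.ht (i + 1) = C.ht i + 1 := by
  have := C.ht_succ i
  rw [degAt, h] at this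
  exact this

end Seq

namespace Presentation

variable {R Λ : Type*} [CommRing R] [Ring Λ] [Algebra R Λ] {Q₀ Q₁ : Type*} [Fintype Q₀]
variable {𝔓 : Presentation R Λ Q₀ Q₁} {𝒞 : GWord Q₀ Q₁}

theorem gIdem_of_dir {i : ℤ} {η : NPath Q₁} (h : 𝒞.letterAt i = some (.dir η)) :
    𝔓.gIdem 𝒞 i = 𝔓.e (𝔓.Q.phead η) := by
  rw [gIdem, vertex_of_letterAt 𝔓 𝒞 h]
  rfl

theorem gIdem_of_inv_succ (h𝒞 : 𝔓.IsGWord 𝒞) {i : ℤ} {μ : NPath Q₁}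
    (h : 𝒞.letterAt (i + 1) = some (.inv μ)) : 𝔓.gIdem 𝒞 i = 𝔓.e (𝔓.Q.phead μ) := by
  rw [gIdem, vertex_of_letterAt_succ 𝔓 h𝒞 h]
  rfl

theorem gIdem_of_inv {i : ℤ} {η : NPath Q₁} (h : 𝒞.letterAt i = some (.inv η)) :
    𝔓.gIdem 𝒞 i = 𝔓.e (𝔓.Q.ptail η) := by
  rw [gIdem, vertex_of_letterAt 𝔓 𝒞 h]
  rfl

theorem gIdem_of_dir_succ (h𝒞 : 𝔓.IsGWord 𝒞) {i : ℤ} {μ : NPath Q₁}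
    (h : 𝒞.letterAt (i + 1) = some (.dir μ)) : 𝔓.gIdem 𝒞 i = 𝔓.e (𝔓.Q.ptail μ) := by
  rw [gIdem, vertex_of_letterAt_succ 𝔓 h𝒞 h]
  rfl

open Classical in
/-- The coordinates of an element of `Pⁿ(𝒞)`, as a family indexed by `ℤ`. -/
noncomputable def strCoord (𝒞 : GWord Q₀ Q₁) (n : ℤ) : 𝔓.StrX 𝒞 n →ₗ[Λ] ℤ → Λ :=
  LinearMap.pi fun i => if h : i ∈ 𝒞.index ∧ 𝒞.ht i = n then FreeOn.coord ⟨i, h⟩ else 0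

theorem strCoord_of_mem {n i : ℤ} (h : i ∈ 𝒞.index ∧ 𝒞.ht i = n) (x : 𝔓.StrX 𝒞 n) :
    strCoord 𝒞 n x i = FreeOn.coord ⟨i, h⟩ x := by
  rw [strCoord, LinearMap.pi_apply, dif_pos h]

theorem strCoord_of_notMem {n i : ℤ} (h : ¬ (i ∈ 𝒞.index ∧ 𝒞.ht i = n)) (x : 𝔓.StrX 𝒞 n) :
    strCoord 𝒞 n x i = 0 := by
  rw [strCoord, LinearMap.pi_apply, dif_neg h]
  rfl

theorem strCoord_mem (n i : ℤ) (x : 𝔓.StrX 𝒞 n) : strCoord 𝒞 n x i ∈ leftIdeal (𝔓.gIdem 𝒞 i) := by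
  by_cases h : i ∈ 𝒞.index ∧ 𝒞.ht i = n
  · rw [strCoord_of_mem h]
    have h1 := FreeOn.coord_mem (e := 𝔓.strIdem 𝒞 n) ⟨i, h⟩ x
    rw [strIdem] at h1
    exact h1
  · rw [strCoord_of_notMem h]
    exact zero_mem _

open Classical in
theorem strCoord_strGen (n i j : ℤ) : strCoord 𝒞 n (𝔓.strGen 𝒞 n i) j =
    if (i ∈ 𝒞.index ∧ 𝒞.ht i = n) ∧ i = j then 𝔓.gIdem 𝒞 i else 0 := by
  by_cases hi : i ∈ 𝒞.index ∧ 𝒞.ht i = n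
  · rw [strGen, dif_pos hi]
    by_cases hj : j ∈ 𝒞.index ∧ 𝒞.ht j = n
    · rw [strCoord_of_mem hj, FreeOn.coord_gen]
      by_cases hij : i = j
      · subst hij
        simp [hi, strIdem]
      · rw [if_neg (fun h => hij (congrArg Subtype.val h)), if_neg (fun h => hij h.2)]
    · rw [strCoord_of_notMem hj, if_neg]
      rintro ⟨_, rfl⟩
      exact hj hi
  · rw [strGen, dif_neg hi, map_zero, if_neg (fun h => hi h.1)]
    rfl

/-- The differential of the string complex in terms of coordinates. -/
noncomputable def famD (𝔓 : Presentation R Λ Q₀ Q₁) (𝒞 : GWord Q₀ Q₁) : (ℤ → Λ) →ₗ[Λ] ℤ → Λ :=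
  LinearMap.pi fun j =>
    (match 𝒞.letterAt (j + 1) with
      | some (.dir η) => (LinearMap.toSpanSingleton Λ Λ (𝔓.path η)).comp (LinearMap.proj (j + 1))
      | _ => 0) +
    match 𝒞.letterAt j with
      | some (.inv μ) => (LinearMap.toSpanSingleton Λ Λ (𝔓.path μ)).comp (LinearMap.proj (j - 1))
      | _ => 0

theorem strCoord_smul_strGen (n i : ℤ) (a : Λ) (h : i ∈ 𝒞.index ∧ 𝒞.ht i = n) :
    strCoord 𝒞 n (a • 𝔓.strGen 𝒞 n i) = Pi.single i (a * 𝔓.gIdem 𝒞 i) := by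
  classical
  funext j
  rw [map_smul, Pi.smul_apply, strCoord_strGen, Pi.single_apply]
  by_cases hij : i = j
  · subst hij
    rw [if_pos ⟨h, rfl⟩, if_pos rfl, smul_eq_mul]
  · rw [if_neg (fun h => hij h.2), if_neg (Ne.symm hij), smul_zero]

/-- The boundary `g⁻ + g⁺` is organised by source, and `famD` by target: position `j` receives from
`j + 1` through a direct letter and from `j - 1` through an inverse one. -/
theorem famD_single (h𝒞 : 𝔓.IsGWord 𝒞) (n i : ℤ) (h : i ∈ 𝒞.index ∧ 𝒞.ht i = n) :
    famD 𝔓 𝒞 (Pi.single i (𝔓.gIdem 𝒞 i)) =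
      strCoord 𝒞 (n + 1) (𝔓.strBdLeft 𝒞 (n + 1) i + 𝔓.strBdRight 𝒞 (n + 1) i) := by
  classical
  funext j
  rw [map_add, Pi.add_apply, famD, LinearMap.pi_apply, LinearMap.add_apply]
  congr 1
  · unfold strBdLeft
    by_cases hij : j + 1 = i
    · subst hij
      cases hl : 𝒞.letterAt (j + 1) with
      | none => simp
      | some l =>
        cases l with
        | inv μ => simp
        | dir η =>
          have h1 := Seq.mem_index_of_letterAt hl
          have h2 := Seq.ht_of_dir hl
          simp only
          rw [add_sub_cancel_right] at h1 h2 ⊢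
          rw [strCoord_smul_strGen _ _ _ ⟨h1.2, by omega⟩, Pi.single_eq_same, LinearMap.comp_apply,
            LinearMap.proj_apply, Pi.single_eq_same, LinearMap.toSpanSingleton_apply, smul_eq_mul,
            gIdem_of_dir hl, e_mul_path, gIdem_of_dir_succ h𝒞 hl, path_mul_e]
    · have hL : ∀ f : ℤ → Λ, f (j + 1) = 0 → (match 𝒞.letterAt (j + 1) with
          | some (.dir η) => (LinearMap.toSpanSingleton Λ Λ (𝔓.path η)).comp
              (LinearMap.proj (R := Λ) (φ := fun _ : ℤ => Λ) (j + 1))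
          | _ => 0) f = 0 := by
        intro f hf
        split
        · simp [hf]
        · rfl
      rw [hL _ (Pi.single_eq_of_ne hij _)]
      split
      · rename_i η hl
        have h1 := Seq.mem_index_of_letterAt hl
        have h2 := Seq.ht_of_dir hl
        rw [strCoord_smul_strGen _ _ _ ⟨h1.2, by omega⟩, Pi.single_eq_of_ne (by omega)]
      · rw [map_zero]; rfl
  · unfold strBdRight
    by_cases hij : j - 1 = i
    · obtain rfl : j = i + 1 := by omega
      cases hl : 𝒞.letterAt (i + 1) with
      | none => simp
      | some l =>
        cases l with
        | dir μ => simp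
        | inv η =>
          have h1 := Seq.mem_index_of_letterAt hl
          have h2 := Seq.ht_of_inv hl
          simp only
          rw [strCoord_smul_strGen _ _ _ ⟨h1.1, by omega⟩, Pi.single_eq_same, LinearMap.comp_apply,
            LinearMap.proj_apply, add_sub_cancel_right, Pi.single_eq_same,
            LinearMap.toSpanSingleton_apply, smul_eq_mul, gIdem_of_inv_succ h𝒞 hl, e_mul_path,
            gIdem_of_inv hl, path_mul_e]
    · have hL : ∀ f : ℤ → Λ, f (j - 1) = 0 → (match 𝒞.letterAt j with
          | some (.inv η) => (LinearMap.toSpanSingleton Λ Λ (𝔓.path η)).comp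
              (LinearMap.proj (R := Λ) (φ := fun _ : ℤ => Λ) (j - 1))
          | _ => 0) f = 0 := by
        intro f hf
        split
        · simp [hf]
        · rfl
      rw [hL _ (Pi.single_eq_of_ne hij _)]
      split
      · rename_i η hl
        have h1 := Seq.mem_index_of_letterAt hl
        have h2 := Seq.ht_of_inv hl
        rw [strCoord_smul_strGen _ _ _ ⟨h1.1, by omega⟩, Pi.single_eq_of_ne (by omega)]
      · rw [map_zero]; rfl

/-- Cycles may now be studied as families `ℤ → Λ` without reference to degrees. The same families
serve for band complexes, where they need not have finite support. -/
theorem strCoord_strD (h𝒞 : 𝔓.IsGWord 𝒞) (n : ℤ) (x : 𝔓.StrX 𝒞 n) :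
    strCoord 𝒞 (n + 1) (𝔓.strD 𝒞 n x) = famD 𝔓 𝒞 (strCoord 𝒞 n x) := by
  have : (strCoord 𝒞 (n + 1)).comp (𝔓.strD 𝒞 n) = (famD 𝔓 𝒞).comp (strCoord 𝒞 n) := by
    refine FreeOn.hom_ext fun i => ?_
    have hg : FreeOn.gen (𝔓.strIdem 𝒞 n) i = 𝔓.strGen 𝒞 n i := by rw [strGen, dif_pos i.2]
    rw [LinearMap.comp_apply, LinearMap.comp_apply, hg, strD_strGen 𝔓 h𝒞, if_pos i.2,
      ← famD_single h𝒞 n i i.2]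
    congr 1
    have := strCoord_smul_strGen (𝔓 := 𝔓) n i 1 i.2
    rw [one_smul, one_mul] at this
    exact this.symm
  exact LinearMap.congr_fun this x

/-- Each of the terms of a family in the kernel of the differential vanishes. -/
theorem mul_path_eq_zero_of_famD (h𝔓 : 𝔓.IsCompleteGentle) (h𝒞 : 𝔓.IsGWord 𝒞) {f : ℤ → Λ}
    (hf : famD 𝔓 𝒞 f = 0) (i : ℤ) :
    (∀ η, 𝒞.letterAt i = some (.dir η) → f i * 𝔓.path η = 0) ∧
      ∀ μ, 𝒞.letterAt (i + 1) = some (.inv μ) → f i * 𝔓.path μ = 0 := by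
  constructor
  · intro η hη
    have h1 := congrFun hf (i - 1)
    rw [famD, LinearMap.pi_apply, LinearMap.add_apply, sub_add_cancel, hη] at h1
    cases hl : 𝒞.letterAt (i - 1) with
    | none => rw [hl] at h1; simpa using h1
    | some l =>
      rw [hl] at h1
      cases l with
      | dir σ => simpa using h1
      | inv μ =>
        -- Two generators map to position `i - 1`, through paths with different first arrows, so the
        -- two contributions vanish separately.
        have hadj := h𝒞.adjacent (i - 1) _ _ hl (by rwa [sub_add_cancel])
        exact (mul_path_eq_zero_of_add h𝔓 (Ne.symm hadj.2) h1).1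
  · intro μ hμ
    have h1 := congrFun hf (i + 1)
    rw [famD, LinearMap.pi_apply, LinearMap.add_apply, hμ] at h1
    cases hl : 𝒞.letterAt (i + 1 + 1) with
    | none => rw [hl] at h1; simpa using h1
    | some l =>
      rw [hl] at h1
      cases l with
      | inv σ => simpa using h1
      | dir η =>
        have hadj := h𝒞.adjacent (i + 1) _ _ hμ hl
        have := (mul_path_eq_zero_of_add h𝔓 (Ne.symm hadj.2) h1).2
        simpa using this

/-- With letters leading away on both sides, the coordinate annihilates two paths with the same head
and different last arrows. -/
theorem eq_zero_of_famD [IsLocalRing R] [IsNoetherianRing R] (h𝔓 : 𝔓.IsCompleteGentle)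
    (h𝒞 : 𝔓.IsGWord 𝒞) {f : ℤ → Λ} (hf : famD 𝔓 𝒞 f = 0) {i : ℤ}
    (hi : f i ∈ leftIdeal (𝔓.gIdem 𝒞 i)) {η μ : NPath Q₁} (hη : 𝒞.letterAt i = some (.dir η))
    (hμ : 𝒞.letterAt (i + 1) = some (.inv μ)) : f i = 0 := by
  have h1 := (mul_path_eq_zero_of_famD h𝔓 h𝒞 hf i).1 η hη
  have h2 := (mul_path_eq_zero_of_famD h𝔓 h𝒞 hf i).2 μ hμ
  have hadj := h𝒞.adjacent i _ _ hη hμ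
  rw [gIdem_of_dir hη] at hi
  exact eq_zero_of_mul_path_eq_zero_of_ne h𝔓 (h𝒞.mem _ _ hη) (h𝒞.mem _ _ hμ) hadj.1 hadj.2 hi h1 h2

end Presentation

end Gentle

/-! ### Exactness of string complexes. -/

namespace Gentle

namespace Presentation

variable {R Λ : Type*} [CommRing R] [Ring Λ] [Algebra R Λ] {Q₀ Q₁ : Type*} [Fintype Q₀]
variable {𝔓 : Presentation R Λ Q₀ Q₁} {𝒞 : GWord Q₀ Q₁}

/-- A condition on the letters of `𝒞` near `i` under which cycles supported at `i` are boundaries: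
either two letters point away from `i`, or one does and it is prolonged by an arrow if possible. -/
def LocallyExact (𝔓 : Presentation R Λ Q₀ Q₁) (𝒞 : GWord Q₀ Q₁) (i : ℤ) : Prop :=
  (∃ η μ, 𝒞.letterAt i = some (.dir η) ∧ 𝒞.letterAt (i + 1) = some (.inv μ)) ∨
  (∃ η, 𝒞.letterAt i = some (.dir η) ∧ ∀ c, 𝔓.next η.last = some c →
    𝒞.letterAt (i + 1) = some (.dir ⟨c, []⟩) ∧ ∀ μ, 𝒞.letterAt (i + 1 + 1) ≠ some (.inv μ)) ∨
  (∃ μ, 𝒞.letterAt (i + 1) = some (.inv μ) ∧ ∀ c, 𝔓.next μ.last = some c →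
    𝒞.letterAt i = some (.inv ⟨c, []⟩) ∧ ∀ η, 𝒞.letterAt (i - 1) ≠ some (.dir η))

theorem strBdLeft_of_dir {n i : ℤ} {η : NPath Q₁} (h : 𝒞.letterAt i = some (.dir η)) :
    𝔓.strBdLeft 𝒞 n i = 𝔓.path η • 𝔓.strGen 𝒞 n (i - 1) := by
  rw [strBdLeft, h]

theorem strBdLeft_eq_zero {n i : ℤ} (h : ∀ η, 𝒞.letterAt i ≠ some (.dir η)) :
    𝔓.strBdLeft 𝒞 n i = 0 := by
  unfold strBdLeft
  split
  · rename_i η hη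
    exact absurd hη (h η)
  · rfl

theorem strBdRight_of_inv {n i : ℤ} {μ : NPath Q₁} (h : 𝒞.letterAt (i + 1) = some (.inv μ)) :
    𝔓.strBdRight 𝒞 n i = 𝔓.path μ • 𝔓.strGen 𝒞 n (i + 1) := by
  rw [strBdRight, h]

theorem strBdRight_eq_zero {n i : ℤ} (h : ∀ μ, 𝒞.letterAt (i + 1) ≠ some (.inv μ)) :
    𝔓.strBdRight 𝒞 n i = 0 := by
  unfold strBdRight
  split
  · rename_i μ hμ
    exact absurd hμ (h μ)
  · rfl

theorem strGen_mem {n i : ℤ} (h : i ∈ 𝒞.index ∧ 𝒞.ht i = n) :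
    𝔓.strGen 𝒞 n i = FreeOn.gen (𝔓.strIdem 𝒞 n) ⟨i, h⟩ := by
  rw [strGen, dif_pos h]

theorem strX_mem_of_coord {n : ℤ} {N : Submodule Λ (𝔓.StrX 𝒞 n)} {x : 𝔓.StrX 𝒞 n}
    (h : ∀ i, i ∈ 𝒞.index → 𝒞.ht i = n → strCoord 𝒞 n x i • 𝔓.strGen 𝒞 n i ∈ N) : x ∈ N := by
  refine FreeOn.mem_of_coord_smul_gen_mem (e := 𝔓.strIdem 𝒞 n)
    (fun i => 𝔓.gIdem_mul_self 𝒞 i) fun i => ?_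
  have := h i.1 i.2.1 i.2.2
  rwa [strCoord_of_mem i.2, strGen_mem i.2] at this

/-- Each component of a cycle is itself a boundary. It is zero if two letters lead away; otherwise
it is a multiple of the arrow `c` annihilating the one path, and `c` is the neighbouring letter. The
further condition in `LocallyExact` ensures that the boundary of the neighbouring generator has no
second term. -/
theorem strD_exact [IsLocalRing R] [IsNoetherianRing R] (h𝔓 : 𝔓.IsCompleteGentle)
    (h𝒞 : 𝔓.IsGWord 𝒞) (n : ℤ)
    (h : ∀ i, i ∈ 𝒞.index → 𝒞.ht i = n + 1 → LocallyExact 𝔓 𝒞 i) :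
    Function.Exact (𝔓.strD 𝒞 n) (𝔓.strD 𝒞 (n + 1)) := by
  intro x
  constructor
  swap
  · rintro ⟨y, rfl⟩
    exact 𝔓.strD_strD h𝒞 n y
  intro hx
  change x ∈ LinearMap.range (𝔓.strD 𝒞 n)
  refine strX_mem_of_coord fun i hi hn => ?_
  set f := strCoord 𝒞 (n + 1) x with hf
  have hfD : famD 𝔓 𝒞 f = 0 := by rw [hf, ← strCoord_strD h𝒞, hx, map_zero]
  have hfi : f i ∈ leftIdeal (𝔓.gIdem 𝒞 i) := strCoord_mem _ _ _
  rcases h i hi hn with ⟨η, μ, hη, hμ⟩ | ⟨η, hη, hc⟩ | ⟨μ, hμ, hc⟩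
  · rw [eq_zero_of_famD h𝔓 h𝒞 hfD hfi hη hμ, zero_smul]
    exact zero_mem _
  · rw [gIdem_of_dir hη] at hfi
    have h1 : f i ∈ (𝔓.next η.last).elim ⊥ fun c => leftIdeal (𝔓.arrow c) :=
      mem_of_mul_path_eq_zero h𝔓 (h𝒞.mem _ _ hη) hfi
      ((mul_path_eq_zero_of_famD h𝔓 h𝒞 hfD i).1 η hη)
    cases hn' : 𝔓.next η.last with
    | none =>
      rw [hn'] at h1
      rw [(Submodule.mem_bot _).mp h1, zero_smul]
      exact zero_mem _
    | some c =>
      rw [hn'] at h1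
      obtain ⟨a, ha⟩ := Submodule.mem_span_singleton.mp h1
      obtain ⟨h2, h3⟩ := hc c hn'
      have h4 := Seq.mem_index_of_letterAt h2
      have h5 := Seq.ht_of_dir h2
      rw [add_sub_cancel_right] at h5
      -- Here `f i = ac`, and `g_{i+1}` has boundary `c g_i`.
      refine ⟨a • 𝔓.strGen 𝒞 n (i + 1), ?_⟩
      rw [map_smul, strD_strGen 𝔓 h𝒞, if_pos ⟨h4.1, by omega⟩, strBdLeft_of_dir h2,
        strBdRight_eq_zero h3, add_zero, path_arrow, add_sub_cancel_right, smul_smul, ← ha,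
        smul_eq_mul]
  · rw [gIdem_of_inv_succ h𝒞 hμ] at hfi
    have h1 : f i ∈ (𝔓.next μ.last).elim ⊥ fun c => leftIdeal (𝔓.arrow c) :=
      mem_of_mul_path_eq_zero h𝔓 (h𝒞.mem _ _ hμ) hfi
      ((mul_path_eq_zero_of_famD h𝔓 h𝒞 hfD i).2 μ hμ)
    cases hn' : 𝔓.next μ.last with
    | none =>
      rw [hn'] at h1
      rw [(Submodule.mem_bot _).mp h1, zero_smul]
      exact zero_mem _
    | some c =>
      rw [hn'] at h1
      obtain ⟨a, ha⟩ := Submodule.mem_span_singleton.mp h1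
      obtain ⟨h2, h3⟩ := hc c hn'
      have h4 := Seq.mem_index_of_letterAt h2
      have h5 := Seq.ht_of_inv (i := i - 1) (by rwa [sub_add_cancel])
      rw [sub_add_cancel] at h5
      refine ⟨a • 𝔓.strGen 𝒞 n (i - 1), ?_⟩
      rw [map_smul, strD_strGen 𝔓 h𝒞, if_pos ⟨h4.2, by omega⟩, strBdLeft_eq_zero h3,
        strBdRight_of_inv (by rwa [sub_add_cancel]), zero_add, path_arrow, sub_add_cancel,
        smul_smul, ← ha, smul_eq_mul]

end Presentation

theorem stringComplex_d {R Λ : Type u} [CommRing R] [Ring Λ] [Algebra R Λ] {Q₀ Q₁ : Type*}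
    [Fintype Q₀] (𝔓 : Presentation R Λ Q₀ Q₁) (𝒞 : GWord Q₀ Q₁) (h𝒞 : 𝔓.IsGWord 𝒞) (n : ℤ) :
    (stringComplex 𝔓 𝒞 h𝒞).d n (n + 1) = ModuleCat.ofHom (𝔓.strD 𝒞 n) :=
  CochainComplex.of_d (fun n => ModuleCat.of Λ (𝔓.StrX 𝒞 n))
    (fun n => ModuleCat.ofHom (𝔓.strD 𝒞 n)) n

/-! ### Criteria for a complex of modules to be a projective resolution. -/

section Homology

variable {Λ : Type u} [Ring Λ] (K : CochainComplex (ModuleCat.{u} Λ) ℤ)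

open CategoryTheory.Limits in
theorem homology_isZero_of_exact {t : ℤ} (hzero : ∀ n, t < n → Subsingleton (K.X n))
    (hexact : ∀ n, n + 1 < t → Function.Exact (K.d n (n + 1)) (K.d (n + 1) (n + 1 + 1)))
    {m : ℤ} (hm : m ≠ t) : IsZero (K.homology m) := by
  rw [← HomologicalComplex.exactAt_iff_isZero_homology]
  rcases lt_or_gt_of_ne hm with h | h
  · obtain ⟨k, rfl⟩ : ∃ k, k + 1 = m := ⟨m - 1, by omega⟩
    rw [HomologicalComplex.exactAt_iff' K k (k + 1) (k + 1 + 1) (by simp) (by simp),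
      ShortComplex.ShortExact.moduleCat_exact_iff_function_exact]
    exact hexact k (by omega)
  · have := hzero m h
    exact HomologicalComplex.ExactAt.of_isZero (ModuleCat.isZero_of_subsingleton _)

open CategoryTheory.Limits in
-- As nothing follows degree `t`, the homology there is the cokernel of the incoming differential,
-- and `π` presents `M` as that cokernel.
theorem nonempty_homology_iso {n t : ℤ} (hn : n + 1 = t) (hzero : Subsingleton (K.X (t + 1)))
    {M : ModuleCat.{u} Λ} (π : K.X t ⟶ M) (hπ : Function.Surjective π)
    (hex : Function.Exact (K.d n t) π) : Nonempty (K.homology t ≅ M) := by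
  have hg : (K.sc' n t (t + 1)).g = 0 := (ModuleCat.isZero_of_subsingleton (K.X (t + 1))).eq_of_tgt _ _
  have hEx : (ShortComplex.mk (K.d n t) π (by
      ext x
      exact hex.apply_apply_eq_zero x)).Exact :=
    (ShortComplex.ShortExact.moduleCat_exact_iff_function_exact _).mpr hex
  have : Epi π := (ModuleCat.epi_iff_surjective π).mpr hπ
  exact ⟨K.homologyIsoSc' n t (t + 1) (by simp; omega) (by simp) ≪≫
    (ShortComplex.LeftHomologyData.ofIsColimitCokernelCofork _ hg _ hEx.gIsCokernel).homologyIso⟩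

/-- A criterion for a complex to be a projective resolution. -/
theorem isProjectiveResolution_of_exact (M : ModuleCat.{u} Λ)
    (hproj : ∀ n, Module.Projective Λ (K.X n)) (hzero : ∀ n, 0 < n → Subsingleton (K.X n))
    (hexact : ∀ n, n + 1 < 0 → Function.Exact (K.d n (n + 1)) (K.d (n + 1) (n + 1 + 1)))
    (π : K.X 0 ⟶ M) (hπ : Function.Surjective π) (hex : Function.Exact (K.d (-1) 0) π) :
    IsProjectiveResolution K M where
  projective n := have := hproj n; (IsProjective.iff_projective _).mp this
  isZero l hl := have := hzero l hl; ModuleCat.isZero_of_subsingleton _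
  homology_isZero _ hm := homology_isZero_of_exact K hzero hexact hm
  homology_zero := nonempty_homology_iso K (by simp) (hzero _ (by simp)) π hπ hex

/-- A criterion for a shifted complex to be a projective resolution. -/
theorem isProjectiveResolution_shift (t : ℤ) (M : ModuleCat.{u} Λ)
    (hproj : ∀ n, Module.Projective Λ (K.X n)) (hzero : ∀ n, t < n → Subsingleton (K.X n))
    (hexact : ∀ n, n + 1 < t → Function.Exact (K.d n (n + 1)) (K.d (n + 1) (n + 1 + 1)))
    (π : K.X t ⟶ M) (hπ : Function.Surjective π) (n : ℤ) (hn : n + 1 = t)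
    (hex : Function.Exact (K.d n t) π) :
    IsProjectiveResolution ((shiftFunctor (CochainComplex (ModuleCat.{u} Λ) ℤ) t).obj K) M := by
  -- Degree `m` of the shifted complex is degree `t + m` of the original one, so the criterion at
  -- `t` becomes one at `0`.
  have hhom : ∀ m m', t + m = m' → Nonempty
      (((shiftFunctor (CochainComplex (ModuleCat.{u} Λ) ℤ) t).obj K).homology m ≅
        K.homology m') := fun m m' h =>
    ⟨((HomologicalComplex.homologyFunctor (ModuleCat.{u} Λ) (ComplexShape.up ℤ) 0).shiftIso t m m'
      h).app K⟩
  refine ⟨fun n => ?_, fun l hl => ?_, fun m hm => ?_, ?_⟩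
  · have := hproj (n + t)
    exact (IsProjective.iff_projective _).mp this
  · have := hzero (l + t) (by omega)
    exact ModuleCat.isZero_of_subsingleton (K.X (l + t))
  · obtain ⟨e⟩ := hhom m (t + m) rfl
    exact (homology_isZero_of_exact K hzero hexact (by omega)).of_iso e
  · obtain ⟨e⟩ := hhom 0 t (by omega)
    obtain ⟨e'⟩ := nonempty_homology_iso K hn (hzero _ (by omega)) π hπ hex
    exact ⟨e ≪≫ e'⟩

end Homology

end Gentle

/-! ### The letters of the sequence `𝓡_C`, counted from `ι(-)`. -/

namespace Gentle

namespace Seq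

variable {Q₀ X : Type*}

/-- The position in `ℬ⁻¹ E` between `ℬ⁻¹` and `E`. -/
def junction : Seq Q₀ X → Seq Q₀ X → ℤ
  | fin l _, _ => l.length
  | right _, fin m _ => -m.length
  | _, _ => 0

/-- Positions are counted from the junction. To its left stand the inverses of the letters of `ℬ` in
reverse order, the letter at position `0` being the inverse of the first one. -/
theorem letterAt_fin_inverse_comp (l : List (Letter X)) (hl : l ≠ []) (E : Seq Q₀ X)
    (hE : (∃ v δ, E = triv v δ) ∨ (∃ l h, E = fin l h) ∨ ∃ c, E = right c) (i : ℤ) :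
    ((fin l hl).inverse.comp E).letterAt (l.length + i) =
      if i ≤ 0 then ((fin (Q₀ := Q₀) l hl).letterAt (1 - i)).map Letter.inverse else E.letterAt i := by
  have key : ∀ j : ℕ, (j : ℤ) = l.length + i - 1 → i ≤ 0 →
      (l.reverse.map Letter.inverse)[j]? = (l[(1 - i - 1).toNat]?).map Letter.inverse := by
    intro j hj hi
    rw [List.getElem?_map, List.getElem?_reverse (by omega)]
    congr 2
    omega
  rcases hE with ⟨v, δ, rfl⟩ | ⟨m, hm, rfl⟩ | ⟨c, rfl⟩
  · simp only [inverse, comp, letterAt]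
    split_ifs with h1 h2 h3 h4
    · exact key _ (by omega) h2
    · omega
    · rw [List.getElem?_eq_none (by simp; omega)]
    · rw [List.getElem?_eq_none (by omega)]
      rfl
    · omega
    · rfl
  · simp only [inverse, comp, letterAt]
    split_ifs with h1 h2 h3 h4
    · rw [List.getElem?_append_left (by simp; omega)]
      exact key _ (by omega) h2
    · omega
    · rw [List.getElem?_append_right (by simp; omega)]
      congr 1
      simp
      omega
    · omega
    · rw [List.getElem?_eq_none (by omega)]
      rfl
    · omega
    · omega
    · omega
  · simp only [inverse, comp, letterAt]
    by_cases h1 : 0 < (l.length : ℤ) + i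
    · rw [if_pos h1]
      by_cases h2 : i ≤ 0
      · rw [if_pos h2, if_pos (by omega), dif_pos (by simp; omega), ← key _ _ h2]
        · rw [List.getElem?_eq_getElem]
        · omega
      · rw [if_neg h2, if_pos (by omega), dif_neg (by simp; omega)]
        congr 2
        simp
        omega
    · rw [if_neg h1, if_pos (by omega), if_pos (by omega), List.getElem?_eq_none (by omega)]
      rfl

/-- For infinite `ℬ`, the place of the junction depends on `E`: a sequence indexed by `-ℕ` is
counted from its right end, which lies the length of `E` beyond the junction, while a two-sided
sequence has its origin at the junction. -/
theorem letterAt_right_inverse_comp (b : ℕ → Letter X) (E : Seq Q₀ X)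
    (hE : (∃ v δ, E = triv v δ) ∨ (∃ l h, E = fin l h) ∨ ∃ c, E = right c) (i : ℤ) :
    ((right b).inverse.comp E).letterAt (junction (right b) E + i) =
      if i ≤ 0 then ((right (Q₀ := Q₀) b).letterAt (1 - i)).map Letter.inverse else E.letterAt i := by
  rcases hE with ⟨v, δ, rfl⟩ | ⟨m, hm, rfl⟩ | ⟨c, rfl⟩
  · simp only [inverse, comp, letterAt, junction, zero_add]
    by_cases h : i ≤ 0
    · rw [if_pos h, if_pos h, if_pos (by omega), Option.map_some]
      congr 3
      omega
    · rw [if_neg h, if_neg h]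
  · simp only [inverse, comp, letterAt, junction]
    by_cases h : i ≤ 0
    · rw [if_pos (by omega), if_pos h, if_pos (by omega), List.getElem?_eq_none (by simp; omega),
        Option.map_some, Option.getD_none]
      congr 3
      omega
    · rw [if_neg h]
      by_cases h2 : i ≤ m.length
      · rw [if_pos (by omega), if_pos (by omega), List.getElem?_reverse (by omega),
          List.getElem?_eq_getElem (by omega), Option.getD_some, List.getElem?_eq_getElem (by omega)]
        congr 2
        omega
      · rw [if_neg (by omega), if_pos (by omega), List.getElem?_eq_none (by omega)]
  · simp only [inverse, comp, letterAt, junction, zero_add]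
    by_cases h : i ≤ 0
    · rw [if_pos h, if_pos (show 0 < 1 - i by omega), if_neg (show ¬ 0 < i by omega),
        Option.map_some]
      congr 3
      omega
    · rw [if_neg h, if_pos (show 0 < i by omega), if_pos (show 0 < i by omega)]

theorem letterAt_fin_comp (l : List (Letter X)) (hl : l ≠ []) (E : Seq Q₀ X)
    (hE : (∃ l h, E = fin l h) ∨ ∃ c, E = right c) (i : ℤ) :
    ((fin l hl).comp E).letterAt i =
      if i ≤ l.length then (fin (Q₀ := Q₀) l hl).letterAt i else E.letterAt (i - l.length) := by
  rcases hE with ⟨m, hm, rfl⟩ | ⟨c, rfl⟩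
  · simp only [comp, letterAt]
    by_cases h : i ≤ l.length
    · rw [if_pos h]
      split_ifs
      · rw [List.getElem?_append_left (by omega)]
      · rfl
    · rw [if_neg h, if_pos (by omega), if_pos (by omega), List.getElem?_append_right (by omega)]
      congr 1
      omega
  · simp only [comp, letterAt]
    by_cases h : i ≤ l.length
    · rw [if_pos h]
      split_ifs
      · rw [List.getElem?_eq_getElem]
      · omega
      · rfl
    · rw [if_neg h, if_pos (by omega), if_pos (by omega), dif_neg (by omega)]
      congr 2
      omega

end Seq

theorem length_blockGLetters {Q₁ : Type*} (bs : List (NPath Q₁ × NPath Q₁)) :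
    (blockGLetters bs).length = 2 * bs.length := by
  induction bs with
  | nil => rfl
  | cons p t ih =>
    simp only [blockGLetters, List.flatMap_cons, List.length_append] at ih ⊢
    rw [ih]
    simp
    omega

theorem blockGLetters_getElem? {Q₁ : Type*} (bs : List (NPath Q₁ × NPath Q₁)) (k : ℕ) :
    (blockGLetters bs)[2 * k]? = (bs[k]?).map (fun p => Letter.dir p.1) ∧
      (blockGLetters bs)[2 * k + 1]? = (bs[k]?).map (fun p => Letter.inv p.2) := by
  induction bs generalizing k with
  | nil => simp [blockGLetters]
  | cons p t ih =>
    cases k with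
    | zero => simp [blockGLetters]
    | succ k =>
      have := ih k
      simp only [blockGLetters] at this
      simp only [blockGLetters, List.flatMap_cons]
      rw [show 2 * (k + 1) = 2 * k + 2 by ring, List.getElem?_append_right (by simp),
        List.getElem?_append_right (by simp)]
      simpa using this

namespace Core

variable {Q₀ Q₁ : Type*}

theorem toGWord_shape (A : Core Q₀ Q₁) :
    (∃ v δ, A.toGWord = .triv v δ) ∨ (∃ l h, A.toGWord = .fin l h) ∨ ∃ c, A.toGWord = .right c := by
  cases A with
  | triv v ε => exact Or.inl ⟨_, _, rfl⟩
  | alt bs h => exact Or.inr (Or.inl ⟨_, _, rfl⟩)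

theorem toGWord_letterAt (A : Core Q₀ Q₁) (i : ℤ) (hi : 0 < i) :
    A.toGWord.letterAt i = (blockGLetters A.blocks)[(i - 1).toNat]? := by
  cases A with
  | triv v ε => simp [Core.toGWord, Seq.letterAt, Core.blocks, blockGLetters]
  | alt bs h => simp [Core.toGWord, Seq.letterAt, Core.blocks, hi]

theorem toGWord_comp (A : Core Q₀ Q₁) (E : GWord Q₀ Q₁)
    (hE : (∃ l h, E = .fin l h) ∨ ∃ c, E = .right c) :
    ((∃ m h, A.toGWord.comp E = .fin m h) ∨ ∃ c, A.toGWord.comp E = .right c) ∧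
      ∀ i : ℤ, 0 < i → (A.toGWord.comp E).letterAt i = if i ≤ 2 * A.blocks.length then
        (blockGLetters A.blocks)[(i - 1).toNat]? else E.letterAt (i - 2 * A.blocks.length) := by
  cases A with
  | triv v ε =>
    refine ⟨hE, fun i hi => ?_⟩
    rw [if_neg (by simp [Core.blocks]; omega)]
    simp [Core.toGWord, Seq.comp, Core.blocks]
  | alt bs h =>
    constructor
    · rcases hE with ⟨l, h, rfl⟩ | ⟨c, rfl⟩
      · exact Or.inl ⟨_, _, rfl⟩
      · exact Or.inr ⟨_, rfl⟩
    · intro i hi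
      rw [Core.toGWord, Seq.letterAt_fin_comp _ _ _ hE, length_blockGLetters]
      simp [Seq.letterAt, Core.blocks, hi]

theorem eq_triv {A : Core Q₀ Q₁} (hn : A.blocks.length = 0) : ∃ v ε, A = .triv v ε := by
  cases A with
  | triv v ε => exact ⟨v, ε, rfl⟩
  | alt bs h => exact absurd (List.length_eq_zero_iff.mp hn) h

end Core

namespace Presentation

variable {R Λ : Type*} [CommRing R] [Ring Λ] [Algebra R Λ] {Q₀ Q₁ : Type*} [Fintype Q₀]
variable (𝔓 : Presentation R Λ Q₀ Q₁)

/-- The paths in the letters of the upward extension of `⟨β⟩`. -/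
noncomputable def upLetter (β : NPath Q₁) (k : ℕ) : Option (NPath Q₁) :=
  if k = 0 then some β else (𝔓.nextIter β.last k).map fun a => ⟨a, []⟩

theorem nextIter_none {a : Q₁} {k m : ℕ} (hkm : k ≤ m) (h : 𝔓.nextIter a k = none) :
    𝔓.nextIter a m = none := by
  induction m, hkm using Nat.le_induction with
  | base => exact h
  | succ m _ ih => rw [nextIter, ih]; rfl

theorem upSeq_shape (β : NPath Q₁) :
    (∃ l h, 𝔓.upSeq β = .fin l h) ∨ ∃ c, 𝔓.upSeq β = .right c := by
  unfold upSeq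
  split_ifs with h
  · exact Or.inl ⟨_, List.cons_ne_nil _ _, rfl⟩
  · exact Or.inr ⟨_, rfl⟩

/-- A sequence with values in an option type describes finite and infinite extensions at once, so
the two need not be distinguished later. -/
theorem upSeq_letterAt (β : NPath Q₁) (i : ℤ) (hi : 0 < i) :
    (𝔓.upSeq β).letterAt i = (𝔓.upLetter β (i - 1).toNat).map .dir := by
  classical
  obtain ⟨k, hk⟩ : ∃ k : ℕ, (i - 1).toNat = k := ⟨_, rfl⟩
  unfold upSeq
  split_ifs with h
  · simp only [Seq.letterAt, if_pos hi, hk]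
    cases k with
    | zero => simp [upLetter]
    | succ k =>
      rw [List.getElem?_cons_succ, upLetter, if_neg (Nat.succ_ne_zero k)]
      -- Before the first missing arrow all arrows exist, so the filter removes nothing and the
      -- positions are not displaced.
      have h1 : (List.range (Nat.find h)).filterMap (fun k =>
          (𝔓.nextIter β.last (k + 1)).map fun a => Letter.dir (⟨a, []⟩ : NPath Q₁)) =
          (List.range (Nat.find h)).map fun k =>
            Letter.dir (⟨(𝔓.nextIter β.last (k + 1)).getD β.last, []⟩ : NPath Q₁) := by
        rw [← List.filterMap_eq_map]
        refine List.filterMap_congr fun j hj => ?_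
        have := Nat.find_min h (List.mem_range.mp hj)
        obtain ⟨a, ha⟩ := Option.ne_none_iff_exists'.mp this
        simp [ha]
      rw [h1, List.getElem?_map]
      by_cases hk' : k < Nat.find h
      · rw [List.getElem?_range hk']
        have := Nat.find_min h hk'
        obtain ⟨a, ha⟩ := Option.ne_none_iff_exists'.mp this
        simp [ha]
      · rw [List.getElem?_eq_none (by simpa using hk'),
          𝔓.nextIter_none (Nat.succ_le_succ (not_lt.mp hk')) (Nat.find_spec h)]
        rfl
  · simp only [Seq.letterAt, if_pos hi, hk]
    cases k with
    | zero => simp [upLetter]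
    | succ k =>
      have := not_exists.mp h k
      obtain ⟨a, ha⟩ := Option.ne_none_iff_exists'.mp this
      simp [upLetter, ha]

open Classical in
/-- The paths in the letters of `ℬ`. -/
noncomputable def extLetter (s : Letter Q₁ → ℤˣ) (B : Word Q₀ Q₁) (k : ℕ) : Option (NPath Q₁) :=
  if h : ∃ b : Q₁, 𝔓.Extends s B b then 𝔓.upLetter (extPath B h.choose) k else none

theorem upExt_eq (s : Letter Q₁ → ℤˣ) (B : Word Q₀ Q₁) :
    (𝔓.upExt s B = none ∧ ∀ k, 𝔓.extLetter s B k = none) ∨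
      ∃ ℬ : GWord Q₀ Q₁, 𝔓.upExt s B = some ℬ ∧ ((∃ l h, ℬ = .fin l h) ∨ ∃ c, ℬ = .right c) ∧
        ∀ i : ℤ, 0 < i → ℬ.letterAt i = (𝔓.extLetter s B (i - 1).toNat).map .dir := by
  by_cases h : ∃ b : Q₁, 𝔓.Extends s B b
  · right
    refine ⟨_, dif_pos h, 𝔓.upSeq_shape _, fun i hi => ?_⟩
    rw [𝔓.upSeq_letterAt _ i hi, extLetter, dif_pos h]
  · exact Or.inl ⟨dif_neg h, fun k => dif_neg h⟩

/-- The letters of `𝒜 𝒟`, or of `𝒜` if `𝒟` is absent. -/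
noncomputable def coreLetter (s : Letter Q₁ → ℤˣ) (A : Core Q₀ Q₁) (D : Word Q₀ Q₁) (i : ℤ) :
    Option (Letter (NPath Q₁)) :=
  if i ≤ 2 * A.blocks.length then (blockGLetters A.blocks)[(i - 1).toNat]?
  else (𝔓.extLetter s D (i - 2 * A.blocks.length - 1).toNat).map .dir

/-- The letters of `𝓡_C`, the position between `ℬ⁻¹` and `𝒜 𝒟` being `0`. -/
noncomputable def resLetter (s : Letter Q₁ → ℤˣ) (B : Word Q₀ Q₁) (A : Core Q₀ Q₁)
    (D : Word Q₀ Q₁) (i : ℤ) : Option (Letter (NPath Q₁)) :=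
  if i ≤ 0 then (𝔓.extLetter s B (-i).toNat).map .inv else 𝔓.coreLetter s A D i

/-- Once positions are measured from `ι(-)`, all shapes of `ℬ` and `𝒟` and all index sets are
described by the one formula `resLetter`. The later arguments work with that formula. -/
theorem resString_letterAt (s : Letter Q₁ → ℤˣ) (B : Word Q₀ Q₁) (A : Core Q₀ Q₁)
    (D : Word Q₀ Q₁) (i : ℤ) :
    (𝔓.resString s B A D).letterAt (𝔓.resStringStart s B A D + i) = 𝔓.resLetter s B A D i := by
  have hA0 : ∀ i : ℤ, i ≤ 0 → A.toGWord.letterAt i = none := by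
    intro i hi
    cases A with
    | triv v ε => rfl
    | alt bs h => simp [Core.toGWord, Seq.letterAt, hi]
  have hcore : ∀ i : ℤ, 0 < i → (∀ k, 𝔓.extLetter s D k = none) →
      A.toGWord.letterAt i = 𝔓.coreLetter s A D i := by
    intro i hi hD
    rw [Core.toGWord_letterAt A i hi, coreLetter]
    split_ifs with h
    · rfl
    · rw [hD, List.getElem?_eq_none]
      · rfl
      · rw [length_blockGLetters]; omega
  rcases 𝔓.upExt_eq s B with ⟨hB, hB'⟩ | ⟨ℬ, hB, hBs, hBl⟩ <;>
    rcases 𝔓.upExt_eq s D with ⟨hD, hD'⟩ | ⟨𝒟, hD, hDs, hDl⟩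
  · have h1 : 𝔓.resString s B A D = A.toGWord := by rw [resString, hB, hD]
    have h2 : 𝔓.resStringStart s B A D = 0 := by rw [resStringStart, hB]
    rw [h1, h2, zero_add, resLetter]
    split_ifs with h
    · rw [hB', hA0 i h]; rfl
    · exact hcore i (not_le.mp h) hD'
  · obtain ⟨h3, h4⟩ := Core.toGWord_comp A 𝒟 hDs
    have h1 : 𝔓.resString s B A D = A.toGWord.comp 𝒟 := by rw [resString, hB, hD]
    have h2 : 𝔓.resStringStart s B A D = 0 := by rw [resStringStart, hB]
    rw [h1, h2, zero_add, resLetter]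
    split_ifs with h
    · rw [hB']
      rcases h3 with ⟨m, hm, h3⟩ | ⟨c, h3⟩
      · rw [h3]; simp [Seq.letterAt, h]
      · rw [h3]; simp [Seq.letterAt, h]
    · rw [h4 i (not_le.mp h), coreLetter]
      split_ifs with h5
      · rfl
      · exact hDl _ (by omega)
  · have h1 : 𝔓.resString s B A D = ℬ.inverse.comp A.toGWord := by rw [resString, hB, hD]
    have h2 : 𝔓.resStringStart s B A D = Seq.junction ℬ A.toGWord := by
      rw [resStringStart, hB, hD]
      rcases hBs with ⟨l, h, rfl⟩ | ⟨c, rfl⟩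
      · rfl
      · cases A with
        | triv v ε => simp [Seq.junction, Core.blocks, Core.toGWord]
        | alt bs h => simp [Seq.junction, Core.blocks, Core.toGWord, length_blockGLetters]
    rw [h1, h2, resLetter]
    have h5 : (ℬ.inverse.comp A.toGWord).letterAt (Seq.junction ℬ A.toGWord + i) =
        if i ≤ 0 then (ℬ.letterAt (1 - i)).map Letter.inverse else A.toGWord.letterAt i := by
      rcases hBs with ⟨l, h, rfl⟩ | ⟨c, rfl⟩
      · exact Seq.letterAt_fin_inverse_comp l h _ (Core.toGWord_shape A) i
      · exact Seq.letterAt_right_inverse_comp c _ (Core.toGWord_shape A) i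
    rw [h5]
    split_ifs with h
    · rw [hBl _ (by omega), Option.map_map, show (1 - i - 1) = -i by ring]
      rfl
    · exact hcore i (not_le.mp h) hD'
  · obtain ⟨h3, h4⟩ := Core.toGWord_comp A 𝒟 hDs
    have h1 : 𝔓.resString s B A D = ℬ.inverse.comp (A.toGWord.comp 𝒟) := by rw [resString, hB, hD]
    have h2 : 𝔓.resStringStart s B A D = Seq.junction ℬ (A.toGWord.comp 𝒟) := by
      rw [resStringStart, hB, hD]
      rcases hBs with ⟨l, h, rfl⟩ | ⟨c, rfl⟩
      · rfl
      · rcases hDs with ⟨m, hm, rfl⟩ | ⟨d, rfl⟩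
        · cases A with
          | triv v ε => simp [Seq.junction, Core.blocks, Core.toGWord, Seq.comp]
          | alt bs h =>
            simp [Seq.junction, Core.blocks, Core.toGWord, Seq.comp, length_blockGLetters]
        · cases A with
          | triv v ε => simp [Seq.junction, Core.toGWord, Seq.comp]
          | alt bs h => simp [Seq.junction, Core.toGWord, Seq.comp]
    have h6 : (∃ v δ, A.toGWord.comp 𝒟 = .triv v δ) ∨ (∃ l h, A.toGWord.comp 𝒟 = .fin l h) ∨
      ∃ c, A.toGWord.comp 𝒟 = .right c := Or.inr h3
    rw [h1, h2, resLetter]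
    have h5 : (ℬ.inverse.comp (A.toGWord.comp 𝒟)).letterAt
        (Seq.junction ℬ (A.toGWord.comp 𝒟) + i) =
        if i ≤ 0 then (ℬ.letterAt (1 - i)).map Letter.inverse
        else (A.toGWord.comp 𝒟).letterAt i := by
      rcases hBs with ⟨l, h, rfl⟩ | ⟨c, rfl⟩
      · exact Seq.letterAt_fin_inverse_comp l h _ h6 i
      · exact Seq.letterAt_right_inverse_comp c _ h6 i
    rw [h5]
    split_ifs with h
    · rw [hBl _ (by omega), Option.map_map, show (1 - i - 1) = -i by ring]
      rfl
    · rw [h4 i (not_le.mp h), coreLetter]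
      split_ifs with h5
      · rfl
      · exact hDl _ (by omega)

theorem resString_eq_triv (s : Letter Q₁ → ℤˣ) {B : Word Q₀ Q₁} {A : Core Q₀ Q₁}
    {D : Word Q₀ Q₁} {v : Q₀} {δ : ℤˣ} (h : 𝔓.resString s B A D = .triv v δ) :
    A = .triv v δ ∧ 𝔓.resStringStart s B A D = 0 := by
  rcases 𝔓.upExt_eq s B with ⟨hB, hB'⟩ | ⟨ℬ, hB, hBs, hBl⟩ <;>
    rcases 𝔓.upExt_eq s D with ⟨hD, hD'⟩ | ⟨𝒟, hD, hDs, hDl⟩ <;>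
      rw [resString, hB, hD] at h
  · have h2 : 𝔓.resStringStart s B A D = 0 := by rw [resStringStart, hB]
    refine ⟨?_, h2⟩
    cases A with
    | triv v ε => cases h; rfl
    | alt bs h' => cases h
  · rcases (Core.toGWord_comp A 𝒟 hDs).1 with ⟨m, hm, h3⟩ | ⟨c, h3⟩ <;> simp only [h3] at h <;> cases h
  · rcases hBs with ⟨l, hl, rfl⟩ | ⟨c, rfl⟩ <;> cases A <;> cases h
  · rcases (Core.toGWord_comp A 𝒟 hDs).1 with ⟨m, hm, h3⟩ | ⟨c, h3⟩ <;> simp only [h3] at h <;>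
      rcases hBs with ⟨l, hl, rfl⟩ | ⟨c, rfl⟩ <;> cases h

end Presentation

end Gentle

/-! ### Alternating words, and the extension paths `b B⁻¹`. -/

namespace Gentle

namespace Seq

variable {Q₀ X : Type*}

theorem _root_.Gentle.Letter.inverse_inverse (l : Letter X) : l.inverse.inverse = l := by
  cases l <;> rfl

theorem inverse_inverse (C : Seq Q₀ X) : C.inverse.inverse = C := by
  have h : Letter.inverse ∘ Letter.inverse = (id : Letter X → Letter X) :=
    funext Letter.inverse_inverse
  cases C with
  | triv v δ => simp [inverse]
  | fin l hl => simp [inverse, ← List.map_reverse, h]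
  | right c => simp [inverse, Letter.inverse_inverse]
  | left c => simp [inverse, Letter.inverse_inverse]
  | bi c => simp [inverse, Letter.inverse_inverse]

end Seq

theorem blockLetters_cons {Q₁ : Type*} (p : NPath Q₁ × NPath Q₁) (t : List (NPath Q₁ × NPath Q₁)) :
    blockLetters (p :: t) = p.1.arrows.reverse.map Letter.inv ++
      (p.2.arrows.map Letter.dir ++ blockLetters t) := by
  simp [blockLetters]

theorem head?_blockLetters_cons {Q₁ : Type*} (p : NPath Q₁ × NPath Q₁)
    (t : List (NPath Q₁ × NPath Q₁)) :
    (blockLetters (p :: t)).head? = some (.inv p.1.first) := by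
  rw [blockLetters_cons, List.head?_append, List.head?_map, List.head?_reverse,
    NPath.getLast?_arrows]
  rfl

theorem getLast?_blockLetters {Q₁ : Type*} {bs : List (NPath Q₁ × NPath Q₁)} (h : bs ≠ []) :
    (blockLetters bs).getLast? = some (.dir (bs.getLast h).2.first) := by
  obtain ⟨t, p, rfl⟩ : ∃ t p, bs = t ++ [p] := ⟨_, _, (List.dropLast_append_getLast h).symm⟩
  simp only [blockLetters, List.flatMap_append, List.flatMap_singleton, List.getLast_concat]
  rw [← List.append_assoc, List.getLast?_append, List.getLast?_map, NPath.getLast?_arrows]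
  rfl

namespace Presentation

variable {R Λ : Type*} [CommRing R] [Ring Λ] [Algebra R Λ] {Q₀ Q₁ : Type*} [Fintype Q₀]
variable {𝔓 : Presentation R Λ Q₀ Q₁}

/-- The condition on two consecutive letters of a word. -/
def LAdj (𝔓 : Presentation R Λ Q₀ Q₁) (l l' : Letter Q₁) : Prop :=
  𝔓.Q.ltail l = 𝔓.Q.lhead l' ∧ l.inverse ≠ l'

theorem isChain_of_isWord {l : List (Letter Q₁)} {h : l ≠ []}
    (hw : 𝔓.IsWord (Seq.fin (Q₀ := Q₀) l h)) : l.IsChain 𝔓.LAdj := by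
  rw [List.isChain_iff_getElem]
  intro i hi
  refine hw.adjacent (i + 1) _ _ ?_ ?_
  · rw [Seq.letterAt, if_pos (by omega), show ((i : ℤ) + 1 - 1).toNat = i by omega,
      List.getElem?_eq_getElem]
  · rw [Seq.letterAt, if_pos (by omega), show ((i : ℤ) + 1 + 1 - 1).toNat = i + 1 by omega,
      List.getElem?_eq_getElem]

/-- Consecutive blocks match in the middle of `⟨σᵢ⟩⁻¹ ⟨γᵢ₊₁⟩`. -/
def BlockAdj (𝔓 : Presentation R Λ Q₀ Q₁) (p q : NPath Q₁ × NPath Q₁) : Prop :=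
  𝔓.Q.ptail p.2 = 𝔓.Q.ptail q.1 ∧ p.2.first ≠ q.1.first

/-- The conditions on blocks concern the places where the word changes direction. The two letters
there are not inverse to each other, so the arrows involved differ. -/
theorem blocks_of_isChain {bs : List (NPath Q₁ × NPath Q₁)}
    (h : (blockLetters bs).IsChain 𝔓.LAdj) : bs.IsChain 𝔓.BlockAdj ∧
      ∀ p ∈ bs, 𝔓.Q.phead p.1 = 𝔓.Q.phead p.2 ∧ p.1.last ≠ p.2.last := by
  induction bs with
  | nil => simp
  | cons p t ih =>
    rw [blockLetters_cons, List.isChain_append, List.isChain_append] at h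
    obtain ⟨-, ⟨-, h1, h2⟩, h3⟩ := h
    obtain ⟨ih1, ih2⟩ := ih h1
    have h4 := h3 (.inv p.1.last) (by simp [NPath.arrows]) (.dir p.2.last) (by simp [NPath.arrows])
    constructor
    · cases t with
      | nil => simp
      | cons q t =>
        refine List.isChain_cons_cons.mpr ⟨?_, ih1⟩
        have h5 := h2 (.dir p.2.first) (by rw [List.getLast?_map, NPath.getLast?_arrows]; rfl)
          (.inv q.1.first) (by rw [head?_blockLetters_cons]; rfl)
        exact ⟨h5.1, fun h => h5.2 (congrArg Letter.inv h)⟩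
    · intro q hq
      rcases List.mem_cons.mp hq with rfl | hq
      · exact ⟨h4.1, fun h => h4.2 (congrArg Letter.dir h)⟩
      · exact ih2 q hq

section Extension

variable {s : Letter Q₁ → ℤˣ} {B : Word Q₀ Q₁}

/-- The basic properties of the path `b B⁻¹`. -/
theorem extends_properties [Nontrivial R] (hinv : B.IsTrivialOrInverse) {v : Q₀}
    (hB : B.headV 𝔓.Q.lhead = some v) {b : Q₁} (h : 𝔓.Extends s B b) :
    𝔓.IsP (extPath B b) ∧ B.headV 𝔓.Q.lhead = some (𝔓.Q.ptail (extPath B b)) ∧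
      B.sign s = some (s (.inv (extPath B b).first)) := by
  cases B with
  | triv w δ =>
    obtain ⟨⟨⟨u, hu1, hu2⟩, ε, hε1, hε2⟩, -⟩ := h
    refine ⟨𝔓.isP_arrow b, ?_, ?_⟩
    · exact hu1.trans hu2.symm
    · have h1 : -δ = -ε := Option.some.inj hε1
      rw [Seq.sign, neg_injective h1]
      exact hε2.symm
  | fin l hl =>
    have hl' : ∀ (k : ℕ) (hk : k < l.length), l[k] = .inv l[k].base := by
      intro k hk
      obtain ⟨x, hx⟩ := hinv (k + 1) l[k] (by
        rw [Seq.letterAt, if_pos (by omega), show ((k : ℤ) + 1 - 1).toNat = k by omega,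
          List.getElem?_eq_getElem])
      rw [hx]; rfl
    have hrev : (extPath (Q₀ := Q₀) (.fin l hl) b).arrows.reverse = l.map Letter.base ++ [b] := by
      simp [extPath, NPath.arrows]
    have hpos := List.length_pos_iff.mpr hl
    have hfirst : Letter.inv (extPath (Q₀ := Q₀) (.fin l hl) b).first = l[0] := by
      have h1 := NPath.getLast?_arrows (extPath (Q₀ := Q₀) (.fin l hl) b)
      rw [← List.head?_reverse, hrev, List.head?_append, List.head?_map,
        List.head?_eq_getElem?, List.getElem?_eq_getElem hpos] at h1
      rw [hl' 0 hpos]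
      exact congrArg Letter.inv (Option.some.inj h1).symm
    have hhead : l.head? = some l[0] := by
      rw [List.head?_eq_getElem?, List.getElem?_eq_getElem hpos]
    -- The word `B b⁻¹` consists of inverse letters only and, as a whole, spells the inverse of `b
    -- B⁻¹`.
    refine ⟨h.2.path_inv_mem 1 _ fun j hj => ?_, ?_, ?_⟩
    · simp only [hrev] at hj ⊢
      rw [List.length_append, List.length_map, List.length_singleton] at hj
      simp only [Seq.comp, Seq.letterAt]
      rw [if_pos (by omega), show ((1 : ℤ) + j - 1).toNat = j by omega]
      by_cases hj' : j < l.length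
      · rw [List.getElem?_append_left hj', List.getElem?_eq_getElem hj',
          List.getElem_append_left (by simpa using hj'), List.getElem_map, ← hl' j hj']
      · have : j = l.length := by omega
        subst this
        simp
    · rw [Seq.headV, hhead, Quiv.ptail, ← hfirst]
      rfl
    · rw [Seq.sign, hhead, hfirst]
      rfl
  -- The inverse of an infinite `B` has no head, so no arrow extends it.
  | right c => obtain ⟨⟨⟨u, hu1, -⟩, -⟩, -⟩ := h; cases hu1
  | left c => cases hB
  | bi c => cases hB

/-- For trivial `B`, two candidates would be distinct inverse letters with the same head and sign,
whereas such a pair must contain a direct letter. For nontrivial `B`, both candidates prolong the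
same last arrow, and the gentle condition applies. -/
theorem extends_unique [Nontrivial R] (h𝔓 : 𝔓.IsCompleteGentle) (hs : 𝔓.IsSign s)
    (hinv : B.IsTrivialOrInverse) {v : Q₀} (hB : B.headV 𝔓.Q.lhead = some v) {b b' : Q₁}
    (h : 𝔓.Extends s B b) (h' : 𝔓.Extends s B b') : b = b' := by
  by_contra hne
  obtain ⟨h1, h2, h3⟩ := extends_properties hinv hB h
  obtain ⟨h1', h2', h3'⟩ := extends_properties hinv hB h'
  have key : ∀ w δ, B = .triv w δ → False := by
    rintro w δ rfl
    obtain ⟨x, y, ⟨-, h5⟩ | ⟨h5, -⟩, -⟩ := hs (.inv b) (.inv b') (fun h => hne (by cases h; rfl))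
      (Option.some.inj (h2.symm.trans h2')) (Option.some.inj (h3.symm.trans h3'))
    · cases h5
    · cases h5
  cases B with
  | triv w δ => exact key w δ rfl
  | fin l hl =>
    rw [isP_iff] at h1 h1'
    have hl' : (l.map Letter.base).reverse ≠ [] := by simpa using hl
    obtain ⟨y, t, ht⟩ := List.exists_cons_of_ne_nil hl'
    simp only [extPath, NPath.arrows, ht] at h1 h1'
    exact hne (pairP_unique h𝔓 (List.isChain_cons_cons.mp h1).1 (List.isChain_cons_cons.mp h1').1)
  | right c => obtain ⟨⟨⟨u, hu1, -⟩, -⟩, -⟩ := h; cases hu1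
  | left c => cases hB
  | bi c => cases hB

/-- By uniqueness, the arrow chosen in the construction of `ℬ` is the given one. -/
theorem extLetter_eq [Nontrivial R] (h𝔓 : 𝔓.IsCompleteGentle) (hs : 𝔓.IsSign s)
    (hinv : B.IsTrivialOrInverse) {v : Q₀} (hB : B.headV 𝔓.Q.lhead = some v) {b : Q₁}
    (h : 𝔓.Extends s B b) (k : ℕ) : 𝔓.extLetter s B k = 𝔓.upLetter (extPath B b) k := by
  have hex : ∃ b : Q₁, 𝔓.Extends s B b := ⟨b, h⟩
  rw [extLetter, dif_pos hex, extends_unique h𝔓 hs hinv hB hex.choose_spec h]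

theorem extLetter_zero {β : NPath Q₁} (h : 𝔓.extLetter s B 0 = some β) :
    ∃ b, 𝔓.Extends s B b ∧ β = extPath B b := by
  unfold extLetter at h
  split_ifs at h with hex
  refine ⟨hex.choose, hex.choose_spec, ?_⟩
  rw [upLetter, if_pos rfl] at h
  exact (Option.some.inj h).symm

/-- The recursion is the same at the first step as later on, because the next arrow depends on `β`
only through its last arrow. -/
theorem upLetter_succ (β : NPath Q₁) (k : ℕ) : 𝔓.upLetter β (k + 1) =
    (𝔓.upLetter β k).bind fun ρ => (𝔓.next ρ.last).map fun c => ⟨c, []⟩ := by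
  rw [upLetter, if_neg (Nat.succ_ne_zero k), nextIter, upLetter]
  by_cases hk : k = 0
  · subst hk
    rfl
  · rw [if_neg hk]
    cases 𝔓.nextIter β.last k <;> rfl

theorem extLetter_succ (k : ℕ) : 𝔓.extLetter s B (k + 1) =
    (𝔓.extLetter s B k).bind fun ρ => (𝔓.next ρ.last).map fun c => ⟨c, []⟩ := by
  unfold extLetter
  split_ifs with h
  · exact upLetter_succ _ _
  · rfl

theorem extLetter_of_succ {k : ℕ} {σ : NPath Q₁} (h : 𝔓.extLetter s B (k + 1) = some σ) :
    ∃ ρ c, 𝔓.extLetter s B k = some ρ ∧ 𝔓.next ρ.last = some c ∧ σ = ⟨c, []⟩ := by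
  rw [extLetter_succ] at h
  cases hρ : 𝔓.extLetter s B k with
  | none => rw [hρ] at h; cases h
  | some ρ =>
    rw [hρ, Option.bind_some] at h
    cases hc : 𝔓.next ρ.last with
    | none => rw [hc] at h; cases h
    | some c =>
      rw [hc] at h
      exact ⟨ρ, c, rfl, hc, (Option.some.inj h).symm⟩

theorem extLetter_isP [Nontrivial R] (hinv : B.IsTrivialOrInverse) {v : Q₀}
    (hB : B.headV 𝔓.Q.lhead = some v) {k : ℕ} {σ : NPath Q₁}
    (h : 𝔓.extLetter s B k = some σ) : 𝔓.IsP σ := by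
  cases k with
  | zero =>
    obtain ⟨b, hb, rfl⟩ := extLetter_zero h
    exact (extends_properties hinv hB hb).1
  | succ k =>
    obtain ⟨ρ, c, -, -, rfl⟩ := extLetter_of_succ h
    exact 𝔓.isP_arrow c

end Extension

end Presentation

end Gentle

/-! ### The sequence `𝓡_C` is a generalised word. -/

namespace Gentle

namespace Presentation

variable {R Λ : Type*} [CommRing R] [Ring Λ] [Algebra R Λ] {Q₀ Q₁ : Type*} [Fintype Q₀]
variable {𝔓 : Presentation R Λ Q₀ Q₁} {s : Letter Q₁ → ℤˣ} {C B : Word Q₀ Q₁} {A : Core Q₀ Q₁}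
variable {D : Word Q₀ Q₁}

/-! ### The letters of `𝓡_C` -/

theorem resLetter_neg (k : ℕ) :
    𝔓.resLetter s B A D (-k) = (𝔓.extLetter s B k).map .inv := by
  rw [resLetter, if_pos (by omega), neg_neg, Int.toNat_natCast]

theorem resLetter_pos (k : ℕ) :
    𝔓.resLetter s B A D (2 * A.blocks.length + 1 + k) = (𝔓.extLetter s D k).map .dir := by
  rw [resLetter, if_neg (by omega), coreLetter, if_neg (by omega)]
  congr 2
  omega

theorem resLetter_dir {k : ℕ} (hk : k < A.blocks.length) :
    𝔓.resLetter s B A D (2 * k + 1) = some (.dir A.blocks[k].1) := by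
  rw [resLetter, if_neg (by omega), coreLetter, if_pos (by omega),
    show ((2 : ℤ) * k + 1 - 1).toNat = 2 * k by omega, (blockGLetters_getElem? _ k).1,
    List.getElem?_eq_getElem hk]
  rfl

theorem resLetter_inv {k : ℕ} (hk : k < A.blocks.length) :
    𝔓.resLetter s B A D (2 * k + 2) = some (.inv A.blocks[k].2) := by
  rw [resLetter, if_neg (by omega), coreLetter, if_pos (by omega),
    show ((2 : ℤ) * k + 2 - 1).toNat = 2 * k + 1 by omega, (blockGLetters_getElem? _ k).2,
    List.getElem?_eq_getElem hk]
  rfl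

/-- The four kinds of positions in `𝓡_C`. -/
theorem position_cases (n : ℕ) (r : ℤ) : (∃ k : ℕ, r = -k) ∨ (∃ k : ℕ, k < n ∧ r = 2 * k + 1) ∨
    (∃ k : ℕ, k < n ∧ r = 2 * k + 2) ∨ ∃ k : ℕ, r = 2 * n + 1 + k := by
  rcases le_or_gt r 0 with h | h
  · exact Or.inl ⟨(-r).toNat, by omega⟩
  · rcases le_or_gt r (2 * n) with h2 | h2
    · rcases Int.even_or_odd' r with ⟨m, hm | hm⟩
      · exact Or.inr (Or.inr (Or.inl ⟨(m - 1).toNat, by omega, by omega⟩))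
      · exact Or.inr (Or.inl ⟨m.toNat, by omega, by omega⟩)
    · exact Or.inr (Or.inr (Or.inr ⟨(r - 2 * n - 1).toNat, by omega⟩))

/-! ### Junctions -/

namespace IsStringWord

theorem head_right (hw : 𝔓.IsStringWord s C B A D) : ∃ v, D.headV 𝔓.Q.lhead = some v := by
  obtain ⟨v, -, h⟩ := hw.composable_right.1
  exact ⟨v, h⟩

theorem head_left (hw : 𝔓.IsStringWord s C B A D) : ∃ v, B.headV 𝔓.Q.lhead = some v := by
  obtain ⟨v, h, -⟩ := hw.composable_left.1
  rw [Seq.inverse_inverse] at h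
  exact ⟨v, h⟩

theorem chain_blocks (hw : 𝔓.IsStringWord s C B A D) : A.blocks.IsChain 𝔓.BlockAdj ∧
    ∀ p ∈ A.blocks, 𝔓.Q.phead p.1 = 𝔓.Q.phead p.2 ∧ p.1.last ≠ p.2.last := by
  cases A with
  | triv v ε => simp [Core.blocks]
  | alt bs h => exact blocks_of_isChain (isChain_of_isWord hw.word_core)

theorem properties_left [Nontrivial R] (hw : 𝔓.IsStringWord s C B A D) {β : NPath Q₁}
    (h : 𝔓.extLetter s B 0 = some β) : B.headV 𝔓.Q.lhead = some (𝔓.Q.ptail β) ∧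
      B.sign s = some (s (.inv β.first)) := by
  obtain ⟨b, hb, rfl⟩ := extLetter_zero h
  obtain ⟨v, hv⟩ := hw.head_left
  exact (extends_properties hw.inverse_left hv hb).2

theorem properties_right [Nontrivial R] (hw : 𝔓.IsStringWord s C B A D) {β : NPath Q₁}
    (h : 𝔓.extLetter s D 0 = some β) : D.headV 𝔓.Q.lhead = some (𝔓.Q.ptail β) ∧
      D.sign s = some (s (.inv β.first)) := by
  obtain ⟨b, hb, rfl⟩ := extLetter_zero h
  obtain ⟨v, hv⟩ := hw.head_right
  exact (extends_properties hw.inverse_right hv hb).2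

theorem headV_core (hw : 𝔓.IsStringWord s C B A D) (hn : 0 < A.blocks.length) :
    (A.toWord.comp D).headV 𝔓.Q.lhead = some (𝔓.Q.ptail A.blocks[0].1) ∧
      (A.toWord.comp D).sign s = some (s (.inv A.blocks[0].1.first)) := by
  cases A with
  | triv v ε => simp [Core.blocks] at hn
  | alt bs h =>
    obtain ⟨p, t, rfl⟩ := List.exists_cons_of_ne_nil h
    have hp : (blockLetters (p :: t)).head? = some (.inv p.1.first) := head?_blockLetters_cons p t
    obtain ⟨v, hv⟩ := hw.head_right
    cases D with
    | triv w δ =>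
      simp only [Core.toWord, Seq.comp, Seq.headV, Seq.sign, hp]
      exact ⟨rfl, rfl⟩
    | fin l hl =>
      simp only [Core.toWord, Seq.comp, Seq.headV, Seq.sign, List.head?_append, hp]
      exact ⟨rfl, rfl⟩
    | right c =>
      have hlen : 0 < (blockLetters (p :: t)).length :=
        List.length_pos_iff.mpr (blockLetters_ne_nil h)
      rw [List.head?_eq_getElem?, List.getElem?_eq_getElem hlen] at hp
      simp only [Core.toWord, Seq.comp, Seq.headV, Seq.sign, dif_pos hlen, Option.some.inj hp]
      exact ⟨rfl, rfl⟩
    | left c => cases hv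
    | bi c => cases hv

/-- The choice of signs is what matters here: composability of `B⁻¹` with `A D` gives opposite signs
to the inverses of the first arrows of `β` and `γ₁`, so these arrows differ. The right junction is
treated in the same way. -/
theorem gAdjacent_left [Nontrivial R] (hw : 𝔓.IsStringWord s C B A D) {β : NPath Q₁}
    (h : 𝔓.extLetter s B 0 = some β) (hn : 0 < A.blocks.length) :
    𝔓.GAdjacent (.inv β) (.dir A.blocks[0].1) := by
  obtain ⟨h1, h2⟩ := hw.properties_left h
  obtain ⟨h3, h4⟩ := hw.headV_core hn
  obtain ⟨⟨v, hv1, hv2⟩, ε, hε1, hε2⟩ := hw.composable_left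
  rw [Seq.inverse_inverse] at hv1 hε1
  refine ⟨Option.some.inj (h1.symm.trans (hv1.trans (hv2.symm.trans h3))), fun hf => ?_⟩
  rw [h2] at hε1
  rw [h4] at hε2
  have := (Option.some.inj hε1).symm.trans ((congrArg _ (congrArg _ hf)).trans
    (Option.some.inj hε2))
  exact units_ne_neg_self ε this.symm

theorem inverse_core (hn : 0 < A.blocks.length) :
    A.toWord.inverse.headV 𝔓.Q.lhead = some (𝔓.Q.ptail A.blocks[A.blocks.length - 1].2) ∧
      A.toWord.inverse.sign s = some (s (.inv A.blocks[A.blocks.length - 1].2.first)) := by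
  cases A with
  | triv v ε => simp [Core.blocks] at hn
  | alt bs h =>
    have hp := getLast?_blockLetters h
    rw [List.getLast_eq_getElem] at hp
    simp only [Core.toWord, Seq.inverse, Seq.headV, Seq.sign, List.head?_map, List.head?_reverse,
      hp]
    exact ⟨rfl, rfl⟩

theorem gAdjacent_right [Nontrivial R] (hw : 𝔓.IsStringWord s C B A D) {β : NPath Q₁}
    (h : 𝔓.extLetter s D 0 = some β) (hn : 0 < A.blocks.length) :
    𝔓.GAdjacent (.inv A.blocks[A.blocks.length - 1].2) (.dir β) := by
  obtain ⟨h1, h2⟩ := hw.properties_right h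
  obtain ⟨h3, h4⟩ := inverse_core (𝔓 := 𝔓) (s := s) hn
  obtain ⟨⟨v, hv1, hv2⟩, ε, hε1, hε2⟩ := hw.composable_right
  refine ⟨Option.some.inj (h3.symm.trans (hv1.trans (hv2.symm.trans h1))), fun hf => ?_⟩
  rw [h4] at hε1
  rw [h2] at hε2
  have := (Option.some.inj hε1).symm.trans ((congrArg _ (congrArg _ hf)).trans
    (Option.some.inj hε2))
  exact units_ne_neg_self ε this.symm

theorem vertex_left [Nontrivial R] {v : Q₀} {ε : ℤˣ}
    (hw : 𝔓.IsStringWord s C B (.triv v ε) D) {β : NPath Q₁}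
    (h : 𝔓.extLetter s B 0 = some β) : 𝔓.Q.ptail β = v := by
  obtain ⟨h1, -⟩ := hw.properties_left h
  obtain ⟨w, hw1, hw2⟩ := hw.composable_right.1
  obtain ⟨u, hu1, hu2⟩ := hw.composable_left.1
  rw [Seq.inverse_inverse] at hu1
  exact Option.some.inj (h1.symm.trans (hu1.trans (hu2.symm.trans (hw2.trans hw1.symm))))

theorem vertex_right [Nontrivial R] {v : Q₀} {ε : ℤˣ}
    (hw : 𝔓.IsStringWord s C B (.triv v ε) D) {β : NPath Q₁}
    (h : 𝔓.extLetter s D 0 = some β) : 𝔓.Q.ptail β = v := by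
  obtain ⟨h1, -⟩ := hw.properties_right h
  obtain ⟨w, hw1, hw2⟩ := hw.composable_right.1
  exact Option.some.inj (h1.symm.trans (hw2.trans hw1.symm))

/-- For trivial `A` the two extensions meet at a single vertex, and the signs of `B` and `D` are
compared directly. -/
theorem gAdjacent_both [Nontrivial R] (hw : 𝔓.IsStringWord s C B A D) {β β' : NPath Q₁}
    (h : 𝔓.extLetter s B 0 = some β) (h' : 𝔓.extLetter s D 0 = some β')
    (hn : A.blocks.length = 0) : 𝔓.GAdjacent (.inv β) (.dir β') := by
  obtain ⟨v, ε, rfl⟩ := Core.eq_triv hn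
  obtain ⟨-, h2⟩ := hw.properties_left h
  obtain ⟨-, h2'⟩ := hw.properties_right h'
  refine ⟨(hw.vertex_left h).trans (hw.vertex_right h').symm, fun hf => ?_⟩
  obtain ⟨ε, hε1, hε2⟩ := hw.composable_left.2
  rw [Seq.inverse_inverse, h2] at hε1
  change D.sign s = _ at hε2
  rw [h2'] at hε2
  have := (Option.some.inj hε1).symm.trans ((congrArg _ (congrArg _ hf)).trans
    (Option.some.inj hε2))
  exact units_ne_neg_self ε this.symm

theorem resLetter_isP [Nontrivial R] (hw : 𝔓.IsStringWord s C B A D) {r : ℤ}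
    {l : Letter (NPath Q₁)} (h : 𝔓.resLetter s B A D r = some l) : 𝔓.IsP l.base := by
  rcases position_cases A.blocks.length r with ⟨k, rfl⟩ | ⟨k, hk, rfl⟩ | ⟨k, hk, rfl⟩ | ⟨k, rfl⟩
  · rw [resLetter_neg] at h
    obtain ⟨β, hβ, rfl⟩ := Option.map_eq_some_iff.mp h
    obtain ⟨v, hv⟩ := hw.head_left
    exact extLetter_isP hw.inverse_left hv hβ
  · rw [resLetter_dir hk] at h
    cases h
    exact (hw.blocks_mem _ (List.getElem_mem hk)).1
  · rw [resLetter_inv hk] at h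
    cases h
    exact (hw.blocks_mem _ (List.getElem_mem hk)).2
  · rw [resLetter_pos] at h
    obtain ⟨β, hβ, rfl⟩ := Option.map_eq_some_iff.mp h
    obtain ⟨v, hv⟩ := hw.head_right
    exact extLetter_isP hw.inverse_right hv hβ

/-- The condition comes from the signs at the junctions, from the word `A` inside `𝒜`, and from the
zero products that define the successive arrows inside the extensions. -/
theorem resLetter_adjacent [Nontrivial R] (h𝔓 : 𝔓.IsCompleteGentle)
    (hw : 𝔓.IsStringWord s C B A D) {r : ℤ} {l l' : Letter (NPath Q₁)}
    (h : 𝔓.resLetter s B A D r = some l) (h' : 𝔓.resLetter s B A D (r + 1) = some l') :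
    𝔓.GAdjacent l l' := by
  obtain ⟨hc1, hc2⟩ := hw.chain_blocks
  rcases position_cases A.blocks.length r with ⟨k, rfl⟩ | ⟨k, hk, rfl⟩ | ⟨k, hk, rfl⟩ | ⟨k, rfl⟩
  · rw [resLetter_neg] at h
    obtain ⟨β, hβ, rfl⟩ := Option.map_eq_some_iff.mp h
    cases k with
    | zero =>
      rcases Nat.eq_zero_or_pos A.blocks.length with hn | hn
      · have h1 := resLetter_pos (𝔓 := 𝔓) (s := s) (B := B) (A := A) (D := D) 0
        rw [hn] at h1
        have h2 := h1.symm.trans h'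
        obtain ⟨β', hβ', rfl⟩ := Option.map_eq_some_iff.mp h2
        exact hw.gAdjacent_both hβ hβ' hn
      · have h1 := resLetter_dir (𝔓 := 𝔓) (s := s) (B := B) (D := D) hn
        have h2 := h1.symm.trans h'
        cases h2
        exact hw.gAdjacent_left hβ hn
    | succ k =>
      rw [show -((k + 1 : ℕ) : ℤ) + 1 = -(k : ℤ) by push_cast; ring, resLetter_neg] at h'
      obtain ⟨ρ, c, hρ, hc, rfl⟩ := extLetter_of_succ hβ
      rw [hρ] at h'
      cases h'
      have h2 := (next_eq_some h𝔓).mp hc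
      exact h2
  · rw [resLetter_dir hk] at h
    rw [show (2 : ℤ) * k + 1 + 1 = 2 * k + 2 by ring, resLetter_inv hk] at h'
    cases h
    cases h'
    exact hc2 _ (List.getElem_mem hk)
  · rw [resLetter_inv hk] at h
    cases h
    by_cases hk' : k + 1 < A.blocks.length
    · have h1 := resLetter_dir (𝔓 := 𝔓) (s := s) (B := B) (D := D) hk'
      rw [show (2 : ℤ) * (k + 1 : ℕ) + 1 = 2 * k + 2 + 1 by push_cast; ring, h'] at h1
      cases h1
      exact List.isChain_iff_getElem.mp hc1 k hk'
    · have hk2 : k = A.blocks.length - 1 := by omega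
      have h1 := resLetter_pos (𝔓 := 𝔓) (s := s) (B := B) (A := A) (D := D) 0
      rw [show (2 : ℤ) * A.blocks.length + 1 + (0 : ℕ) = 2 * k + 2 + 1 by omega, h'] at h1
      obtain ⟨β', hβ', rfl⟩ := Option.map_eq_some_iff.mp h1.symm
      subst hk2
      exact hw.gAdjacent_right hβ' (by omega)
  · rw [resLetter_pos] at h
    rw [show (2 : ℤ) * A.blocks.length + 1 + k + 1 = 2 * A.blocks.length + 1 + (k + 1 : ℕ) by
      push_cast; ring, resLetter_pos] at h'
    obtain ⟨β, hβ, rfl⟩ := Option.map_eq_some_iff.mp h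
    obtain ⟨β', hβ', rfl⟩ := Option.map_eq_some_iff.mp h'
    obtain ⟨ρ, c, hρ, hc, rfl⟩ := extLetter_of_succ hβ'
    rw [hρ] at hβ
    cases hβ
    have h2 := (next_eq_some h𝔓).mp hc
    exact ⟨h2.1.symm, h2.2⟩

theorem isGWord [Nontrivial R] (h𝔓 : 𝔓.IsCompleteGentle) (hw : 𝔓.IsStringWord s C B A D) :
    𝔓.IsGWord (𝔓.resString s B A D) where
  mem i l h := by
    obtain ⟨r, rfl⟩ : ∃ r, i = 𝔓.resStringStart s B A D + r := ⟨i - 𝔓.resStringStart s B A D, by ring⟩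
    rw [resString_letterAt] at h
    exact hw.resLetter_isP h
  adjacent i l l' h h' := by
    obtain ⟨r, rfl⟩ : ∃ r, i = 𝔓.resStringStart s B A D + r := ⟨i - 𝔓.resStringStart s B A D, by ring⟩
    rw [add_assoc] at h'
    rw [resString_letterAt] at h h'
    exact hw.resLetter_adjacent h𝔓 h h'

end IsStringWord

end Presentation

end Gentle

/-! ### Heights and local exactness in `𝓡_C`. -/

namespace Gentle

namespace Presentation

namespace IsStringWord

section Heights

variable {R Λ : Type*} [CommRing R] [Ring Λ] [Algebra R Λ] {Q₀ Q₁ : Type*} [Fintype Q₀]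
variable {𝔓 : Presentation R Λ Q₀ Q₁} {s : Letter Q₁ → ℤˣ} {C B : Word Q₀ Q₁} {A : Core Q₀ Q₁}
variable {D : Word Q₀ Q₁}

theorem extLetter_isSome_of_le {k m : ℕ} (hkm : k ≤ m) (h : (𝔓.extLetter s B m).isSome) :
    (𝔓.extLetter s B k).isSome := by
  induction m, hkm using Nat.le_induction with
  | base => exact h
  | succ m _ ih =>
    obtain ⟨σ, hσ⟩ := Option.isSome_iff_exists.mp h
    obtain ⟨ρ, c, hρ, -⟩ := extLetter_of_succ hσ
    exact ih (by rw [hρ]; rfl)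

theorem degAt_eq (r : ℤ) : (𝔓.resString s B A D).degAt (𝔓.resStringStart s B A D + r) =
    (𝔓.resLetter s B A D r).elim 0 Letter.deg := by
  rw [Seq.degAt, resString_letterAt]

theorem ht_succ_eq (r : ℤ) : (𝔓.resString s B A D).ht (𝔓.resStringStart s B A D + (r + 1)) =
    (𝔓.resString s B A D).ht (𝔓.resStringStart s B A D + r) +
      (𝔓.resLetter s B A D (r + 1)).elim 0 Letter.deg := by
  rw [← degAt_eq, ← add_assoc, Seq.ht_succ]

/-- The height at a peak. -/
theorem ht_even {k : ℕ} (hk : k ≤ A.blocks.length) :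
    (𝔓.resString s B A D).ht (𝔓.resStringStart s B A D + 2 * k) =
      (𝔓.resString s B A D).ht (𝔓.resStringStart s B A D) := by
  induction k with
  | zero => simp
  | succ k ih =>
    rw [show (2 : ℤ) * (k + 1 : ℕ) = 2 * k + 1 + 1 by push_cast; ring, ht_succ_eq, ht_succ_eq,
      ih (by omega), show (2 : ℤ) * k + 1 + 1 = 2 * k + 2 by ring, resLetter_dir (by omega),
      resLetter_inv (by omega)]
    simp [Letter.deg]

theorem ht_odd {k : ℕ} (hk : k < A.blocks.length) :
    (𝔓.resString s B A D).ht (𝔓.resStringStart s B A D + (2 * k + 1)) =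
      (𝔓.resString s B A D).ht (𝔓.resStringStart s B A D) - 1 := by
  rw [ht_succ_eq, ht_even hk.le, resLetter_dir hk]
  simp [Letter.deg, sub_eq_add_neg]

/-- The letter must exist: beyond the end of the word the degree is `0` by default, and the height
would stop falling. -/
theorem ht_neg {k : ℕ} (hk : (𝔓.extLetter s B k).isSome) :
    (𝔓.resString s B A D).ht (𝔓.resStringStart s B A D + -((k + 1 : ℕ) : ℤ)) =
      (𝔓.resString s B A D).ht (𝔓.resStringStart s B A D) - (k + 1 : ℕ) := by
  induction k with
  | zero =>
    have h := ht_succ_eq (𝔓 := 𝔓) (s := s) (B := B) (A := A) (D := D) (-1)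
    obtain ⟨β, hβ⟩ := Option.isSome_iff_exists.mp hk
    have h2 := resLetter_neg (𝔓 := 𝔓) (s := s) (B := B) (A := A) (D := D) 0
    rw [hβ, Nat.cast_zero, neg_zero] at h2
    rw [neg_add_cancel, add_zero, h2] at h
    simp only [Option.map_some, Option.elim_some, Letter.deg] at h
    rw [zero_add, Nat.cast_one]
    omega
  | succ k ih =>
    have h := ht_succ_eq (𝔓 := 𝔓) (s := s) (B := B) (A := A) (D := D) (-((k + 1 + 1 : ℕ) : ℤ))
    obtain ⟨β, hβ⟩ := Option.isSome_iff_exists.mp hk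
    have h2 := resLetter_neg (𝔓 := 𝔓) (s := s) (B := B) (A := A) (D := D) (k + 1)
    rw [hβ] at h2
    rw [show -((k + 1 + 1 : ℕ) : ℤ) + 1 = -((k + 1 : ℕ) : ℤ) by push_cast; ring, h2,
      ih (extLetter_isSome_of_le (Nat.le_succ k) hk)] at h
    simp only [Option.map_some, Option.elim_some, Letter.deg] at h
    omega

theorem ht_pos {k : ℕ} (hk : (𝔓.extLetter s D k).isSome) :
    (𝔓.resString s B A D).ht (𝔓.resStringStart s B A D + (2 * A.blocks.length + 1 + k)) =
      (𝔓.resString s B A D).ht (𝔓.resStringStart s B A D) - (k + 1 : ℕ) := by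
  have h2 := resLetter_pos (𝔓 := 𝔓) (s := s) (B := B) (A := A) (D := D) k
  obtain ⟨β, hβ⟩ := Option.isSome_iff_exists.mp hk
  rw [hβ] at h2
  induction k generalizing β with
  | zero =>
    rw [Nat.cast_zero, add_zero] at h2 ⊢
    rw [ht_succ_eq, ht_even le_rfl, h2]
    simp only [Option.map_some, Option.elim_some, Letter.deg]
    omega
  | succ k ih =>
    have hk' := extLetter_isSome_of_le (Nat.le_succ k) hk
    obtain ⟨β', hβ'⟩ := Option.isSome_iff_exists.mp hk'
    have h3 := resLetter_pos (𝔓 := 𝔓) (s := s) (B := B) (A := A) (D := D) k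
    rw [hβ'] at h3
    have h4 := ih hk' β' h3 hβ'
    rw [show (2 : ℤ) * A.blocks.length + 1 + (k + 1 : ℕ) = 2 * A.blocks.length + 1 + k + 1 by
      push_cast; ring] at h2 ⊢
    rw [ht_succ_eq, h4, h2]
    simp only [Option.map_some, Option.elim_some, Letter.deg]
    push_cast
    ring

/-- The positions of `𝓡_C`, with the letters of the extensions which they require. -/
theorem index_cases {i : ℤ} (hi : i ∈ (𝔓.resString s B A D).index) :
    (∃ k : ℕ, k ≤ A.blocks.length ∧ i = 𝔓.resStringStart s B A D + 2 * k) ∨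
    (∃ k : ℕ, k < A.blocks.length ∧ i = 𝔓.resStringStart s B A D + (2 * k + 1)) ∨
    (∃ k : ℕ, (𝔓.extLetter s B k).isSome ∧
      i = 𝔓.resStringStart s B A D + -((k + 1 : ℕ) : ℤ)) ∨
    ∃ k : ℕ, (𝔓.extLetter s D k).isSome ∧
      i = 𝔓.resStringStart s B A D + (2 * A.blocks.length + 1 + k) := by
  obtain ⟨r, rfl⟩ : ∃ r, i = 𝔓.resStringStart s B A D + r :=
    ⟨i - 𝔓.resStringStart s B A D, by ring⟩
  have hsome : r = 0 ∨ (𝔓.resLetter s B A D r).isSome ∨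
      (𝔓.resLetter s B A D (r + 1)).isSome := by
    rcases Seq.mem_index_iff.mp hi with h | h | ⟨⟨v, δ, h⟩, h0⟩
    · rw [resString_letterAt] at h
      exact Or.inr (Or.inl h)
    · rw [add_assoc, resString_letterAt] at h
      exact Or.inr (Or.inr h)
    · have := (𝔓.resString_eq_triv s h).2
      left
      omega
  rcases position_cases A.blocks.length r with ⟨k, rfl⟩ | ⟨k, hk, rfl⟩ | ⟨k, hk, rfl⟩ | ⟨k, rfl⟩
  · cases k with
    | zero => exact Or.inl ⟨0, Nat.zero_le _, by simp⟩
    | succ k =>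
      right; right; left
      refine ⟨k, ?_, rfl⟩
      rcases hsome with h | h | h
      · omega
      · rw [resLetter_neg, Option.isSome_map] at h
        exact extLetter_isSome_of_le (Nat.le_succ k) h
      · rwa [show -((k + 1 : ℕ) : ℤ) + 1 = -(k : ℤ) by push_cast; ring, resLetter_neg,
          Option.isSome_map] at h
  · exact Or.inr (Or.inl ⟨k, hk, rfl⟩)
  · exact Or.inl ⟨k + 1, hk, by push_cast; ring⟩
  · right; right; right
    refine ⟨k, ?_, rfl⟩
    rcases hsome with h | h | h
    · omega
    · rwa [resLetter_pos, Option.isSome_map] at h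
    · rw [show (2 : ℤ) * A.blocks.length + 1 + k + 1 = 2 * A.blocks.length + 1 + (k + 1 : ℕ) by
        push_cast; ring, resLetter_pos, Option.isSome_map] at h
      exact extLetter_isSome_of_le (Nat.le_succ k) h

theorem ht_le {i : ℤ} (hi : i ∈ (𝔓.resString s B A D).index) : (𝔓.resString s B A D).ht i ≤
    (𝔓.resString s B A D).ht (𝔓.resStringStart s B A D) := by
  rcases index_cases hi with ⟨k, hk, rfl⟩ | ⟨k, hk, rfl⟩ | ⟨k, hk, rfl⟩ | ⟨k, hk, rfl⟩
  · exact (ht_even hk).le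
  · rw [ht_odd hk]; omega
  · rw [ht_neg hk]; omega
  · rw [ht_pos hk]; omega

theorem letterAt_add (r m : ℤ) :
    (𝔓.resString s B A D).letterAt (𝔓.resStringStart s B A D + r + m) =
      𝔓.resLetter s B A D (r + m) := by
  rw [add_assoc, resString_letterAt]

/-- Below the top there are two kinds of positions: valleys of the zigzag, where letters lead away
on both sides, and positions on the extensions, where the following letter is by construction the
arrow generating the annihilator. Beyond it the letters of an extension keep their direction, so no
further boundary term occurs. -/
theorem locallyExact {i : ℤ} (hi : i ∈ (𝔓.resString s B A D).index)
    (hne : (𝔓.resString s B A D).ht i ≠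
      (𝔓.resString s B A D).ht (𝔓.resStringStart s B A D)) :
    LocallyExact 𝔓 (𝔓.resString s B A D) i := by
  rcases index_cases hi with ⟨k, hk, rfl⟩ | ⟨k, hk, rfl⟩ | ⟨k, hk, rfl⟩ | ⟨k, hk, rfl⟩
  · exact absurd (ht_even hk) hne
  · left
    refine ⟨A.blocks[k].1, A.blocks[k].2, ?_, ?_⟩
    · rw [resString_letterAt, resLetter_dir hk]
    · rw [letterAt_add, add_assoc, show (1 : ℤ) + 1 = 2 by norm_num, resLetter_inv hk]
  · right; right
    obtain ⟨ρ, hρ⟩ := Option.isSome_iff_exists.mp hk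
    refine ⟨ρ, ?_, fun c hc => ⟨?_, fun η h => ?_⟩⟩
    · rw [letterAt_add, show -((k + 1 : ℕ) : ℤ) + 1 = -(k : ℤ) by push_cast; ring, resLetter_neg,
        hρ]
      rfl
    · rw [resString_letterAt, resLetter_neg, extLetter_succ, hρ, Option.bind_some, hc]
      rfl
    · rw [sub_eq_add_neg, letterAt_add,
        show -((k + 1 : ℕ) : ℤ) + -1 = -((k + 2 : ℕ) : ℤ) by push_cast; ring, resLetter_neg] at h
      obtain ⟨_, -, h'⟩ := Option.map_eq_some_iff.mp h
      cases h'
  · right; left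
    obtain ⟨ρ, hρ⟩ := Option.isSome_iff_exists.mp hk
    refine ⟨ρ, ?_, fun c hc => ⟨?_, fun η h => ?_⟩⟩
    · rw [resString_letterAt, resLetter_pos, hρ]
      rfl
    · rw [letterAt_add, show (2 : ℤ) * A.blocks.length + 1 + k + 1 =
        2 * A.blocks.length + 1 + (k + 1 : ℕ) by push_cast; ring, resLetter_pos, extLetter_succ, hρ,
        Option.bind_some, hc]
      rfl
    · rw [add_assoc _ (1 : ℤ) 1, letterAt_add, show (2 : ℤ) * A.blocks.length + 1 + k + (1 + 1) =
        2 * A.blocks.length + 1 + (k + 2 : ℕ) by push_cast; ring, resLetter_pos] at h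
      obtain ⟨_, -, h'⟩ := Option.map_eq_some_iff.mp h
      cases h'

theorem peak_mem_index {k : ℕ} (hk : k ≤ A.blocks.length) :
    𝔓.resStringStart s B A D + 2 * k ∈ (𝔓.resString s B A D).index := by
  rcases hk.lt_or_eq with h | rfl
  · have h1 := 𝔓.resString_letterAt s B A D (2 * k + 1)
    rw [resLetter_dir h] at h1
    have := (Seq.mem_index_of_letterAt h1).2
    rwa [← add_assoc, add_sub_cancel_right] at this
  · rcases Nat.eq_zero_or_pos A.blocks.length with hn | hn
    · rw [Seq.mem_index_iff]
      by_cases h1 : ((𝔓.resString s B A D).letterAt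
        (𝔓.resStringStart s B A D + 2 * A.blocks.length)).isSome
      · exact Or.inl h1
      by_cases h2 : ((𝔓.resString s B A D).letterAt
        (𝔓.resStringStart s B A D + 2 * A.blocks.length + 1)).isSome
      · exact Or.inr (Or.inl h2)
      -- With `A` trivial and both extensions absent there are no letters at all, and the peak is
      -- the only position of a trivial sequence.
      right; right
      rw [letterAt_add] at h2
      have h3 := resLetter_pos (𝔓 := 𝔓) (s := s) (B := B) (A := A) (D := D) 0
      have h4 := resLetter_neg (𝔓 := 𝔓) (s := s) (B := B) (A := A) (D := D) 0
      rw [resString_letterAt] at h1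
      rw [hn] at h1 h2 h3
      have hD : (𝔓.extLetter s D 0).isSome = false := by
        have h6 : 𝔓.resLetter s B A D (2 * (0 : ℕ) + 1) = (𝔓.extLetter s D 0).map .dir := h3
        rw [h6, Option.isSome_map] at h2
        exact Bool.eq_false_iff.mpr h2
      have hB : (𝔓.extLetter s B 0).isSome = false := by
        have h5 : 𝔓.resLetter s B A D (2 * (0 : ℕ)) = (𝔓.extLetter s B 0).map .inv := h4
        rw [h5, Option.isSome_map] at h1
        exact Bool.eq_false_iff.mpr h1
      obtain ⟨v, ε, rfl⟩ := Core.eq_triv hn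
      have hB' : 𝔓.upExt s B = none := by
        unfold extLetter at hB
        unfold upExt
        split_ifs at hB ⊢
        · simp [upLetter] at hB
        · rfl
      have hD' : 𝔓.upExt s D = none := by
        unfold extLetter at hD
        unfold upExt
        split_ifs at hD ⊢
        · simp [upLetter] at hD
        · rfl
      have h5 : 𝔓.resString s B (.triv v ε) D = .triv v ε := by
        rw [resString, hB', hD']
        rfl
      exact ⟨⟨v, ε, h5⟩, by simp [resStringStart, hB', Core.blocks]⟩
    · have h1 := 𝔓.resString_letterAt s B A D (2 * (A.blocks.length - 1 : ℕ) + 2)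
      rw [resLetter_inv (by omega)] at h1
      have := (Seq.mem_index_of_letterAt h1).1
      rwa [show (2 : ℤ) * (A.blocks.length - 1 : ℕ) + 2 = 2 * A.blocks.length by omega] at this

/-- The idempotent of `𝓡_C` at a peak. -/
theorem gIdem_peak [Nontrivial R] (h𝔓 : 𝔓.IsCompleteGentle) (hw : 𝔓.IsStringWord s C B A D) {k : ℕ}
    (hk : k ≤ A.blocks.length) :
    𝔓.gIdem (𝔓.resString s B A D) (𝔓.resStringStart s B A D + 2 * k) =
      𝔓.e (A.peakVertex 𝔓.Q k) := by
  have h𝒞 := hw.isGWord h𝔓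
  rcases hk.lt_or_eq with h | rfl
  · have h1 := 𝔓.resString_letterAt s B A D (2 * k + 1)
    rw [resLetter_dir h, ← add_assoc] at h1
    rw [gIdem_of_dir_succ h𝒞 h1]
    cases A with
    | triv v ε => simp [Core.blocks] at h
    | alt bs hbs =>
      simp only [Core.blocks] at h
      simp only [Core.peakVertex, Core.blocks, List.getElem?_eq_getElem h]
  · rcases Nat.eq_zero_or_pos A.blocks.length with hn | hn
    · obtain ⟨v, ε, rfl⟩ := Core.eq_triv hn
      simp only [Core.blocks, List.length_nil, Nat.cast_zero, mul_zero, add_zero, Core.peakVertex]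
      have h3 := resLetter_pos (𝔓 := 𝔓) (s := s) (B := B) (A := .triv v ε) (D := D) 0
      have h4 := resLetter_neg (𝔓 := 𝔓) (s := s) (B := B) (A := .triv v ε) (D := D) 0
      have h5 := 𝔓.resString_letterAt s B (.triv v ε) D 0
      have h6 := 𝔓.resString_letterAt s B (.triv v ε) D 1
      rw [add_zero] at h5
      rw [show (2 : ℤ) * (Core.triv (Q₁ := Q₁) v ε).blocks.length + 1 + (0 : ℕ) = 1 by
        simp [Core.blocks]] at h3
      rw [Nat.cast_zero, neg_zero] at h4
      rw [h4] at h5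
      rw [h3] at h6
      cases hB : 𝔓.extLetter s B 0 with
      | some β =>
        rw [hB] at h5
        rw [gIdem_of_inv h5, hw.vertex_left hB]
      | none =>
        cases hD : 𝔓.extLetter s D 0 with
        | some β =>
          rw [hD] at h6
          rw [gIdem_of_dir_succ h𝒞 h6, hw.vertex_right hD]
        | none =>
          have hmem := peak_mem_index (𝔓 := 𝔓) (s := s) (B := B) (A := .triv v ε) (D := D)
            (k := 0) (Nat.zero_le _)
          rw [Nat.cast_zero, mul_zero, add_zero] at hmem
          rcases Seq.mem_index_iff.mp hmem with h | h | ⟨⟨w, δ, h⟩, h0⟩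
          · rw [h5, hB] at h; cases h
          · rw [h6, hD] at h; cases h
          · have h7 := (𝔓.resString_eq_triv s h).1
            cases h7
            rw [gIdem, h, h0]
            rfl
    · have h1 := 𝔓.resString_letterAt s B A D (2 * (A.blocks.length - 1 : ℕ) + 2)
      rw [resLetter_inv (by omega)] at h1
      rw [show (2 : ℤ) * (A.blocks.length - 1 : ℕ) + 2 = 2 * A.blocks.length by omega] at h1
      rw [gIdem_of_inv h1]
      cases A with
      | triv v ε => simp [Core.blocks] at hn
      | alt bs hbs =>
        simp only [Core.peakVertex, Core.blocks, List.getElem?_eq_none le_rfl,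
          List.getLast_eq_getElem]

end Heights

end IsStringWord

end Presentation

end Gentle

/-! ### The augmentation onto the string module. -/

namespace Gentle

namespace Presentation

namespace IsStringWord

section Augmentation

variable {R Λ : Type*} [CommRing R] [Ring Λ] [Algebra R Λ] {Q₀ Q₁ : Type*} [Fintype Q₀]
variable {𝔓 : Presentation R Λ Q₀ Q₁} {s : Letter Q₁ → ℤˣ} {C B : Word Q₀ Q₁} {A : Core Q₀ Q₁}
variable {D : Word Q₀ Q₁}

/-- The height of the peaks of `𝓡_C`. -/
noncomputable abbrev top (𝔓 : Presentation R Λ Q₀ Q₁) (s : Letter Q₁ → ℤˣ) (B : Word Q₀ Q₁)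
    (A : Core Q₀ Q₁) (D : Word Q₀ Q₁) : ℤ :=
  (𝔓.resString s B A D).ht (𝔓.resStringStart s B A D)

/-- The peaks of `𝓡_C`. -/
noncomputable abbrev peak (𝔓 : Presentation R Λ Q₀ Q₁) (s : Letter Q₁ → ℤˣ) (B : Word Q₀ Q₁)
    (A : Core Q₀ Q₁) (D : Word Q₀ Q₁) (k : ℕ) : ℤ := 𝔓.resStringStart s B A D + 2 * k

theorem peak_mem {k : ℕ} (hk : k ≤ A.blocks.length) :
    peak 𝔓 s B A D k ∈ (𝔓.resString s B A D).index ∧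
      (𝔓.resString s B A D).ht (peak 𝔓 s B A D k) = top 𝔓 s B A D :=
  ⟨peak_mem_index hk, ht_even hk⟩

theorem exists_peak (i : {i : ℤ // i ∈ (𝔓.resString s B A D).index ∧
    (𝔓.resString s B A D).ht i = top 𝔓 s B A D}) :
    ∃ k : Fin (A.blocks.length + 1), i.1 = peak 𝔓 s B A D k := by
  obtain ⟨i, hi, ht⟩ := i
  unfold top at ht
  rcases index_cases hi with ⟨k, hk, rfl⟩ | ⟨k, hk, rfl⟩ | ⟨k, hk, rfl⟩ | ⟨k, hk, rfl⟩
  · exact ⟨⟨k, by omega⟩, rfl⟩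
  · rw [ht_odd hk] at ht; omega
  · rw [ht_neg hk] at ht; omega
  · rw [ht_pos hk] at ht; omega

open Classical in
/-- The map `g_{𝓡_C,k} ↦ (-1)ᵏ g_{C,k}`, where on the left we mean the `k`-th peak. -/
noncomputable def toN (𝔓 : Presentation R Λ Q₀ Q₁) (s : Letter Q₁ → ℤˣ) (B : Word Q₀ Q₁)
    (A : Core Q₀ Q₁) (D : Word Q₀ Q₁) :
    𝔓.StrX (𝔓.resString s B A D) (top 𝔓 s B A D) →ₗ[Λ] 𝔓.stringN A :=
  FreeOn.lift _ fun i => (-1 : ℤ) ^ ((exists_peak i).choose : ℕ) •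
    FreeOn.gen (𝔓.peakIdem A) (exists_peak i).choose

/-- The map `g_{C,k} ↦ (-1)ᵏ g_{𝓡_C,k}`, where on the right we mean the `k`-th peak. -/
noncomputable def ofN (𝔓 : Presentation R Λ Q₀ Q₁) (s : Letter Q₁ → ℤˣ) (B : Word Q₀ Q₁)
    (A : Core Q₀ Q₁) (D : Word Q₀ Q₁) :
    𝔓.stringN A →ₗ[Λ] 𝔓.StrX (𝔓.resString s B A D) (top 𝔓 s B A D) :=
  FreeOn.lift _ fun k => (-1 : ℤ) ^ (k : ℕ) •
    𝔓.strGen (𝔓.resString s B A D) (top 𝔓 s B A D) (peak 𝔓 s B A D k)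

theorem toN_strGen [Nontrivial R] (h𝔓 : 𝔓.IsCompleteGentle) (hw : 𝔓.IsStringWord s C B A D)
    (k : Fin (A.blocks.length + 1)) :
    toN 𝔓 s B A D (𝔓.strGen (𝔓.resString s B A D) (top 𝔓 s B A D) (peak 𝔓 s B A D k)) =
      (-1 : ℤ) ^ (k : ℕ) • FreeOn.gen (𝔓.peakIdem A) k := by
  rw [strGen_mem (peak_mem (Nat.lt_succ_iff.mp k.2)), toN, FreeOn.lift_gen]
  -- Distinct `k` give distinct positions, so the chosen index is the given one.
  have hk : (exists_peak (𝔓 := 𝔓) (s := s) (B := B) (A := A) (D := D)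
      ⟨peak 𝔓 s B A D k, peak_mem (Nat.lt_succ_iff.mp k.2)⟩).choose = k := by
    have h := (exists_peak (𝔓 := 𝔓) (s := s) (B := B) (A := A) (D := D)
      ⟨peak 𝔓 s B A D k, peak_mem (Nat.lt_succ_iff.mp k.2)⟩).choose_spec
    refine Fin.ext ?_
    exact_mod_cast (mul_left_cancel₀ two_ne_zero (add_left_cancel h)).symm
  rw [hk, strIdem]
  simp only
  rw [gIdem_peak h𝔓 hw (Nat.lt_succ_iff.mp k.2), smul_comm]
  congr 1
  exact FreeOn.smul_gen (e := 𝔓.peakIdem A) (fun _ => 𝔓.e_mul_self _) k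

theorem ofN_gen [Nontrivial R] (h𝔓 : 𝔓.IsCompleteGentle) (hw : 𝔓.IsStringWord s C B A D)
    (k : Fin (A.blocks.length + 1)) :
    ofN 𝔓 s B A D (FreeOn.gen (𝔓.peakIdem A) k) = (-1 : ℤ) ^ (k : ℕ) •
      𝔓.strGen (𝔓.resString s B A D) (top 𝔓 s B A D) (peak 𝔓 s B A D k) := by
  rw [ofN, FreeOn.lift_gen, smul_comm, peakIdem, ← gIdem_peak h𝔓 hw (Nat.lt_succ_iff.mp k.2),
    gIdem_smul_strGen]

theorem ofN_toN [Nontrivial R] (h𝔓 : 𝔓.IsCompleteGentle) (hw : 𝔓.IsStringWord s C B A D)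
    (x : 𝔓.StrX (𝔓.resString s B A D) (top 𝔓 s B A D)) :
    ofN 𝔓 s B A D (toN 𝔓 s B A D x) = x := by
  have : (ofN 𝔓 s B A D).comp (toN 𝔓 s B A D) = LinearMap.id := by
    refine FreeOn.hom_ext fun i => ?_
    obtain ⟨k, hk⟩ := exists_peak i
    rw [← strGen_mem i.2, hk, LinearMap.comp_apply, toN_strGen h𝔓 hw, map_zsmul, ofN_gen h𝔓 hw,
      smul_smul, ← mul_pow]
    simp
  exact LinearMap.congr_fun this x

theorem toN_ofN [Nontrivial R] (h𝔓 : 𝔓.IsCompleteGentle) (hw : 𝔓.IsStringWord s C B A D)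
    (x : 𝔓.stringN A) : toN 𝔓 s B A D (ofN 𝔓 s B A D x) = x := by
  have : (toN 𝔓 s B A D).comp (ofN 𝔓 s B A D) = LinearMap.id := by
    refine FreeOn.hom_ext fun k => ?_
    rw [LinearMap.comp_apply, ofN_gen h𝔓 hw, map_zsmul, toN_strGen h𝔓 hw, smul_smul, ← mul_pow]
    simp
  exact LinearMap.congr_fun this x

/-- The submodule `L(C)`. -/
noncomputable abbrev stringL (𝔓 : Presentation R Λ Q₀ Q₁) (s : Letter Q₁ → ℤˣ) (B : Word Q₀ Q₁)
    (A : Core Q₀ Q₁) (D : Word Q₀ Q₁) : Submodule Λ (𝔓.stringN A) :=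
  𝔓.stringLeft s B A ⊔ 𝔓.stringMiddle A ⊔ 𝔓.stringRight s A D

/-- One step below the top lie the valleys and the first positions of the two extensions. They
correspond to the generators of `stringMiddle`, `stringLeft` and `stringRight`. -/
theorem strGen_cases {m : ℤ} (hm : m + 1 = top 𝔓 s B A D) (i : {i : ℤ // i ∈ (𝔓.resString s B A D).index ∧
    (𝔓.resString s B A D).ht i = m}) :
    (∃ β, 𝔓.extLetter s B 0 = some β ∧ i.1 = 𝔓.resStringStart s B A D + -1) ∨
    (∃ k : ℕ, k < A.blocks.length ∧ i.1 = 𝔓.resStringStart s B A D + (2 * k + 1)) ∨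
    ∃ β, 𝔓.extLetter s D 0 = some β ∧
      i.1 = 𝔓.resStringStart s B A D + (2 * A.blocks.length + 1 + (0 : ℕ)) := by
  obtain ⟨i, hi, ht⟩ := i
  unfold top at hm
  rcases index_cases hi with ⟨k, hk, rfl⟩ | ⟨k, hk, rfl⟩ | ⟨k, hk, rfl⟩ | ⟨k, hk, rfl⟩
  · rw [ht_even hk] at ht; omega
  · exact Or.inr (Or.inl ⟨k, hk, rfl⟩)
  · rw [ht_neg hk] at ht
    obtain rfl : k = 0 := by omega
    obtain ⟨β, hβ⟩ := Option.isSome_iff_exists.mp hk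
    exact Or.inl ⟨β, hβ, by simp⟩
  · rw [ht_pos hk] at ht
    obtain rfl : k = 0 := by omega
    obtain ⟨β, hβ⟩ := Option.isSome_iff_exists.mp hk
    exact Or.inr (Or.inr ⟨β, hβ, rfl⟩)

section Differential

variable [Nontrivial R] {m : ℤ}

/-- The letter further to the left, if any, is inverse and leads towards this position, so it
contributes no second boundary term. -/
theorem strD_left (h𝔓 : 𝔓.IsCompleteGentle) (hw : 𝔓.IsStringWord s C B A D)
    (hm : m + 1 = top 𝔓 s B A D) {β : NPath Q₁} (hβ : 𝔓.extLetter s B 0 = some β) :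
    𝔓.strD (𝔓.resString s B A D) m (𝔓.strGen (𝔓.resString s B A D) m
      (𝔓.resStringStart s B A D + -1)) =
      𝔓.path β • 𝔓.strGen (𝔓.resString s B A D) (m + 1) (peak 𝔓 s B A D 0) := by
  unfold top at hm
  have h1 := letterAt_add (𝔓 := 𝔓) (s := s) (B := B) (A := A) (D := D) (-1) 1
  have h2 := resLetter_neg (𝔓 := 𝔓) (s := s) (B := B) (A := A) (D := D) 0
  have h3 := 𝔓.resString_letterAt s B A D (-1)
  have h4 := resLetter_neg (𝔓 := 𝔓) (s := s) (B := B) (A := A) (D := D) 1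
  rw [Nat.cast_one] at h4
  rw [Nat.cast_zero, neg_zero] at h2
  rw [neg_add_cancel, h2, hβ] at h1
  rw [h4] at h3
  have hsome : (𝔓.extLetter s B 0).isSome := by rw [hβ]; rfl
  have h5 := ht_neg (𝔓 := 𝔓) (A := A) (D := D) hsome
  rw [zero_add, Nat.cast_one] at h5
  have h6 := (Seq.mem_index_of_letterAt h1).2
  rw [add_sub_cancel_right] at h6
  rw [strD_strGen 𝔓 (hw.isGWord h𝔓), if_pos ⟨h6, by omega⟩, strBdRight_of_inv h1,
    strBdLeft_eq_zero, zero_add]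
  · congr 2
    rw [peak]
    push_cast
    ring
  · intro η h
    rw [h3] at h
    obtain ⟨_, -, h'⟩ := Option.map_eq_some_iff.mp h
    cases h'

theorem strD_right (h𝔓 : 𝔓.IsCompleteGentle) (hw : 𝔓.IsStringWord s C B A D)
    (hm : m + 1 = top 𝔓 s B A D) {β : NPath Q₁} (hβ : 𝔓.extLetter s D 0 = some β) :
    𝔓.strD (𝔓.resString s B A D) m (𝔓.strGen (𝔓.resString s B A D) m
      (𝔓.resStringStart s B A D + (2 * A.blocks.length + 1 + (0 : ℕ)))) =
      𝔓.path β • 𝔓.strGen (𝔓.resString s B A D) (m + 1) (peak 𝔓 s B A D A.blocks.length) := by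
  unfold top at hm
  have h1 := letterAt_add (𝔓 := 𝔓) (s := s) (B := B) (A := A) (D := D)
    (2 * A.blocks.length + 1 + (0 : ℕ)) 1
  have h2 := resLetter_pos (𝔓 := 𝔓) (s := s) (B := B) (A := A) (D := D) 1
  have h3 := 𝔓.resString_letterAt s B A D (2 * A.blocks.length + 1 + (0 : ℕ))
  rw [show (2 : ℤ) * A.blocks.length + 1 + (0 : ℕ) + 1 = 2 * A.blocks.length + 1 + (1 : ℕ) by
    push_cast; ring, h2] at h1
  rw [resLetter_pos, hβ] at h3
  have hsome : (𝔓.extLetter s D 0).isSome := by rw [hβ]; rfl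
  have h5 := ht_pos (𝔓 := 𝔓) (B := B) (A := A) hsome
  have h6 := (Seq.mem_index_of_letterAt h3).1
  rw [strD_strGen 𝔓 (hw.isGWord h𝔓), if_pos ⟨h6, by omega⟩, strBdLeft_of_dir h3,
    strBdRight_eq_zero, add_zero]
  · congr 2
    rw [peak]
    push_cast
    ring
  · intro η h
    rw [h1] at h
    obtain ⟨_, -, h'⟩ := Option.map_eq_some_iff.mp h
    cases h'

theorem strD_middle (h𝔓 : 𝔓.IsCompleteGentle) (hw : 𝔓.IsStringWord s C B A D)
    (hm : m + 1 = top 𝔓 s B A D) {k : ℕ} (hk : k < A.blocks.length) :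
    𝔓.strD (𝔓.resString s B A D) m (𝔓.strGen (𝔓.resString s B A D) m
      (𝔓.resStringStart s B A D + (2 * k + 1))) =
      𝔓.path A.blocks[k].1 • 𝔓.strGen (𝔓.resString s B A D) (m + 1) (peak 𝔓 s B A D k) +
        𝔓.path A.blocks[k].2 •
          𝔓.strGen (𝔓.resString s B A D) (m + 1) (peak 𝔓 s B A D (k + 1)) := by
  unfold top at hm
  have h1 := letterAt_add (𝔓 := 𝔓) (s := s) (B := B) (A := A) (D := D) (2 * k + 1) 1
  have h3 := 𝔓.resString_letterAt s B A D (2 * k + 1)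
  rw [show (2 : ℤ) * k + 1 + 1 = 2 * k + 2 by ring, resLetter_inv hk] at h1
  rw [resLetter_dir hk] at h3
  have h5 := ht_odd (𝔓 := 𝔓) (s := s) (B := B) (D := D) hk
  have h6 := (Seq.mem_index_of_letterAt h3).1
  rw [strD_strGen 𝔓 (hw.isGWord h𝔓), if_pos ⟨h6, by omega⟩, strBdLeft_of_dir h3,
    strBdRight_of_inv h1]
  congr 3
  · rw [peak]; ring
  · rw [peak]; push_cast; ring

/-- The composition `P^{t-1}(𝓡_C) → P^t(𝓡_C) → N(C)` has values in `L(C)`. -/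
theorem toN_strD_mem (h𝔓 : 𝔓.IsCompleteGentle) (hw : 𝔓.IsStringWord s C B A D)
    (f : 𝔓.StrX (𝔓.resString s B A D) (m + 1) →ₗ[Λ] 𝔓.stringN A) (hm : m + 1 = top 𝔓 s B A D)
    (hf : ∀ k : Fin (A.blocks.length + 1),
      f (𝔓.strGen (𝔓.resString s B A D) (m + 1) (peak 𝔓 s B A D k)) =
        (-1 : ℤ) ^ (k : ℕ) • FreeOn.gen (𝔓.peakIdem A) k)
    (x : 𝔓.StrX (𝔓.resString s B A D) m) :
    f (𝔓.strD (𝔓.resString s B A D) m x) ∈ stringL 𝔓 s B A D := by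
  have : (Submodule.mkQ (stringL 𝔓 s B A D)).comp (f.comp (𝔓.strD (𝔓.resString s B A D) m)) = 0 := by
    refine FreeOn.hom_ext fun i => ?_
    rw [LinearMap.comp_apply, LinearMap.comp_apply, LinearMap.zero_apply, Submodule.mkQ_apply,
      Submodule.Quotient.mk_eq_zero, ← strGen_mem i.2]
    rcases strGen_cases hm i with ⟨β, hβ, hi⟩ | ⟨k, hk, hi⟩ | ⟨β, hβ, hi⟩
    · rw [hi, strD_left h𝔓 hw hm hβ, map_smul]
      have h0 := hf 0
      rw [Fin.val_zero] at h0
      rw [h0, pow_zero, one_smul]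
      refine Submodule.mem_sup_left (Submodule.mem_sup_left (Submodule.subset_span ?_))
      obtain ⟨b, hb, rfl⟩ := extLetter_zero hβ
      exact ⟨b, hb, rfl⟩
    · rw [hi, strD_middle h𝔓 hw hm hk, map_add, map_smul, map_smul]
      have h0 := hf (Fin.castSucc ⟨k, hk⟩)
      have h1 := hf (Fin.succ ⟨k, hk⟩)
      rw [Fin.val_castSucc] at h0
      rw [Fin.val_succ] at h1
      simp only at h0 h1
      rw [h0, h1]
      have h2 : (𝔓.path A.blocks[k].1 • FreeOn.gen (𝔓.peakIdem A) (Fin.castSucc ⟨k, hk⟩) -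
        𝔓.path A.blocks[k].2 • FreeOn.gen (𝔓.peakIdem A) (Fin.succ ⟨k, hk⟩)) ∈
          𝔓.stringMiddle A := Submodule.subset_span ⟨⟨k, hk⟩, rfl⟩
      -- The signs of neighbouring peaks are `(-1)ᵏ` and `(-1)ᵏ⁺¹`, so the sum in the boundary
      -- becomes `(-1)ᵏ` times the difference in the relation.
      have h3 := zsmul_mem h2 ((-1 : ℤ) ^ k)
      refine Submodule.mem_sup_left (Submodule.mem_sup_right ?_)
      convert! h3 using 1
      rw [smul_sub, pow_succ, mul_neg_one, neg_smul, smul_neg, ← sub_eq_add_neg,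
        smul_comm _ ((-1 : ℤ) ^ k), smul_comm _ ((-1 : ℤ) ^ k)]
    · rw [hi, strD_right h𝔓 hw hm hβ, map_smul]
      have h0 := hf (Fin.last _)
      rw [Fin.val_last] at h0
      rw [h0, smul_comm]
      refine Submodule.mem_sup_right (zsmul_mem (Submodule.subset_span ?_) _)
      obtain ⟨b, hb, rfl⟩ := extLetter_zero hβ
      exact ⟨b, hb, rfl⟩
  have h := LinearMap.congr_fun this x
  rwa [LinearMap.comp_apply, LinearMap.zero_apply, Submodule.mkQ_apply,
    Submodule.Quotient.mk_eq_zero] at h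

/-- The preimage of `L(C)` in `P^t(𝓡_C)` consists of boundaries. -/
theorem ofN_mem_range (h𝔓 : 𝔓.IsCompleteGentle) (hs : 𝔓.IsSign s) (hw : 𝔓.IsStringWord s C B A D)
    (f : 𝔓.stringN A →ₗ[Λ] 𝔓.StrX (𝔓.resString s B A D) (m + 1)) (hm : m + 1 = top 𝔓 s B A D)
    (hf : ∀ k : Fin (A.blocks.length + 1), f (FreeOn.gen (𝔓.peakIdem A) k) = (-1 : ℤ) ^ (k : ℕ) •
      𝔓.strGen (𝔓.resString s B A D) (m + 1) (peak 𝔓 s B A D k))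
    {y : 𝔓.stringN A} (hy : y ∈ stringL 𝔓 s B A D) :
    f y ∈ LinearMap.range (𝔓.strD (𝔓.resString s B A D) m) := by
  have : stringL 𝔓 s B A D ≤
      (LinearMap.range (𝔓.strD (𝔓.resString s B A D) m)).comap f := by
    refine sup_le (sup_le ?_ ?_) ?_
    · refine Submodule.span_le.mpr ?_
      rintro _ ⟨b, hb, rfl⟩
      obtain ⟨v, hv⟩ := hw.head_left
      have hβ := extLetter_eq h𝔓 hs hw.inverse_left hv hb 0
      have h0 := hf 0
      rw [Fin.val_zero, pow_zero, one_smul] at h0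
      refine ⟨_, (strD_left h𝔓 hw hm hβ).trans ?_⟩
      rw [map_smul, h0]
    · refine Submodule.span_le.mpr ?_
      rintro _ ⟨⟨k, hk⟩, rfl⟩
      have h0 := hf (Fin.castSucc ⟨k, hk⟩)
      have h1 := hf (Fin.succ ⟨k, hk⟩)
      rw [Fin.val_castSucc] at h0
      rw [Fin.val_succ] at h1
      simp only at h0 h1
      -- The `k`-th valley has the relation as its boundary, up to the sign of the peak on its left.
      refine ⟨(-1 : ℤ) ^ k • 𝔓.strGen (𝔓.resString s B A D) m
        (𝔓.resStringStart s B A D + (2 * k + 1)), ?_⟩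
      rw [map_zsmul, strD_middle h𝔓 hw hm hk, map_sub, map_smul, map_smul, h0, h1, pow_succ,
        mul_neg_one, neg_smul, smul_neg, sub_neg_eq_add, smul_add,
        smul_comm _ ((-1 : ℤ) ^ k), smul_comm _ ((-1 : ℤ) ^ k)]
      rfl
    · refine Submodule.span_le.mpr ?_
      rintro _ ⟨b, hb, rfl⟩
      obtain ⟨v, hv⟩ := hw.head_right
      have hβ := extLetter_eq h𝔓 hs hw.inverse_right hv hb 0
      have h0 := hf (Fin.last _)
      rw [Fin.val_last] at h0
      refine ⟨(-1 : ℤ) ^ A.blocks.length • 𝔓.strGen (𝔓.resString s B A D) m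
        (𝔓.resStringStart s B A D + (2 * A.blocks.length + 1 + (0 : ℕ))), ?_⟩
      rw [map_zsmul, strD_right h𝔓 hw hm hβ, map_smul, h0, smul_comm]
  exact this hy

end Differential

end Augmentation

/-- The string complex of `𝓡_C` is, up to a shift, a projective resolution of the string module. -/
theorem isProjectiveResolution {R Λ : Type u} [CommRing R] [IsLocalRing R] [IsNoetherianRing R]
    [Ring Λ] [Algebra R Λ] {Q₀ Q₁ : Type*} [Fintype Q₀] {𝔓 : Presentation R Λ Q₀ Q₁}
    (h𝔓 : 𝔓.IsCompleteGentle) {s : Letter Q₁ → ℤˣ} (hs : 𝔓.IsSign s) {C B : Word Q₀ Q₁}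
    {A : Core Q₀ Q₁} {D : Word Q₀ Q₁} (hw : 𝔓.IsStringWord s C B A D) :
    IsProjectiveResolution
      ((shiftFunctor (CochainComplex (ModuleCat.{u} Λ) ℤ)
        ((𝔓.resString s B A D).ht (𝔓.resStringStart s B A D))).obj
          (stringComplex 𝔓 (𝔓.resString s B A D) (hw.isGWord h𝔓)))
      (ModuleCat.of Λ (𝔓.StringModule s B A D)) := by
  have h𝒞 := hw.isGWord h𝔓
  refine isProjectiveResolution_shift _ _ _ (fun n => ?_) (fun n hn => ?_) (fun n hn => ?_)
    (ModuleCat.ofHom ((Submodule.mkQ (stringL 𝔓 s B A D)).comp (toN 𝔓 s B A D))) ?_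
    (top 𝔓 s B A D - 1) (sub_add_cancel _ _) ?_
  · exact FreeOn.projective (e := 𝔓.strIdem (𝔓.resString s B A D) n)
      fun i => 𝔓.gIdem_mul_self _ _
  · change Subsingleton (𝔓.StrX (𝔓.resString s B A D) n)
    refine ⟨fun x y => FreeOn.ext_coord fun i => ?_⟩
    have := ht_le i.2.1
    have := i.2.2
    omega
  · have h1 : ∀ j, (stringComplex 𝔓 (𝔓.resString s B A D) (hw.isGWord h𝔓)).d j (j + 1) =
        ModuleCat.ofHom (𝔓.strD (𝔓.resString s B A D) j) := stringComplex_d 𝔓 _ _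
    rw [h1, h1]
    exact strD_exact h𝔓 h𝒞 n fun i hi ht => locallyExact hi (by omega)
  · exact (Submodule.mkQ_surjective _).comp fun y => ⟨_, toN_ofN h𝔓 hw y⟩
  -- The module in each degree depends on the degree as a term, so the claim is generalised to a
  -- variable `t` for which `m + 1` can be substituted.
  · have key : ∀ (t m : ℤ) (hmt : m + 1 = t) (ht : t = top 𝔓 s B A D)
      (f : 𝔓.StrX (𝔓.resString s B A D) t →ₗ[Λ] 𝔓.stringN A)
      (g : 𝔓.stringN A →ₗ[Λ] 𝔓.StrX (𝔓.resString s B A D) t)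
      (hgf : ∀ x, g (f x) = x)
      (hf : ∀ k : Fin (A.blocks.length + 1),
        f (𝔓.strGen (𝔓.resString s B A D) t (peak 𝔓 s B A D k)) =
          (-1 : ℤ) ^ (k : ℕ) • FreeOn.gen (𝔓.peakIdem A) k)
      (hg : ∀ k : Fin (A.blocks.length + 1), g (FreeOn.gen (𝔓.peakIdem A) k) =
        (-1 : ℤ) ^ (k : ℕ) • 𝔓.strGen (𝔓.resString s B A D) t (peak 𝔓 s B A D k)),
      Function.Exact ((stringComplex 𝔓 (𝔓.resString s B A D) (hw.isGWord h𝔓)).d m t)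
        ((Submodule.mkQ (stringL 𝔓 s B A D)).comp f) := by
      rintro t m rfl ht f g hgf hf hg
      have hd : (stringComplex 𝔓 (𝔓.resString s B A D) (hw.isGWord h𝔓)).d m (m + 1) =
        ModuleCat.ofHom (𝔓.strD (𝔓.resString s B A D) m) := stringComplex_d 𝔓 _ _ m
      rw [hd]
      intro x
      change Submodule.mkQ _ (f x) = 0 ↔ x ∈ LinearMap.range (𝔓.strD (𝔓.resString s B A D) m)
      rw [Submodule.mkQ_apply, Submodule.Quotient.mk_eq_zero]
      constructor
      · intro hx
        have := ofN_mem_range h𝔓 hs hw g ht hg hx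
        have h2 : g (f x) = x := hgf x
        rwa [h2] at this
      · rintro ⟨y, rfl⟩
        exact toN_strD_mem h𝔓 hw f ht hf y
    exact key _ _ (sub_add_cancel _ _) rfl (toN 𝔓 s B A D) (ofN 𝔓 s B A D) (ofN_toN h𝔓 hw)
      (toN_strGen h𝔓 hw) (ofN_gen h𝔓 hw)

end IsStringWord

end Presentation

end Gentle

/-! ### Band words: `𝓡_C` is a generalised word of period `2n`. -/

namespace Gentle

section Blocks

variable {Q₁ : Type*} {bs : List (NPath Q₁ × NPath Q₁)} (h : bs ≠ [])

theorem getElem?_emod_eq_blockAt (i : ℤ) :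
    bs[(i % (bs.length : ℤ)).toNat]? = some (blockAt bs h i) :=
  List.getElem?_eq_getElem _

theorem getElem?_eq_blockAt {k : ℕ} (hk : k < bs.length) : bs[k]? = some (blockAt bs h k) := by
  rw [← getElem?_emod_eq_blockAt h, Int.emod_eq_of_lt (by omega) (by omega), Int.toNat_natCast]

theorem blockAt_mem (i : ℤ) : blockAt bs h i ∈ bs := List.getElem_mem _

theorem blockAt_emod (i : ℤ) : blockAt bs h (i % bs.length) = blockAt bs h i := by
  have h1 := getElem?_emod_eq_blockAt h i
  rw [← Int.emod_emod, getElem?_emod_eq_blockAt h] at h1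
  exact Option.some.inj h1

theorem getElem?_append_self {k : ℕ} (hk : k < bs.length + bs.length) :
    (bs ++ bs)[k]? = some (blockAt bs h k) := by
  rcases lt_or_ge k bs.length with h1 | h1
  · rw [List.getElem?_append_left h1, getElem?_eq_blockAt h h1]
  · rw [List.getElem?_append_right h1, getElem?_eq_blockAt h (by omega), Nat.cast_sub h1,
      blockAt_sub]

theorem periodic_blockGLetters_dir (i : ℤ) :
    Seq.periodic (blockGLetters bs) (blockGLetters_ne_nil h) (2 * i + 1) =
      .dir (blockAt bs h i).1 := by
  have hn : (0 : ℤ) < bs.length := by exact_mod_cast List.length_pos_iff.mpr h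
  have h1 := Int.emod_nonneg i hn.ne'
  refine Option.some.inj ?_
  rw [Seq.periodic, ← List.getElem?_eq_getElem, length_blockGLetters, add_sub_cancel_right]
  push_cast
  rw [Int.mul_emod_mul_of_pos _ _ two_pos,
    show (2 * (i % (bs.length : ℤ))).toNat = 2 * (i % (bs.length : ℤ)).toNat by omega,
    (blockGLetters_getElem? _ _).1, getElem?_emod_eq_blockAt h]
  rfl

theorem periodic_blockGLetters_inv (i : ℤ) :
    Seq.periodic (blockGLetters bs) (blockGLetters_ne_nil h) (2 * i + 2) =
      .inv (blockAt bs h i).2 := by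
  have hn : (0 : ℤ) < bs.length := by exact_mod_cast List.length_pos_iff.mpr h
  have h1 := Int.emod_nonneg i hn.ne'
  have h2 := Int.emod_lt_of_pos i hn
  refine Option.some.inj ?_
  rw [Seq.periodic, ← List.getElem?_eq_getElem, length_blockGLetters]
  have h3 : (2 * i + 2 - 1) % ((2 * bs.length : ℕ) : ℤ) = 2 * (i % (bs.length : ℤ)) + 1 := by
    have h4 : 2 * i + 2 - 1 = 2 * (i % (bs.length : ℤ)) + 1 +
        ((2 * bs.length : ℕ) : ℤ) * (i / bs.length) := by
      have := Int.emod_add_mul_ediv i bs.length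
      push_cast
      linear_combination (-2 : ℤ) * this
    rw [h4, Int.add_mul_emod_self_left, Int.emod_eq_of_lt (by omega) (by push_cast; omega)]
  rw [h3, show (2 * (i % (bs.length : ℤ)) + 1).toNat = 2 * (i % (bs.length : ℤ)).toNat + 1 by omega,
    (blockGLetters_getElem? _ _).2, getElem?_emod_eq_blockAt h]
  rfl

/-- A list with period `g` dividing its length is a power of its initial segment of length `g`. -/
theorem take_mul_eq_flatten_replicate {α : Type*} {l : List α} {g : ℕ}
    (hg : ∀ k, k + g < l.length → l[k + g]? = l[k]?) (j : ℕ) (hj : g * j ≤ l.length) :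
    l.take (g * j) = (List.replicate j (l.take g)).flatten := by
  have hper : ∀ (j k : ℕ), k + g * j < l.length → l[k + g * j]? = l[k]? := by
    intro j
    induction j with
    | zero => simp
    | succ j ih =>
      intro k hk
      rw [mul_add, mul_one, ← add_assoc] at hk ⊢
      rw [hg _ hk, ih k (by omega)]
  induction j with
  | zero => simp
  | succ j ih =>
    rw [mul_add, mul_one] at hj ⊢
    rw [List.replicate_succ', List.flatten_append, ← ih (by omega), List.take_add]
    congr 1
    simp only [List.flatten_cons, List.flatten_nil, List.append_nil]
    refine List.ext_getElem? fun k => ?_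
    by_cases hk : k < g
    · rw [List.getElem?_take_of_lt hk, List.getElem?_take_of_lt hk, List.getElem?_drop, add_comm,
        hper j k (by omega)]
    · rw [List.getElem?_take_eq_none (by omega), List.getElem?_take_eq_none (by omega)]

theorem blockLetters_flatten_replicate (k : ℕ) :
    blockLetters (List.replicate k bs).flatten =
      (List.replicate k (blockLetters bs)).flatten := by
  induction k with
  | zero => rfl
  | succ k ih =>
    rw [List.replicate_succ, List.replicate_succ, List.flatten_cons, List.flatten_cons, ← ih,
      blockLetters, List.flatMap_append]
    rfl

variable (Q₀ : Type*)

/-- The generalised word `𝓡_C`. -/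
abbrev resBand (bs : List (NPath Q₁ × NPath Q₁)) (h : bs ≠ []) : GWord Q₀ Q₁ :=
  .bi (Seq.periodic (blockGLetters bs) (blockGLetters_ne_nil h))

theorem resBand_letterAt_dir (h : bs ≠ []) (i : ℤ) :
    (resBand (Q₀ := Q₀) bs h).letterAt (2 * i + 1) = some (.dir (blockAt bs h i).1) :=
  congrArg some (periodic_blockGLetters_dir h i)

theorem resBand_letterAt_inv (h : bs ≠ []) (i : ℤ) :
    (resBand (Q₀ := Q₀) bs h).letterAt (2 * i + 2) = some (.inv (blockAt bs h i).2) :=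
  congrArg some (periodic_blockGLetters_inv h i)

/-- Direct and inverse letters alternate, so their degrees cancel in pairs. The complex therefore
lives in degrees `0` and `-1` only. -/
theorem resBand_ht_even (h : bs ≠ []) (i : ℤ) : (resBand (Q₀ := Q₀) bs h).ht (2 * i) = 0 := by
  have step : ∀ i : ℤ, (resBand (Q₀ := Q₀) bs h).ht (2 * (i + 1)) =
      (resBand (Q₀ := Q₀) bs h).ht (2 * i) := by
    intro i
    have h1 := Seq.ht_of_dir (resBand_letterAt_dir Q₀ h i)
    have h2 := Seq.ht_of_inv (i := 2 * i + 1) (by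
      rw [add_assoc]
      exact resBand_letterAt_inv Q₀ h i)
    rw [add_sub_cancel_right] at h1
    rw [h1, ← h2]
    congr 1
    ring
  induction i using Int.induction_on with
  | zero => simp [Seq.ht]
  | succ n ih => rw [step, ih]
  | pred n ih => rw [← ih, ← step, sub_add_cancel]

theorem resBand_ht_odd (h : bs ≠ []) (i : ℤ) : (resBand (Q₀ := Q₀) bs h).ht (2 * i + 1) = -1 := by
  have h1 := Seq.ht_of_dir (resBand_letterAt_dir Q₀ h i)
  rw [add_sub_cancel_right, resBand_ht_even] at h1
  omega

theorem eq_two_mul_of_ht {Q₀ : Type*} {h : bs ≠ []} {i : ℤ} (hi : (resBand Q₀ bs h).ht i = 0) : ∃ k, i = 2 * k := by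
  rcases Int.even_or_odd' i with ⟨k, rfl | rfl⟩
  · exact ⟨k, rfl⟩
  · exact absurd ((resBand_ht_odd Q₀ h k).symm.trans hi) (by decide)

theorem eq_two_mul_add_one_of_ht {Q₀ : Type*} {h : bs ≠ []} {i : ℤ} (hi : (resBand Q₀ bs h).ht i = -1) :
    ∃ k, i = 2 * k + 1 := by
  rcases Int.even_or_odd' i with ⟨k, rfl | rfl⟩
  · exact absurd ((resBand_ht_even Q₀ h k).symm.trans hi) (by decide)
  · exact ⟨k, rfl⟩

end Blocks

namespace Presentation

variable {R Λ : Type*} [CommRing R] [Ring Λ] [Algebra R Λ] {Q₀ Q₁ : Type*} [Fintype Q₀]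
variable {𝔓 : Presentation R Λ Q₀ Q₁}

theorem IsWord.of_append {a b : List (Letter Q₁)} {ha : a ≠ []} {hab : a ++ b ≠ []}
    (h : 𝔓.IsWord (Seq.fin (Q₀ := Q₀) (a ++ b) hab)) : 𝔓.IsWord (Seq.fin (Q₀ := Q₀) a ha) := by
  have key : ∀ (i : ℤ) (l : Letter Q₁), (Seq.fin (Q₀ := Q₀) a ha).letterAt i = some l →
      (Seq.fin (Q₀ := Q₀) (a ++ b) hab).letterAt i = some l := by
    intro i l hl
    simp only [Seq.letterAt] at hl ⊢
    split_ifs at hl ⊢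
    have := (List.getElem?_eq_some_iff.mp hl).1
    rw [List.getElem?_append_left this, hl]
  exact ⟨fun i l l' h1 h2 => h.adjacent i l l' (key _ _ h1) (key _ _ h2),
    fun i γ h1 => h.path_mem i γ fun j hj => key _ _ (h1 j hj),
    fun i γ h1 => h.path_inv_mem i γ fun j hj => key _ _ (h1 j hj)⟩

namespace IsBandWord

variable {C : Word Q₀ Q₁} {bs : List (NPath Q₁ × NPath Q₁)} {h : bs ≠ []}

/-- That `A²` is a word gives the condition also where the last block of `A` meets the first one. -/
theorem blockAdj (hw : 𝔓.IsBandWord C bs h) (i : ℤ) :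
    𝔓.BlockAdj (blockAt bs h i) (blockAt bs h (i + 1)) := by
  have hn : (0 : ℤ) < bs.length := by exact_mod_cast List.length_pos_iff.mpr h
  have h1 := Int.emod_nonneg i hn.ne'
  have h2 := Int.emod_lt_of_pos i hn
  have hch : (blockLetters (bs ++ bs)).IsChain 𝔓.LAdj := by
    have := isChain_of_isWord hw.cyclic.1
    rwa [blockLetters, List.flatMap_append]
  have h3 := List.isChain_iff_getElem.mp (blocks_of_isChain hch).1 (i % (bs.length : ℤ)).toNat
    (by rw [List.length_append]; omega)
  have h4 := getElem?_append_self h (k := (i % (bs.length : ℤ)).toNat) (by omega)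
  have h5 := getElem?_append_self h (k := (i % (bs.length : ℤ)).toNat + 1) (by omega)
  rw [List.getElem?_eq_getElem (by rw [List.length_append]; omega)] at h4 h5
  rw [Option.some.inj h4, Option.some.inj h5] at h3
  push_cast at h3
  rwa [Int.toNat_of_nonneg h1, blockAt_emod, ← blockAt_emod h (i % _ + 1), Int.emod_add_emod,
    blockAt_emod] at h3

theorem blockAt_head (hw : 𝔓.IsBandWord C bs h) (i : ℤ) :
    𝔓.Q.phead (blockAt bs h i).1 = 𝔓.Q.phead (blockAt bs h i).2 ∧
      (blockAt bs h i).1.last ≠ (blockAt bs h i).2.last := by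
  have hch : (blockLetters bs).IsChain 𝔓.LAdj :=
    (List.isChain_append.mp (isChain_of_isWord hw.cyclic.1)).1
  exact (blocks_of_isChain hch).2 _ (blockAt_mem h i)

theorem isGWord (hw : 𝔓.IsBandWord C bs h) : 𝔓.IsGWord (resBand Q₀ bs h) := by
  have hcases : ∀ i : ℤ, (∃ k, i = 2 * k + 1) ∨ ∃ k, i = 2 * k + 2 := fun i => by
    rcases Int.even_or_odd' i with ⟨k, rfl | rfl⟩
    · exact Or.inr ⟨k - 1, by ring⟩
    · exact Or.inl ⟨k, rfl⟩
  refine ⟨fun i l hl => ?_, fun i l l' hl hl' => ?_⟩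
  · rcases hcases i with ⟨k, rfl⟩ | ⟨k, rfl⟩
    · rw [resBand_letterAt_dir, Option.some.injEq] at hl
      subst hl
      exact (hw.blocks_mem _ (blockAt_mem h k)).1
    · rw [resBand_letterAt_inv, Option.some.injEq] at hl
      subst hl
      exact (hw.blocks_mem _ (blockAt_mem h k)).2
  · rcases hcases i with ⟨k, rfl⟩ | ⟨k, rfl⟩
    · rw [resBand_letterAt_dir, Option.some.injEq] at hl
      rw [show 2 * k + 1 + 1 = 2 * k + 2 by ring, resBand_letterAt_inv, Option.some.injEq] at hl'
      subst hl hl'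
      exact hw.blockAt_head k
    · rw [resBand_letterAt_inv, Option.some.injEq] at hl
      rw [show 2 * k + 2 + 1 = 2 * (k + 1) + 1 by ring, resBand_letterAt_dir, Option.some.injEq] at hl'
      subst hl hl'
      exact hw.blockAdj k

/-- A smaller period would make the list of blocks periodic modulo a proper divisor of `n`, and `A`
would be a proper power. -/
theorem isPeriod (hw : 𝔓.IsBandWord C bs h) : IsPeriod Q₀
    (Seq.periodic (blockGLetters bs) (blockGLetters_ne_nil h)) (2 * bs.length) := by
  have hn := List.length_pos_iff.mpr h
  refine ⟨by omega, fun i => ?_, resBand_ht_even Q₀ h _, fun q hq hper hht => ?_⟩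
  · have h1 : i + 2 * bs.length - 1 = i - 1 + (blockGLetters bs).length := by
      rw [length_blockGLetters]; push_cast; ring
    simp only [Seq.periodic, h1, Int.add_emod_right]
  · by_contra! hlt
    -- Odd positions have height `-1`, so `q` is even and moves blocks to blocks.
    obtain ⟨m, rfl⟩ : ∃ m, q = 2 * m := by
      rcases Int.even_or_odd' q with ⟨k, rfl | rfl⟩
      · exact ⟨k, rfl⟩
      · exact absurd ((resBand_ht_odd Q₀ h k).symm.trans hht) (by decide)
    have hm : Function.Periodic (blockAt bs h) m := fun i => by
      have h1 := hper (2 * i + 1)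
      have h2 := hper (2 * i + 2)
      rw [show 2 * i + 1 + 2 * m = 2 * (i + m) + 1 by ring, periodic_blockGLetters_dir h,
        periodic_blockGLetters_dir h] at h1
      rw [show 2 * i + 2 + 2 * m = 2 * (i + m) + 2 by ring, periodic_blockGLetters_inv h,
        periodic_blockGLetters_inv h] at h2
      exact Prod.ext (Letter.dir.inj h1) (Letter.inv.inj h2)
    -- By Bézout, the greatest common divisor of the periods `m` and `n` is again a period.
    have hg : Function.Periodic (blockAt bs h) (Int.gcd m bs.length) := by
      rw [Int.gcd_eq_gcd_ab, mul_comm m, mul_comm (bs.length : ℤ)]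
      exact (hm.int_mul _).add_period (Function.Periodic.int_mul (blockAt_add bs h) _)
    obtain ⟨k, hk⟩ : Int.gcd m bs.length ∣ bs.length :=
      Int.natCast_dvd_natCast.mp (Int.gcd_dvd_right _ _)
    have hgm : (Int.gcd m bs.length : ℤ) ≤ m := Int.le_of_dvd (by omega) (Int.gcd_dvd_left _ _)
    generalize Int.gcd m bs.length = g at hg hk hgm
    -- Here `n = gk` with `g ≤ m < n` and `n > 0`, which excludes `k = 0` and `k = 1`.
    have hk2 : 2 ≤ k := by
      by_contra! hk2
      interval_cases k
      · rw [mul_zero] at hk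
        omega
      · rw [mul_one] at hk
        omega
    have hbs : bs = (List.replicate k (bs.take g)).flatten := by
      rw [← take_mul_eq_flatten_replicate _ k hk.ge, ← hk, List.take_length]
      intro j hj
      rw [getElem?_eq_blockAt h hj, getElem?_eq_blockAt h (by omega), Nat.cast_add, hg]
    have hne : bs.take g ≠ [] := by
      intro h0
      rw [h0] at hbs
      exact h (hbs.trans (by simp))
    have hletters : blockLetters bs =
        (List.replicate k (blockLetters (bs.take g))).flatten := by
      conv_lhs => rw [hbs]
      rw [blockLetters_flatten_replicate]
    refine hw.cyclic.2 ⟨_, blockLetters_ne_nil hne, k, ?_, hk2, hletters⟩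
    -- The root of the power is an initial segment of `A²`, hence itself a word.
    obtain ⟨k, rfl⟩ := Nat.exists_eq_add_of_le' (show 1 ≤ k by omega)
    have h1 := hw.cyclic.1
    simp only [hletters, List.replicate_succ, List.flatten_cons, List.append_assoc] at h1
    exact h1.of_append

end IsBandWord

end Presentation

end Gentle

/-! ### Maps out of tensor products over `R[T;T⁻¹]`. -/

namespace Gentle

namespace FreeOn

variable {Λ : Type*} [Ring Λ] {ι : Type*} (e : ι → Λ) {X : Type*} [AddCommGroup X] [Module Λ X]

/-- `FreeOn.lift` as an additive function of the images of the generators. -/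
noncomputable def liftHom : (ι → X) →+ FreeOn e →ₗ[Λ] X where
  toFun := lift e
  map_zero' := hom_ext fun i => by simp [lift_gen]
  map_add' y y' := hom_ext fun i => by simp [lift_gen]

end FreeOn

section LaurentLift

variable {R Λ : Type*} [CommRing R] [Ring Λ] [Algebra R Λ] {X Y Z : Type*} [AddCommGroup X]
  [Module Λ X] [AddCommGroup Y] [Module Λ Y] [AddCommGroup Z] [Module Λ Z] (τ : X ≃ₗ[Λ] X)
  (τ' : Y ≃ₗ[Λ] Y) {W : Type*} [AddCommGroup W] [Module R[T;T⁻¹] W]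

/-- The map `x ↦ x ⊗ w`. -/
noncomputable def laurentMk : W →+ X →ₗ[Λ] (Laurent R τ ⊗[R[T;T⁻¹]] W) where
  toFun w :=
    { toFun := fun x => (show Laurent R τ from x) ⊗ₜ w
      map_add' := fun x y => TensorProduct.add_tmul (R := R[T;T⁻¹]) (M := Laurent R τ) x y w
      map_smul' := fun _ _ => rfl }
  map_zero' := LinearMap.ext fun x => TensorProduct.tmul_zero W (show Laurent R τ from x)
  map_add' w w' := LinearMap.ext fun x => TensorProduct.tmul_add (show Laurent R τ from x) w w'

theorem laurentMk_smul (a : R[T;T⁻¹]) (w : W) (x : X) :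
    laurentMk τ (a • w) x = laurentMk (R := R) τ w (laurentEnd R τ a x) :=
  (TensorProduct.smul_tmul a (show Laurent R τ from x) w).symm

theorem laurentMk_T_smul (w : W) (x : X) :
    laurentMk τ ((LaurentPolynomial.T 1 : R[T;T⁻¹]) • w) x = laurentMk (R := R) τ w (τ x) := by
  rw [laurentMk_smul, laurentEnd_T]

theorem laurentMap_mk (f : X →ₗ[Λ] Y) (hf : ∀ x, f (τ x) = τ' (f x)) (w : W) (x : X) :
    laurentMap (R := R) τ τ' W f hf (laurentMk τ w x) = laurentMk τ' w (f x) := rfl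

variable {τ}

theorem laurent_induction {P : (Laurent R τ ⊗[R[T;T⁻¹]] W) → Prop}
    (hmk : ∀ w x, P (laurentMk τ w x)) (hadd : ∀ y z, P y → P z → P (y + z))
    (z : Laurent R τ ⊗[R[T;T⁻¹]] W) : P z := by
  induction z using TensorProduct.induction_on with
  | zero => simpa using hmk 0 0
  | tmul x w => exact hmk w x
  | add y z hy hz => exact hadd y z hy hz

theorem laurent_hom_ext {f g : (Laurent R τ ⊗[R[T;T⁻¹]] W) →ₗ[Λ] Z}
    (h : ∀ w, f.comp (laurentMk τ w) = g.comp (laurentMk τ w)) : f = g := by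
  refine LinearMap.ext fun z => ?_
  induction z using laurent_induction with
  | hmk w x => exact LinearMap.congr_fun (h w) x
  | hadd y z hy hz => rw [map_add, map_add, hy, hz]

variable (τ)

/-- It suffices to compare the actions of the scalars and of `T`. The case of `T⁻¹` follows because
`T` acts invertibly on both sides, and these elements generate the ring. -/
theorem laurent_balanced (F : W →+ X →ₗ[Λ] Z)
    (hC : ∀ (r : R) (w : W) (x : X),
      F ((LaurentPolynomial.C r : R[T;T⁻¹]) • w) x = algebraMap R Λ r • F w x)
    (hT : ∀ (w : W) (x : X), F ((LaurentPolynomial.T 1 : R[T;T⁻¹]) • w) x = F w (τ x))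
    (a : R[T;T⁻¹]) (w : W) (x : X) : F (a • w) x = F w (laurentEnd R τ a x) := by
  have hTneg : ∀ (w : W) (x : X),
      F ((LaurentPolynomial.T (-1) : R[T;T⁻¹]) • w) x =
        F w (laurentEnd R τ (LaurentPolynomial.T (-1)) x) := by
    intro w x
    have h1 : τ (laurentEnd R τ (LaurentPolynomial.T (-1)) x) = x := by
      rw [← laurentEnd_T R τ, ← Module.End.mul_apply, ← map_mul, ← LaurentPolynomial.T_add]
      simp
    conv_lhs => rw [← h1, ← hT, smul_smul, ← LaurentPolynomial.T_add]
    simp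
  have hTn : ∀ (n : ℤ) (w : W) (x : X), F ((LaurentPolynomial.T n : R[T;T⁻¹]) • w) x =
      F w (laurentEnd R τ (LaurentPolynomial.T n) x) := by
    intro n
    induction n using Int.induction_on with
    | zero => intro w x; simp
    | succ n ih =>
      intro w x
      rw [LaurentPolynomial.T_add, mul_smul, ih, hT, map_mul, ← laurentEnd_T R τ,
        ← Module.End.mul_apply, ← map_mul, ← map_mul, mul_comm]
    | pred n ih =>
      intro w x
      rw [sub_eq_add_neg, LaurentPolynomial.T_add, mul_smul, ih, hTneg, ← Module.End.mul_apply,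
        ← map_mul, mul_comm]
  induction a using LaurentPolynomial.induction_on' generalizing w x with
  | add p q hp hq => rw [add_smul, map_add, LinearMap.add_apply, hp, hq, map_add,
      LinearMap.add_apply, map_add]
  | C_mul_T n r =>
    rw [mul_smul, hC, hTn, map_mul, Module.End.mul_apply, laurentEnd_C, map_smul]

/-- The `Λ`-linear map on `X ⊗ W` given by a balanced biadditive map. -/
noncomputable def laurentLift (F : W →+ X →ₗ[Λ] Z)
    (hC : ∀ (r : R) (w : W) (x : X),
      F ((LaurentPolynomial.C r : R[T;T⁻¹]) • w) x = algebraMap R Λ r • F w x)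
    (hT : ∀ (w : W) (x : X), F ((LaurentPolynomial.T 1 : R[T;T⁻¹]) • w) x = F w (τ x)) :
    (Laurent R τ ⊗[R[T;T⁻¹]] W) →ₗ[Λ] Z :=
  let G : Laurent R τ →+ W →+ Z := AddMonoidHom.mk' (fun x => AddMonoidHom.mk'
    (fun w => F w (show X from x)) fun w w' => by rw [map_add, LinearMap.add_apply])
      fun x y => AddMonoidHom.ext fun w => map_add (F w) (show X from x) (show X from y)
  let g := TensorProduct.liftAddHom G fun a x w => (laurent_balanced τ F hC hT a w x).symm
  { g with
    map_smul' := fun l z => by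
      change g (l • z) = l • g z
      induction z using TensorProduct.induction_on with
      | zero => simp
      | tmul x w => exact map_smul (F w) l (show X from x)
      | add x y hx hy => rw [smul_add, map_add, hx, hy, map_add, smul_add] }

theorem laurentLift_mk (F : W →+ X →ₗ[Λ] Z)
    (hC : ∀ (r : R) (w : W) (x : X),
      F ((LaurentPolynomial.C r : R[T;T⁻¹]) • w) x = algebraMap R Λ r • F w x)
    (hT : ∀ (w : W) (x : X), F ((LaurentPolynomial.T 1 : R[T;T⁻¹]) • w) x = F w (τ x))
    (w : W) (x : X) : laurentLift τ F hC hT (laurentMk τ w x) = F w x := rfl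

end LaurentLift

section Scalars

variable {R : Type*} [CommRing R] {W : Type*} [AddCommGroup W] [Module R W] [Module R[T;T⁻¹] W]
  [IsScalarTower R R[T;T⁻¹] W]

theorem C_smul_eq (r : R) (w : W) : (LaurentPolynomial.C r : R[T;T⁻¹]) • w = r • w := by
  rw [← mul_one (LaurentPolynomial.C r), ← LaurentPolynomial.smul_eq_C_mul, smul_assoc, one_smul]

/-- Multiplication by `Tᵏ`, as an `R`-linear map. -/
noncomputable def mulT (R : Type*) [CommRing R] (W : Type*) [AddCommGroup W] [Module R W]
    [Module R[T;T⁻¹] W] [IsScalarTower R R[T;T⁻¹] W] (k : ℤ) : W →ₗ[R] W :=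
  (LinearMap.lsmul R[T;T⁻¹] W (LaurentPolynomial.T k)).restrictScalars R

theorem mulT_apply (k : ℤ) (w : W) :
    mulT R W k w = (LaurentPolynomial.T k : R[T;T⁻¹]) • w := rfl

theorem mulT_T_smul (k : ℤ) (w : W) :
    mulT R W k ((LaurentPolynomial.T 1 : R[T;T⁻¹]) • w) = mulT R W (k + 1) w := by
  rw [mulT_apply, mulT_apply, smul_smul, ← LaurentPolynomial.T_add]

theorem mulT_C_smul (k : ℤ) (r : R) (w : W) :
    mulT R W k ((LaurentPolynomial.C r : R[T;T⁻¹]) • w) = r • mulT R W k w := by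
  rw [C_smul_eq, map_smul]

noncomputable instance (n : ℕ) : Module R (SignTwist R n W) := inferInstanceAs (Module R W)

/-- The twist fixes the scalars from `R`. -/
instance (n : ℕ) : IsScalarTower R R[T;T⁻¹] (SignTwist R n W) where
  smul_assoc r a w := by
    rw [signTwist_smul_def, signTwist_smul_def, LaurentPolynomial.smul_eq_C_mul, map_mul,
      signHom_C, mul_smul]
    exact C_smul_eq (W := W) r _

end Scalars

end Gentle

/-! ### The terms of a band complex. -/

namespace Gentle

theorem eq_of_periodic_of_dvd {α : Type*} {f : ℤ → α} {p : ℤ} (hf : Function.Periodic f p)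
    {i j : ℤ} (h : p ∣ j - i) : f j = f i := by
  obtain ⟨k, hk⟩ := h
  have := hf.int_mul k i
  rwa [Int.cast_id, mul_comm, ← hk, add_sub_cancel] at this

namespace Presentation

variable {R Λ : Type*} [CommRing R] [Ring Λ] [Algebra R Λ] {Q₀ Q₁ : Type*} [Fintype Q₀]
variable {𝔓 : Presentation R Λ Q₀ Q₁} {c : ℤ → Letter (NPath Q₁)} {p : ℤ}
variable {X : Type*} [AddCommGroup X] [Module Λ X]

theorem lift_strGen (n : ℤ) (y : ℤ → X) {i : ℤ} (hi : (Seq.bi (Q₀ := Q₀) c).ht i = n) :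
    FreeOn.lift (𝔓.strIdem (.bi c) n) (fun i => y i) (𝔓.strGen (.bi c) n i) =
      𝔓.gIdem (.bi c) i • y i := by
  rw [← 𝔓.strGen_of_mem n ⟨i, ⟨trivial, hi⟩⟩, FreeOn.lift_gen, strIdem]

theorem laurentEnd_T_strGen (hp : IsPeriod Q₀ c p) (n k i : ℤ) :
    laurentEnd R (𝔓.strShift hp n) (LaurentPolynomial.T k) (𝔓.strGen (.bi c) n i) =
      𝔓.strGen (.bi c) n (i - k * p) := by
  induction k using Int.induction_on generalizing i with
  | zero => simp
  | succ k ih =>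
    rw [LaurentPolynomial.T_add, map_mul, Module.End.mul_apply, laurentEnd_T, strShift_strGen, ih]
    congr 1
    ring
  | pred k ih =>
    have h1 := ih (i + p)
    rw [show -(k : ℤ) = -(k : ℤ) - 1 + 1 by ring, LaurentPolynomial.T_add, map_mul,
      Module.End.mul_apply, laurentEnd_T, strShift_strGen, add_sub_cancel_right] at h1
    rw [h1]
    congr 1
    ring

variable {W : Type*} [AddCommGroup W] [Module R[T;T⁻¹] W]

/-- The terms of the band complex. -/
abbrev BandX (hp : IsPeriod Q₀ c p) (𝔓 : Presentation R Λ Q₀ Q₁) (n : ℤ) (W : Type*)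
    [AddCommGroup W] [Module R[T;T⁻¹] W] : Type _ :=
  Laurent R (𝔓.strShift hp n) ⊗[R[T;T⁻¹]] W

theorem laurentMk_strGen_T_smul (hp : IsPeriod Q₀ c p) (n k i : ℤ) (w : W) :
    laurentMk (𝔓.strShift hp n) ((LaurentPolynomial.T k : R[T;T⁻¹]) • w) (𝔓.strGen (.bi c) n i) =
      laurentMk (R := R) (𝔓.strShift hp n) w (𝔓.strGen (.bi c) n (i - k * p)) := by
  rw [laurentMk_smul, laurentEnd_T_strGen]

theorem bandX_hom_ext {hp : IsPeriod Q₀ c p} {n : ℤ} {f g : BandX hp 𝔓 n W →ₗ[Λ] X}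
    (h : ∀ (w : W) (i : ℤ), (Seq.bi (Q₀ := Q₀) c).ht i = n →
      f (laurentMk (𝔓.strShift hp n) w (𝔓.strGen (.bi c) n i)) =
        g (laurentMk (𝔓.strShift hp n) w (𝔓.strGen (.bi c) n i))) : f = g := by
  refine laurent_hom_ext fun w => FreeOn.hom_ext fun i => ?_
  rw [𝔓.strGen_of_mem]
  exact h w i i.2.2

theorem bandX_subsingleton {hp : IsPeriod Q₀ c p} {n : ℤ} (h : ∀ i, (Seq.bi (Q₀ := Q₀) c).ht i ≠ n) :
    Subsingleton (BandX hp 𝔓 n W) := by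
  have : (LinearMap.id : BandX hp 𝔓 n W →ₗ[Λ] BandX hp 𝔓 n W) = 0 :=
    bandX_hom_ext fun w i hi => absurd hi (h i)
  exact ⟨fun x y => (LinearMap.congr_fun this x).trans (LinearMap.congr_fun this y).symm⟩

variable (hp : IsPeriod Q₀ c p) (n : ℤ) (y : ℤ → W →+ X)

/-- The map on a term of the band complex with prescribed values on the elements `g_{𝒞,i} ⊗ w`. -/
noncomputable def bandXLift
    (hC : ∀ (i : ℤ) (r : R) (w : W),
      y i ((LaurentPolynomial.C r : R[T;T⁻¹]) • w) = algebraMap R Λ r • y i w)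
    (hT : ∀ (i : ℤ) (w : W), y i ((LaurentPolynomial.T 1 : R[T;T⁻¹]) • w) = y (i - p) w) :
    BandX hp 𝔓 n W →ₗ[Λ] X :=
  laurentLift (𝔓.strShift hp n) ((FreeOn.liftHom (𝔓.strIdem (.bi c) n)).comp
    (AddMonoidHom.pi fun i => y i))
    (fun r w x => by
      have : FreeOn.lift (𝔓.strIdem (.bi c) n)
          (fun i => y i ((LaurentPolynomial.C r : R[T;T⁻¹]) • w)) =
          (scalarEnd R X r).comp (FreeOn.lift (𝔓.strIdem (.bi c) n) fun i => y i w) := by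
        refine FreeOn.hom_ext fun i => ?_
        rw [LinearMap.comp_apply, FreeOn.lift_gen, FreeOn.lift_gen, hC, map_smul]
        rfl
      exact LinearMap.congr_fun this x)
    (fun w x => by
      have : FreeOn.lift (𝔓.strIdem (.bi c) n)
          (fun i => y i ((LaurentPolynomial.T 1 : R[T;T⁻¹]) • w)) =
          (FreeOn.lift (𝔓.strIdem (.bi c) n) fun i => y i w).comp
            (𝔓.strShift hp n : 𝔓.StrX (.bi c) n →ₗ[Λ] 𝔓.StrX (.bi c) n) := by
        refine FreeOn.hom_ext fun i => ?_
        rw [LinearMap.comp_apply, FreeOn.lift_gen, hT, strGen_of_mem, LinearEquiv.coe_coe,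
          strShift_strGen, lift_strGen n (fun i => y i w) (by rw [hp.ht_sub]; exact i.2.2),
          gIdem_sub 𝔓 hp, strIdem]
      exact LinearMap.congr_fun this x)

variable {y}

theorem bandXLift_mk
    (hC : ∀ (i : ℤ) (r : R) (w : W),
      y i ((LaurentPolynomial.C r : R[T;T⁻¹]) • w) = algebraMap R Λ r • y i w)
    (hT : ∀ (i : ℤ) (w : W), y i ((LaurentPolynomial.T 1 : R[T;T⁻¹]) • w) = y (i - p) w)
    {i : ℤ} (hi : (Seq.bi (Q₀ := Q₀) c).ht i = n) (w : W) :
    bandXLift hp n y hC hT (laurentMk (𝔓.strShift hp n) w (𝔓.strGen (.bi c) n i)) =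
      𝔓.gIdem (.bi c) i • y i w :=
  lift_strGen n (fun i => y i w) hi

end Presentation

end Gentle

/-! ### Unrolling elements of a band complex along linear forms. -/

namespace Gentle

namespace Presentation

variable {R Λ : Type*} [CommRing R] [Ring Λ] [Algebra R Λ] {Q₀ Q₁ : Type*} [Fintype Q₀]
variable {𝔓 : Presentation R Λ Q₀ Q₁} {c : ℤ → Letter (NPath Q₁)} {p : ℤ}
variable {W : Type*} [AddCommGroup W] [Module R W] [Module R[T;T⁻¹] W] [IsScalarTower R R[T;T⁻¹] W]

section Family

open Classical in
/-- The family with value `φ(Tᵏ w) e` at `i + k p`. -/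
noncomputable def famFun (𝔓 : Presentation R Λ Q₀ Q₁) (c : ℤ → Letter (NPath Q₁)) (p : ℤ)
    (φ : W →ₗ[R] R) (i : ℤ) : W →+ ℤ → Λ :=
  AddMonoidHom.pi fun j => if p ∣ j - i then
    (AddMonoidHom.mulRight (𝔓.gIdem (.bi c) j)).comp
      ((algebraMap R Λ : R →+ Λ).comp (φ.comp (mulT R W ((j - i) / p))).toAddMonoidHom) else 0

theorem famFun_of_dvd (φ : W →ₗ[R] R) {i j : ℤ} (h : p ∣ j - i) (w : W) :
    famFun 𝔓 c p φ i w j = algebraMap R Λ (φ (mulT R W ((j - i) / p) w)) * 𝔓.gIdem (.bi c) j := by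
  rw [famFun, AddMonoidHom.pi_apply, if_pos h]
  rfl

theorem famFun_of_not_dvd (φ : W →ₗ[R] R) {i j : ℤ} (h : ¬ p ∣ j - i) (w : W) :
    famFun 𝔓 c p φ i w j = 0 := by
  rw [famFun, AddMonoidHom.pi_apply, if_neg h]
  rfl

theorem gIdem_eq_of_dvd (hp : IsPeriod Q₀ c p) {i j : ℤ} (h : p ∣ j - i) :
    𝔓.gIdem (.bi c) j = 𝔓.gIdem (.bi c) i :=
  eq_of_periodic_of_dvd (gIdem_add 𝔓 hp) h

theorem gIdem_smul_famFun (hp : IsPeriod Q₀ c p) (φ : W →ₗ[R] R) (i : ℤ) (w : W) :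
    𝔓.gIdem (.bi c) i • famFun 𝔓 c p φ i w = famFun 𝔓 c p φ i w := by
  funext j
  rw [Pi.smul_apply, smul_eq_mul]
  by_cases h : p ∣ j - i
  · rw [famFun_of_dvd φ h, ← mul_assoc, ← Algebra.commutes, mul_assoc, ← gIdem_eq_of_dvd hp h,
      gIdem_mul_self]
  · rw [famFun_of_not_dvd φ h, mul_zero]

variable (hp : IsPeriod Q₀ c p) (φ : W →ₗ[R] R)

/-- The family of coordinates of an element of `P(𝒞) ⊗ W` with respect to a linear form on `W`. -/
noncomputable def bandCoord (n : ℤ) (𝔓 : Presentation R Λ Q₀ Q₁) : BandX hp 𝔓 n W →ₗ[Λ] ℤ → Λ :=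
  bandXLift hp n (famFun 𝔓 c p φ)
    (fun i r w => by
      funext j
      rw [Pi.smul_apply]
      by_cases h : p ∣ j - i
      · rw [famFun_of_dvd φ h, famFun_of_dvd φ h, mulT_C_smul, map_smul, smul_eq_mul, map_mul,
          mul_assoc, smul_eq_mul]
      · rw [famFun_of_not_dvd φ h, famFun_of_not_dvd φ h, smul_zero])
    (fun i w => by
      funext j
      -- Passing from `i` to `i - p` raises the exponent of `T` by one, which is the effect of
      -- replacing `w` by `T w`.
      have h1 : j - (i - p) = j - i + p := by ring
      by_cases h : p ∣ j - i
      · have h2 : p ∣ j - (i - p) := by rw [h1]; exact dvd_add_self_right.mpr h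
        rw [famFun_of_dvd φ h, famFun_of_dvd φ h2, mulT_T_smul, h1,
          Int.add_ediv_of_dvd_right dvd_rfl, Int.ediv_self hp.pos.ne']
      · have h2 : ¬ p ∣ j - (i - p) := by rwa [h1, dvd_add_self_right]
        rw [famFun_of_not_dvd φ h, famFun_of_not_dvd φ h2])

theorem bandCoord_mk {n i : ℤ} (hi : (Seq.bi (Q₀ := Q₀) c).ht i = n) (w : W) :
    bandCoord hp φ n 𝔓 (laurentMk (𝔓.strShift hp n) w (𝔓.strGen (.bi c) n i)) =
      famFun 𝔓 c p φ i w := by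
  rw [bandCoord, bandXLift_mk _ _ _ _ hi, gIdem_smul_famFun hp]

theorem bandCoord_mem (n i : ℤ) (z : BandX hp 𝔓 n W) :
    bandCoord hp φ n 𝔓 z i ∈ leftIdeal (𝔓.gIdem (.bi c) i) := by
  have : ((LinearMap.toSpanSingleton Λ Λ (𝔓.gIdem (.bi c) i)).comp (LinearMap.proj i)).comp
      (bandCoord hp φ n 𝔓) = (LinearMap.proj i).comp (bandCoord hp φ n 𝔓) := by
    refine bandX_hom_ext fun w k hk => ?_
    simp only [LinearMap.comp_apply, bandCoord_mk hp φ hk, LinearMap.proj_apply,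
      LinearMap.toSpanSingleton_apply, smul_eq_mul]
    by_cases h : p ∣ i - k
    · rw [famFun_of_dvd φ h, mul_assoc, gIdem_mul_self]
    · rw [famFun_of_not_dvd φ h, zero_mul]
  exact Submodule.mem_span_singleton.mpr ⟨_, LinearMap.congr_fun this z⟩

theorem bandCoord_eq_zero {n i : ℤ} (hi : (Seq.bi (Q₀ := Q₀) c).ht i ≠ n) (z : BandX hp 𝔓 n W) :
    bandCoord hp φ n 𝔓 z i = 0 := by
  have : (LinearMap.proj i).comp (bandCoord hp φ n 𝔓) = 0 := by
    refine bandX_hom_ext fun w k hk => ?_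
    rw [LinearMap.comp_apply, bandCoord_mk hp φ hk, LinearMap.proj_apply, LinearMap.zero_apply]
    refine famFun_of_not_dvd φ (fun h => hi ?_) w
    rw [← hk]
    exact eq_of_periodic_of_dvd hp.ht_add h
  exact LinearMap.congr_fun this z

/-- The differential of the band complex. -/
noncomputable abbrev bandD (hc : 𝔓.IsGWord (.bi c)) (n : ℤ) (W : Type*) [AddCommGroup W]
    [Module R[T;T⁻¹] W] : BandX hp 𝔓 n W →ₗ[Λ] BandX hp 𝔓 (n + 1) W :=
  laurentMap (R := R) (𝔓.strShift hp n) (𝔓.strShift hp (n + 1)) W (𝔓.strD (.bi c) n)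
    (𝔓.strD_strShift hc hp n)

/-- The unrolled differential is the one of the underlying string complex, so the analysis of the
kernel of `famD` applies to band complexes. -/
theorem bandCoord_bandD (hc : 𝔓.IsGWord (.bi c)) (n : ℤ) (z : BandX hp 𝔓 n W) :
    bandCoord hp φ (n + 1) 𝔓 (bandD hp hc n W z) = famD 𝔓 (.bi c) (bandCoord hp φ n 𝔓 z) := by
  have : (bandCoord hp φ (n + 1) 𝔓).comp (bandD hp hc n W) =
      (famD 𝔓 (.bi c)).comp (bandCoord hp φ n 𝔓) := by
    refine bandX_hom_ext fun w k hk => ?_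
    rw [LinearMap.comp_apply, LinearMap.comp_apply, bandD, laurentMap_mk, strD_strGen 𝔓 hc,
      if_pos ⟨trivial, hk⟩, bandCoord_mk hp φ hk, map_add, map_add]
    funext j
    rw [famD, LinearMap.pi_apply, LinearMap.add_apply, Pi.add_apply]
    congr 1
    · by_cases h : p ∣ j + 1 - k
      · have h1 : c (j + 1) = c k := eq_of_periodic_of_dvd hp.shift h
        rw [strBdLeft]
        simp only [Seq.letterAt, h1]
        cases hl : c k with
        | inv μ => simp
        | dir η =>
          have hl' : (Seq.bi (Q₀ := Q₀) c).letterAt k = some (.dir η) := congrArg some hl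
          have h2 := Seq.ht_of_dir hl'
          have h3 : p ∣ j - (k - 1) := by rwa [show j - (k - 1) = j + 1 - k by ring]
          simp only [map_smul, LinearMap.comp_apply, LinearMap.proj_apply,
            LinearMap.toSpanSingleton_apply, smul_eq_mul, Pi.smul_apply]
          rw [bandCoord_mk hp φ (by omega), famFun_of_dvd φ h, famFun_of_dvd φ h3,
            gIdem_eq_of_dvd hp h, gIdem_eq_of_dvd hp h3, gIdem_of_dir hl', mul_assoc,
            e_mul_path, ← mul_assoc, ← Algebra.commutes, mul_assoc,
            gIdem_of_dir_succ hc (by rwa [sub_add_cancel]), path_mul_e]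
          rw [show j - (k - 1) = j + 1 - k by ring]
      · have h0 : famFun 𝔓 c p φ k w (j + 1) = 0 := famFun_of_not_dvd φ h w
        refine Eq.trans (b := 0) ?_ (Eq.symm ?_)
        · rw [strBdLeft]
          split
          · rename_i η hl'
            have h2 := Seq.ht_of_dir hl'
            rw [map_smul, map_smul, Pi.smul_apply, bandCoord_mk hp φ (by omega),
              famFun_of_not_dvd φ (by rwa [show j - (k - 1) = j + 1 - k by ring]), smul_zero]
          · rw [map_zero, map_zero]; rfl
        · split
          · rw [LinearMap.comp_apply, LinearMap.proj_apply, h0, map_zero]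
          · rfl
    · by_cases h : p ∣ j - 1 - k
      · have h1 : c j = c (k + 1) := eq_of_periodic_of_dvd hp.shift (by rwa [show j - (k + 1) = j - 1 - k by ring])
        rw [strBdRight]
        simp only [Seq.letterAt, h1]
        cases hl : c (k + 1) with
        | dir μ => simp
        | inv η =>
          have hl' : (Seq.bi (Q₀ := Q₀) c).letterAt (k + 1) = some (.inv η) := congrArg some hl
          have h2 := Seq.ht_of_inv hl'
          have h3 : p ∣ j - (k + 1) := by rwa [show j - (k + 1) = j - 1 - k by ring]
          simp only [map_smul, LinearMap.comp_apply, LinearMap.proj_apply,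
            LinearMap.toSpanSingleton_apply, smul_eq_mul, Pi.smul_apply]
          rw [bandCoord_mk hp φ (by omega), famFun_of_dvd φ h, famFun_of_dvd φ h3,
            gIdem_eq_of_dvd hp h, gIdem_eq_of_dvd hp h3, gIdem_of_inv hl', mul_assoc,
            gIdem_of_inv_succ hc hl', e_mul_path, ← mul_assoc, ← Algebra.commutes, mul_assoc,
            path_mul_e]
          rw [show j - (k + 1) = j - 1 - k by ring]
      · have h0 : famFun 𝔓 c p φ k w (j - 1) = 0 := famFun_of_not_dvd φ h w
        refine Eq.trans (b := 0) ?_ (Eq.symm ?_)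
        · rw [strBdRight]
          split
          · rename_i η hl'
            have h2 := Seq.ht_of_inv hl'
            rw [map_smul, map_smul, Pi.smul_apply, bandCoord_mk hp φ (by omega),
              famFun_of_not_dvd φ (by rwa [show j - (k + 1) = j - 1 - k by ring]), smul_zero]
          · rw [map_zero, map_zero]; rfl
        · split
          · rw [LinearMap.comp_apply, LinearMap.proj_apply, h0, map_zero]
          · rfl
  exact LinearMap.congr_fun this z

end Family

end Presentation

end Gentle

/-! ### Projectivity, and injectivity of the differential. -/

namespace Gentle

namespace Presentation

variable {R Λ : Type*} [CommRing R] [Ring Λ] [Algebra R Λ] {Q₀ Q₁ : Type*} [Fintype Q₀]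
variable {𝔓 : Presentation R Λ Q₀ Q₁} {c : ℤ → Letter (NPath Q₁)} {p : ℤ}
variable {W : Type*}

/-- The idempotents of the free cover of a term of the band complex. -/
noncomputable def coverIdem (𝔓 : Presentation R Λ Q₀ Q₁) (c : ℤ → Letter (NPath Q₁)) (W : Type*)
    (i : ℤ × W) : Λ := 𝔓.gIdem (.bi c) i.1

/-- The element `∑ᵣ r g_{(i,b)}` of the free cover given by a finite family of scalars. -/
noncomputable def coverSum (𝔓 : Presentation R Λ Q₀ Q₁) (c : ℤ → Letter (NPath Q₁)) (W : Type*)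
    (i : ℤ) : (W →₀ R) →+ FreeOn (coverIdem 𝔓 c W) :=
  Finsupp.liftAddHom fun b => (((smulAddHom Λ (FreeOn (coverIdem 𝔓 c W))).flip
    (FreeOn.gen (coverIdem 𝔓 c W) (i, b))).comp (algebraMap R Λ : R →+ Λ))

theorem coverSum_single (i : ℤ) (b : W) (r : R) : coverSum 𝔓 c W i (Finsupp.single b r) =
    algebraMap R Λ r • FreeOn.gen (coverIdem 𝔓 c W) (i, b) := by
  rw [coverSum, Finsupp.liftAddHom_apply_single]
  rfl

theorem coverSum_smul (i : ℤ) (r : R) (x : W →₀ R) :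
    coverSum 𝔓 c W i (r • x) = algebraMap R Λ r • coverSum 𝔓 c W i x := by
  induction x using Finsupp.induction_linear with
  | zero => simp
  | add x y hx hy => rw [smul_add, map_add, hx, hy, map_add, smul_add]
  | single b t => rw [Finsupp.smul_single, coverSum_single, coverSum_single, smul_eq_mul, map_mul,
      mul_smul]

open Classical in
theorem coord_coverSum (i j : ℤ) (b : W) (x : W →₀ R) :
    FreeOn.coord (i, b) (coverSum 𝔓 c W j x) =
      if j = i then algebraMap R Λ (x b) * 𝔓.gIdem (.bi c) i else 0 := by
  induction x using Finsupp.induction_linear with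
  | zero => simp
  | add x y hx hy =>
    rw [map_add, map_add, hx, hy]
    split_ifs
    · rw [Finsupp.add_apply, map_add, add_mul]
    · rw [add_zero]
  | single b' t =>
    rw [coverSum_single, map_smul, FreeOn.coord_gen, Finsupp.single_apply, Prod.mk.injEq]
    by_cases h1 : j = i
    · by_cases h2 : b' = b
      · subst h1 h2
        simp [coverIdem]
      · simp [h1, h2]
    · simp [h1]

variable [AddCommGroup W] [Module R W] [Module R[T;T⁻¹] W] [IsScalarTower R R[T;T⁻¹] W]
  (hp : IsPeriod Q₀ c p) (s : W →ₗ[R] W →₀ R)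

/-- The embedding of a term of the band complex into a direct sum of modules `Λ e`. -/
noncomputable def toCover (n : ℤ) (𝔓 : Presentation R Λ Q₀ Q₁) :
    BandX hp 𝔓 n W →ₗ[Λ] FreeOn (coverIdem 𝔓 c W) :=
  bandXLift hp n (fun i => ((coverSum 𝔓 c W (i % p)).comp
      (s.comp (mulT R W (-(i / p)))).toAddMonoidHom))
    (fun i r w => by
      change coverSum 𝔓 c W _ (s (mulT R W _ _)) = _ • coverSum 𝔓 c W _ (s (mulT R W _ _))
      rw [mulT_C_smul, map_smul, coverSum_smul])
    (fun i w => by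
      change coverSum 𝔓 c W _ (s (mulT R W _ _)) = coverSum 𝔓 c W _ (s (mulT R W _ _))
      rw [mulT_T_smul, Int.sub_emod_right, Int.sub_ediv_of_dvd _ dvd_rfl, Int.ediv_self hp.pos.ne']
      congr 4
      ring)

theorem toCover_mk {n i : ℤ} (hi : (Seq.bi (Q₀ := Q₀) c).ht i = n) (w : W) :
    toCover hp s n 𝔓 (laurentMk (𝔓.strShift hp n) w (𝔓.strGen (.bi c) n i)) =
      𝔓.gIdem (.bi c) i • coverSum 𝔓 c W (i % p) (s (mulT R W (-(i / p)) w)) := by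
  rw [toCover, bandXLift_mk _ _ _ _ hi]
  rfl

/-- The projection onto a term of the band complex from a direct sum of modules `Λ e`. -/
noncomputable def ofCover (n : ℤ) (𝔓 : Presentation R Λ Q₀ Q₁) :
    FreeOn (coverIdem 𝔓 c W) →ₗ[Λ] BandX hp 𝔓 n W :=
  FreeOn.lift _ fun i => laurentMk (𝔓.strShift hp n) i.2 (𝔓.strGen (.bi c) n i.1)

theorem ofCover_coverSum (n i : ℤ) (x : W →₀ R) : ofCover hp n 𝔓 (coverSum 𝔓 c W i x) =
    laurentMk (𝔓.strShift hp n) (Finsupp.linearCombination R id x) (𝔓.strGen (.bi c) n i) := by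
  induction x using Finsupp.induction_linear with
  | zero => simp
  | add x y hx hy => rw [map_add, map_add, hx, hy, map_add, map_add, LinearMap.add_apply]
  | single b t =>
    rw [coverSum_single, map_smul, ofCover, FreeOn.lift_gen, coverIdem, ← map_smul,
      gIdem_smul_strGen, Finsupp.linearCombination_single, id_eq, ← C_smul_eq, laurentMk_smul,
      laurentEnd_C, map_smul]

/-- Since `g_i ⊗ w = g_{i mod p} ⊗ T^{-(i/p)} w`, each index can be brought into one period; the
vector in `W` is then written through the section `s` of the free cover of `W`. Thus the term is a
direct summand of a sum of modules `Λe`. -/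
theorem ofCover_toCover (hs : ∀ w, Finsupp.linearCombination R id (s w) = w) (n : ℤ)
    (z : BandX hp 𝔓 n W) : ofCover hp n 𝔓 (toCover hp s n 𝔓 z) = z := by
  have : (ofCover hp n 𝔓).comp (toCover hp s n 𝔓) = LinearMap.id := by
    refine bandX_hom_ext fun w i hi => ?_
    rw [LinearMap.comp_apply, toCover_mk hp s hi, map_smul, ofCover_coverSum, hs, mulT_apply,
      laurentMk_strGen_T_smul, LinearMap.id_apply, ← map_smul]
    have h1 : i % p - -(i / p) * p = i := by
      have := Int.emod_add_mul_ediv i p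
      linear_combination this
    rw [h1, gIdem_smul_strGen]
  exact LinearMap.congr_fun this z

theorem bandX_projective [Module.Projective R W] (n : ℤ) :
    Module.Projective Λ (BandX hp 𝔓 n W) := by
  obtain ⟨s, hs⟩ := Module.projective_def.mp ‹Module.Projective R W›
  have := FreeOn.projective (e := coverIdem 𝔓 c W) fun i => 𝔓.gIdem_mul_self _ i.1
  exact Module.Projective.of_split (toCover hp s n 𝔓) (ofCover hp n 𝔓)
    (LinearMap.ext (ofCover_toCover hp s hs n))

-- The coordinates of the embedding are values of `bandCoord` for the linear forms `w ↦ s(w)_b`;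
-- these forms are therefore enough to detect an element.
open Classical in
theorem coord_toCover (n i : ℤ) (b : W) (z : BandX hp 𝔓 n W) :
    FreeOn.coord (i, b) (toCover hp s n 𝔓 z) =
      if i % p = i then bandCoord hp ((Finsupp.lapply b).comp s) n 𝔓 z i else 0 := by
  have : (FreeOn.coord (i, b)).comp (toCover hp s n 𝔓) =
      if i % p = i then (LinearMap.proj i).comp (bandCoord hp ((Finsupp.lapply b).comp s) n 𝔓)
        else 0 := by
    refine bandX_hom_ext fun w k hk => ?_
    rw [LinearMap.comp_apply, toCover_mk hp s hk, map_smul, coord_coverSum, smul_eq_mul, mul_ite,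
      mul_zero]
    split_ifs with h1 h2 h2
    · rw [LinearMap.comp_apply, LinearMap.proj_apply, bandCoord_mk _ _ hk]
      have h3 : i - k = p * -(k / p) := by
        have := Int.emod_add_mul_ediv k p
        linear_combination this - h1
      have h4 : p ∣ i - k := ⟨_, h3⟩
      rw [famFun_of_dvd _ h4, ← gIdem_eq_of_dvd hp h4, ← mul_assoc, ← Algebra.commutes, mul_assoc,
        gIdem_mul_self, h3, Int.mul_ediv_cancel_left _ hp.pos.ne']
      rfl
    · exact absurd (by rw [← h1, Int.emod_emod]) h2
    · rw [LinearMap.comp_apply, LinearMap.proj_apply, bandCoord_mk _ _ hk, famFun_of_not_dvd]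
      intro h3
      exact h1 (((Int.emod_eq_emod_iff_emod_sub_eq_zero.mpr
        (Int.emod_eq_zero_of_dvd h3)).symm).trans h2)
    · rfl
  have h := LinearMap.congr_fun this z
  rw [LinearMap.comp_apply] at h
  rw [h]
  split_ifs <;> rfl

theorem eq_zero_of_bandCoord [Module.Projective R W] {n : ℤ} {z : BandX hp 𝔓 n W}
    (h : ∀ φ : W →ₗ[R] R, bandCoord hp φ n 𝔓 z = 0) : z = 0 := by
  classical
  obtain ⟨s, hs⟩ := Module.projective_def.mp ‹Module.Projective R W›
  rw [← ofCover_toCover hp s hs n z]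
  have : toCover hp s n 𝔓 z = 0 := FreeOn.ext_coord fun i => by
    rw [coord_toCover hp s n i.1 i.2, h, Pi.zero_apply, ite_self, map_zero]
  rw [this, map_zero]

/-- When every position of degree `n` has letters leading away on both sides, all unrolled
coordinates of an element of the kernel vanish. -/
theorem bandD_injective [IsLocalRing R] [IsNoetherianRing R] [Module.Projective R W]
    (h𝔓 : 𝔓.IsCompleteGentle) (hc : 𝔓.IsGWord (.bi c)) {n : ℤ}
    (h : ∀ i, (Seq.bi (Q₀ := Q₀) c).ht i = n → ∃ η μ, c i = .dir η ∧ c (i + 1) = .inv μ) :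
    Function.Injective (bandD hp hc n W) := by
  rw [← LinearMap.ker_eq_bot, LinearMap.ker_eq_bot']
  intro z hz
  refine eq_zero_of_bandCoord hp fun φ => funext fun i => ?_
  have h1 : famD 𝔓 (.bi c) (bandCoord hp φ n 𝔓 z) = 0 := by
    rw [← bandCoord_bandD hp φ hc, hz, map_zero]
  by_cases hi : (Seq.bi (Q₀ := Q₀) c).ht i = n
  · obtain ⟨η, μ, hη, hμ⟩ := h i hi
    exact eq_zero_of_famD h𝔓 hc h1 (bandCoord_mem hp φ n i z) (congrArg some hη)
      (congrArg some hμ)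
  · exact bandCoord_eq_zero hp φ hi z

end Presentation

end Gentle

/-! ### The augmentation onto the band module. -/

namespace Gentle

theorem negOnePow_smul_smul {X : Type*} [AddCommGroup X] (k : ℤ) (x : X) :
    (k.negOnePow : ℤ) • (k.negOnePow : ℤ) • x = x := by
  rw [smul_smul, ← Units.val_mul, Int.units_mul_self, Units.val_one, one_smul]

section SignTwist

variable {R : Type*} [CommRing R] {W : Type*} [AddCommGroup W] [Module R[T;T⁻¹] W] (n : ℕ)

/-- The identity map, from the twisted module to the original one. -/
def twistEquiv (R : Type*) (n : ℕ) (W : Type*) [AddCommGroup W] : SignTwist R n W ≃+ W :=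
  AddEquiv.refl W

theorem twistEquiv_smul (a : R[T;T⁻¹]) (w : SignTwist R n W) :
    twistEquiv R n W (a • w) = signHom R n a • twistEquiv R n W w := rfl

theorem twistEquiv_T_smul (w : SignTwist R n W) :
    twistEquiv R n W ((LaurentPolynomial.T 1 : R[T;T⁻¹]) • w) =
      ((n : ℤ).negOnePow : ℤ) • (LaurentPolynomial.T 1 : R[T;T⁻¹]) • twistEquiv R n W w := by
  rw [twistEquiv_smul, signHom_T, mul_smul, ← Int.cast_smul_eq_zsmul R[T;T⁻¹],
    Int.negOnePow_def]
  simp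

theorem twistEquiv_C_smul (r : R) (w : SignTwist R n W) :
    twistEquiv R n W ((LaurentPolynomial.C r : R[T;T⁻¹]) • w) =
      (LaurentPolynomial.C r : R[T;T⁻¹]) • twistEquiv R n W w := by
  rw [twistEquiv_smul, signHom_C]

theorem twistEquiv_symm_T_smul (w : W) :
    (twistEquiv R n W).symm ((LaurentPolynomial.T 1 : R[T;T⁻¹]) • w) =
      ((n : ℤ).negOnePow : ℤ) • (LaurentPolynomial.T 1 : R[T;T⁻¹]) •
        (twistEquiv R n W).symm w := by
  rw [AddEquiv.symm_apply_eq, map_zsmul, twistEquiv_T_smul, negOnePow_smul_smul,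
    AddEquiv.apply_symm_apply]

theorem twistEquiv_symm_C_smul (r : R) (w : W) :
    (twistEquiv R n W).symm ((LaurentPolynomial.C r : R[T;T⁻¹]) • w) =
      (LaurentPolynomial.C r : R[T;T⁻¹]) • (twistEquiv R n W).symm w := by
  rw [AddEquiv.symm_apply_eq, twistEquiv_C_smul, AddEquiv.apply_symm_apply]

instance [Module R W] [Module.Projective R W] : Module.Projective R (SignTwist R n W) :=
  inferInstanceAs (Module.Projective R W)

end SignTwist

namespace Presentation

namespace IsBandWord

variable {R Λ : Type*} [CommRing R] [Ring Λ] [Algebra R Λ] {Q₀ Q₁ : Type*} [Fintype Q₀]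
variable {𝔓 : Presentation R Λ Q₀ Q₁}
variable {C : Word Q₀ Q₁} {bs : List (NPath Q₁ × NPath Q₁)} {h : bs ≠ []}

theorem gIdem_even (hw : 𝔓.IsBandWord C bs h) (k : ℤ) :
    𝔓.gIdem (resBand Q₀ bs h) (2 * k) = 𝔓.bandIdem bs h k :=
  gIdem_of_dir_succ hw.isGWord (resBand_letterAt_dir Q₀ h k)

theorem _root_.Gentle.Presentation.gIdem_resBand_odd (k : ℤ) :
    𝔓.gIdem (resBand Q₀ bs h) (2 * k + 1) = 𝔓.e (𝔓.Q.phead (blockAt bs h k).1) :=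
  gIdem_of_dir (resBand_letterAt_dir Q₀ h k)

theorem bandIdem_smul_gen (k : ℤ) : 𝔓.bandIdem bs h k • FreeOn.gen (𝔓.bandIdem bs h) k =
    FreeOn.gen (𝔓.bandIdem bs h) k :=
  FreeOn.smul_gen (fun _ => 𝔓.e_mul_self _) k

section Differential

variable {U : Type*} [AddCommGroup U] [Module R[T;T⁻¹] U]

/-- The element `g_{𝓡_C,i} ⊗ u`. -/
noncomputable abbrev bandGen (hw : 𝔓.IsBandWord C bs h) (n : ℤ) (u : U) (i : ℤ) :
    BandX hw.isPeriod 𝔓 n U :=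
  laurentMk (𝔓.strShift hw.isPeriod n) u (𝔓.strGen (resBand Q₀ bs h) n i)

theorem bandD_bandGen (hw : 𝔓.IsBandWord C bs h) {m : ℤ} (hm : m + 1 = 0) (k : ℤ) (u : U) :
    bandD hw.isPeriod hw.isGWord m U (hw.bandGen m u (2 * k + 1)) =
      𝔓.path (blockAt bs h k).1 • hw.bandGen (m + 1) u (2 * k) +
        𝔓.path (blockAt bs h k).2 • hw.bandGen (m + 1) u (2 * (k + 1)) := by
  have hht := resBand_ht_odd Q₀ h k
  have h2 : (resBand Q₀ bs h).letterAt (2 * k + 1 + 1) = some (.inv (blockAt bs h k).2) := by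
    rw [add_assoc]
    exact resBand_letterAt_inv Q₀ h k
  rw [bandD, laurentMap_mk, strD_strGen 𝔓 hw.isGWord, if_pos ⟨trivial, by omega⟩,
    strBdLeft_of_dir (resBand_letterAt_dir Q₀ h k), strBdRight_of_inv h2, map_add, map_smul,
    map_smul, add_sub_cancel_right, show 2 * k + 1 + 1 = 2 * (k + 1) by ring]

end Differential

variable {W : Type*} [AddCommGroup W] [Module R[T;T⁻¹] W]

/-- The map `g_{𝓡_C,2k} ⊗ w ↦ (-1)ᵏ g_{C,k} ⊗ w` onto the band module. -/
noncomputable def toBandModule (hw : 𝔓.IsBandWord C bs h) (n : ℤ) (W : Type*) [AddCommGroup W]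
    [Module R[T;T⁻¹] W] : BandX hw.isPeriod 𝔓 n (SignTwist R bs.length W) →ₗ[Λ]
      𝔓.BandModule (R := R) bs h W :=
  -- The rounding in `i / 2` is harmless: in degree `0`, where the map is used, all positions are
  -- even.
  bandXLift hw.isPeriod n (fun i => AddMonoidHom.mk'
    (fun w => ((i / 2).negOnePow : ℤ) • laurentMk (𝔓.bandT bs h) (twistEquiv R bs.length W w)
      (Submodule.mkQ (𝔓.bandL bs h) (FreeOn.gen (𝔓.bandIdem bs h) (i / 2))))
    (fun w w' => by rw [map_add, map_add, LinearMap.add_apply, smul_add]))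
    (fun i r w => by
      simp only [AddMonoidHom.mk'_apply]
      rw [twistEquiv_C_smul, laurentMk_smul, laurentEnd_C, map_smul, smul_comm])
    (fun i w => by
      simp only [AddMonoidHom.mk'_apply]
      -- Moving by `n` peaks changes the sign by `(-1)ⁿ`, and the twisted action of `T` compensates
      -- for this.
      have h1 : (i - 2 * bs.length) / 2 = i / 2 - bs.length := by omega
      have h2 : 𝔓.bandT bs h (Submodule.mkQ (𝔓.bandL bs h) (FreeOn.gen _ (i / 2))) =
          Submodule.mkQ (𝔓.bandL bs h) (FreeOn.gen _ (i / 2 - bs.length)) :=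
        congrArg (Submodule.mkQ (𝔓.bandL bs h)) (𝔓.bandShiftN_gen bs h (i / 2))
      rw [twistEquiv_T_smul, map_zsmul, LinearMap.smul_apply, laurentMk_T_smul, smul_smul, h1, h2,
        Int.negOnePow_sub, Units.val_mul])

theorem toBandModule_bandGen (hw : 𝔓.IsBandWord C bs h) {n : ℤ} (hn : n = 0) (k : ℤ)
    (w : SignTwist R bs.length W) :
    toBandModule hw n W (hw.bandGen n w (2 * k)) = (k.negOnePow : ℤ) •
      laurentMk (𝔓.bandT bs h) (twistEquiv R bs.length W w)
        (Submodule.mkQ (𝔓.bandL bs h) (FreeOn.gen (𝔓.bandIdem bs h) k)) := by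
  have h1 : 𝔓.bandIdem bs h k • laurentMk (R := R) (𝔓.bandT bs h) (twistEquiv R bs.length W w)
      (Submodule.mkQ (𝔓.bandL bs h) (FreeOn.gen (𝔓.bandIdem bs h) k)) =
      laurentMk (𝔓.bandT bs h) (twistEquiv R bs.length W w)
        (Submodule.mkQ (𝔓.bandL bs h) (FreeOn.gen (𝔓.bandIdem bs h) k)) := by
    rw [← map_smul, ← map_smul, bandIdem_smul_gen]
  rw [toBandModule, bandGen, bandXLift_mk _ _ _ _ ((resBand_ht_even Q₀ h k).trans hn.symm),
    AddMonoidHom.mk'_apply, gIdem_even hw, Int.mul_ediv_cancel_left _ two_ne_zero, smul_comm, h1]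

theorem toBandModule_surjective (hw : 𝔓.IsBandWord C bs h) {n : ℤ} (hn : n = 0) :
    Function.Surjective (toBandModule hw n W) := by
  rw [← LinearMap.range_eq_top, eq_top_iff]
  have : (Submodule.mkQ (LinearMap.range (toBandModule hw n W))) = 0 := by
    refine laurent_hom_ext fun w => ?_
    rw [LinearMap.zero_comp]
    refine (LinearMap.cancel_right (Submodule.mkQ_surjective (𝔓.bandL bs h))).mp ?_
    refine FreeOn.hom_ext fun k => ?_
    rw [LinearMap.comp_apply, LinearMap.comp_apply, LinearMap.zero_comp, LinearMap.zero_apply,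
      Submodule.mkQ_apply, Submodule.Quotient.mk_eq_zero]
    refine ⟨(k.negOnePow : ℤ) • hw.bandGen n ((twistEquiv R bs.length W).symm w) (2 * k), ?_⟩
    rw [map_zsmul, toBandModule_bandGen hw hn, negOnePow_smul_smul, AddEquiv.apply_symm_apply]
  intro z _
  have h1 := LinearMap.congr_fun this z
  rwa [Submodule.mkQ_apply, LinearMap.zero_apply, Submodule.Quotient.mk_eq_zero] at h1

/-- With alternating signs, the two terms of the boundary of a valley become a multiple of a
defining relation of the band module. -/
theorem toBandModule_bandD (hw : 𝔓.IsBandWord C bs h) {m : ℤ} (hm : m + 1 = 0)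
    (z : BandX hw.isPeriod 𝔓 m (SignTwist R bs.length W)) :
    toBandModule hw (m + 1) W (bandD hw.isPeriod hw.isGWord m _ z) = 0 := by
  have : (toBandModule hw (m + 1) W).comp (bandD hw.isPeriod hw.isGWord m _) = 0 := by
    refine bandX_hom_ext fun w i hi => ?_
    obtain ⟨k, rfl⟩ := eq_two_mul_add_one_of_ht (h := h) (hi.trans (by omega))
    rw [LinearMap.comp_apply, bandD_bandGen hw hm, map_add, map_smul, map_smul,
      toBandModule_bandGen hw hm, toBandModule_bandGen hw hm, Int.negOnePow_succ, Units.val_neg, neg_smul,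
      smul_neg, smul_comm _ (k.negOnePow : ℤ), smul_comm _ (k.negOnePow : ℤ), ← sub_eq_add_neg,
      ← smul_sub]
    have h1 : Submodule.mkQ (𝔓.bandL bs h) (𝔓.bandRel bs h k) = 0 := by
      rw [Submodule.mkQ_apply, Submodule.Quotient.mk_eq_zero]
      exact Submodule.subset_span ⟨k, rfl⟩
    have h2 := congrArg (laurentMk (R := R) (𝔓.bandT bs h) (twistEquiv R bs.length W w)) h1
    rw [bandRel, map_sub, map_sub, map_smul, map_smul, map_smul, map_smul, map_zero] at h2
    rw [h2, smul_zero, LinearMap.zero_apply]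
  exact LinearMap.congr_fun this z

section Inverse

variable {Y : Type*} [AddCommGroup Y] [Module Λ Y] (hw : 𝔓.IsBandWord C bs h) {n : ℤ}
  (q : BandX hw.isPeriod 𝔓 n (SignTwist R bs.length W) →ₗ[Λ] Y)

/-- The map `g_{C,k} ↦ (-1)ᵏ q(g_{𝓡_C,2k} ⊗ w)`. -/
noncomputable def ofBandN : W →+ 𝔓.bandN bs h →ₗ[Λ] Y :=
  (FreeOn.liftHom (𝔓.bandIdem bs h)).comp (AddMonoidHom.mk' (fun w k => (k.negOnePow : ℤ) •
    q (hw.bandGen n ((twistEquiv R bs.length W).symm w) (2 * k)))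
    (fun w w' => by
      funext k
      rw [Pi.add_apply, map_add, bandGen, map_add, LinearMap.add_apply, map_add, smul_add]))

theorem ofBandN_gen (w : W) (k : ℤ) :
    hw.ofBandN q w (FreeOn.gen (𝔓.bandIdem bs h) k) = (k.negOnePow : ℤ) •
      q (hw.bandGen n ((twistEquiv R bs.length W).symm w) (2 * k)) := by
  have : hw.ofBandN q w (FreeOn.gen (𝔓.bandIdem bs h) k) = 𝔓.bandIdem bs h k •
      (k.negOnePow : ℤ) • q (hw.bandGen n ((twistEquiv R bs.length W).symm w) (2 * k)) :=
    FreeOn.lift_gen _ k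
  have h1 : 𝔓.bandIdem bs h k • q (hw.bandGen n ((twistEquiv R bs.length W).symm w) (2 * k)) =
      q (hw.bandGen n ((twistEquiv R bs.length W).symm w) (2 * k)) := by
    rw [← map_smul, bandGen, ← map_smul, ← gIdem_even hw, gIdem_smul_strGen]
  rw [this, smul_comm, h1]

theorem ofBandN_C_smul (r : R) (w : W) (x : 𝔓.bandN bs h) :
    hw.ofBandN q ((LaurentPolynomial.C r : R[T;T⁻¹]) • w) x =
      algebraMap R Λ r • hw.ofBandN q w x := by
  have : hw.ofBandN q ((LaurentPolynomial.C r : R[T;T⁻¹]) • w) =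
      (scalarEnd R _ r).comp (hw.ofBandN q w) := by
    refine FreeOn.hom_ext fun k => ?_
    rw [LinearMap.comp_apply, ofBandN_gen, ofBandN_gen, map_zsmul]
    congr 1
    rw [bandGen, twistEquiv_symm_C_smul, laurentMk_smul, laurentEnd_C, map_smul, map_smul]
    rfl
  exact LinearMap.congr_fun this x

theorem ofBandN_T_smul (w : W) (x : 𝔓.bandN bs h) :
    hw.ofBandN q ((LaurentPolynomial.T 1 : R[T;T⁻¹]) • w) x =
      hw.ofBandN q w (𝔓.bandShiftN bs h x) := by
  have : hw.ofBandN q ((LaurentPolynomial.T 1 : R[T;T⁻¹]) • w) =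
      (hw.ofBandN q w).comp (𝔓.bandShiftN bs h : 𝔓.bandN bs h →ₗ[Λ] 𝔓.bandN bs h) := by
    refine FreeOn.hom_ext fun k => ?_
    rw [LinearMap.comp_apply, LinearEquiv.coe_coe, bandShiftN_gen, ofBandN_gen, ofBandN_gen,
      bandGen, bandGen, twistEquiv_symm_T_smul, map_zsmul, LinearMap.smul_apply,
      laurentMk_T_smul, strShift_strGen, map_zsmul, smul_smul, Int.negOnePow_sub,
      Units.val_mul, show 2 * k - 2 * (bs.length : ℤ) = 2 * (k - bs.length) by ring]
  exact LinearMap.congr_fun this x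

end Inverse

section Exact

variable {Y : Type*} [AddCommGroup Y] [Module Λ Y] (hw : 𝔓.IsBandWord C bs h) {m : ℤ}
  (hm : m + 1 = 0) (q : BandX hw.isPeriod 𝔓 (m + 1) (SignTwist R bs.length W) →ₗ[Λ] Y)
  (hq : ∀ z, q (bandD hw.isPeriod hw.isGWord m _ z) = 0)

/-- Up to sign, the value on a relation is the value of `q` on the boundary of a valley. -/
theorem bandL_le_ker (hm : m + 1 = 0) (hq : ∀ z, q (bandD hw.isPeriod hw.isGWord m _ z) = 0)
    (w : W) : 𝔓.bandL bs h ≤ LinearMap.ker (hw.ofBandN q w) := by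
  refine Submodule.span_le.mpr ?_
  rintro _ ⟨k, rfl⟩
  have h1 := hq (hw.bandGen m ((twistEquiv R bs.length W).symm w) (2 * k + 1))
  rw [bandD_bandGen hw hm, map_add, map_smul, map_smul] at h1
  rw [SetLike.mem_coe, LinearMap.mem_ker, bandRel, map_sub, map_smul, map_smul, ofBandN_gen,
    ofBandN_gen, Int.negOnePow_succ, Units.val_neg, neg_smul, smul_neg, sub_neg_eq_add,
    smul_comm _ (k.negOnePow : ℤ), smul_comm _ (k.negOnePow : ℤ), ← smul_add, h1,
    smul_zero]

/-- The map from the band module induced by a map which vanishes on boundaries. -/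
noncomputable def ofBandModule : 𝔓.BandModule (R := R) bs h W →ₗ[Λ] Y :=
  laurentLift (𝔓.bandT bs h) (AddMonoidHom.mk'
    (fun w => (𝔓.bandL bs h).liftQ (hw.ofBandN q w) (hw.bandL_le_ker q hm hq w))
    (fun w w' => by
      refine (LinearMap.cancel_right (Submodule.mkQ_surjective (𝔓.bandL bs h))).mp ?_
      rw [LinearMap.add_comp, Submodule.liftQ_mkQ, Submodule.liftQ_mkQ, Submodule.liftQ_mkQ,
        map_add]))
    (fun r w x => by
      obtain ⟨x, rfl⟩ := Submodule.mkQ_surjective _ x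
      exact hw.ofBandN_C_smul q r w x)
    (fun w x => by
      obtain ⟨x, rfl⟩ := Submodule.mkQ_surjective _ x
      exact hw.ofBandN_T_smul q w x)

/-- This is the universal property of a cokernel: a map that vanishes on boundaries factors through
the band module. -/
theorem ofBandModule_toBandModule (z) :
    hw.ofBandModule hm q hq (toBandModule hw (m + 1) W z) = q z := by
  have : (hw.ofBandModule hm q hq).comp (toBandModule hw (m + 1) W) = q := by
    refine bandX_hom_ext fun w i hi => ?_
    obtain ⟨k, rfl⟩ := eq_two_mul_of_ht (h := h) (hi.trans hm)
    rw [LinearMap.comp_apply, toBandModule_bandGen hw hm, map_zsmul, ofBandModule, laurentLift_mk,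
      AddMonoidHom.mk'_apply, Submodule.mkQ_apply, Submodule.liftQ_apply, ofBandN_gen,
      negOnePow_smul_smul, AddEquiv.symm_apply_apply]
  exact LinearMap.congr_fun this z

end Exact

theorem exact_toBandModule (hw : 𝔓.IsBandWord C bs h) {m : ℤ} (hm : m + 1 = 0) :
    Function.Exact (bandD hw.isPeriod hw.isGWord m (SignTwist R bs.length W))
      (toBandModule hw (m + 1) W) := by
  intro z
  constructor
  · intro hz
    -- Applied to the projection modulo boundaries, the factorisation shows that the kernel of the
    -- augmentation consists of boundaries.
    have h1 := hw.ofBandModule_toBandModule hm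
      (Submodule.mkQ (LinearMap.range (bandD hw.isPeriod hw.isGWord m (SignTwist R bs.length W))))
      (fun y => (Submodule.Quotient.mk_eq_zero _).mpr (LinearMap.mem_range_self _ y)) z
    rw [hz, map_zero, eq_comm] at h1
    exact (Submodule.Quotient.mk_eq_zero _).mp h1
  · rintro ⟨y, rfl⟩
    exact hw.toBandModule_bandD hm y

end IsBandWord

end Presentation

end Gentle

/-! ### Projective dimension, and the resolution of a band module. -/

namespace Gentle

/-- A nonzero projective module over a noetherian local ring admits a linear form which takes a unit
as a value. -/
theorem exists_isUnit_linearForm {R W : Type*} [CommRing R] [IsLocalRing R] [IsNoetherianRing R]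
    [AddCommGroup W] [Module R W] [Module.Projective R W] [Nontrivial W] :
    ∃ (φ : W →ₗ[R] R) (w : W), IsUnit (φ w) := by
  by_contra! hcon
  obtain ⟨s, hs⟩ := Module.projective_def.mp ‹Module.Projective R W›
  -- Suppose that no form has a unit value. The expansion `φ(w) = ∑ s(w)_b φ(b)` has both factors in
  -- the maximal ideal, and by iteration all values lie in all of its powers. By Krull all
  -- coordinates `s(w)_b` vanish, and so does `w`.
  have hpow : ∀ (k : ℕ) (φ : W →ₗ[R] R) (w : W), φ w ∈ IsLocalRing.maximalIdeal R ^ k := by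
    intro k
    induction k with
    | zero => simp
    | succ k ih =>
      intro φ w
      have h1 : φ w = (s w).sum fun b r => r * φ b := by
        conv_lhs => rw [← hs w, Finsupp.linearCombination_apply, Finsupp.sum, map_sum]
        simp [Finsupp.sum]
      rw [h1, pow_succ']
      refine Ideal.sum_mem _ fun b _ => Ideal.mul_mem_mul ?_ (ih φ b)
      exact (IsLocalRing.mem_maximalIdeal _).mpr (hcon ((Finsupp.lapply b).comp s) w)
  obtain ⟨w, hw⟩ := exists_ne (0 : W)
  refine hw ?_
  have h2 : s w = 0 := Finsupp.ext fun b => by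
    have h3 : s w b ∈ ⨅ k : ℕ, IsLocalRing.maximalIdeal R ^ k :=
      Ideal.mem_iInf.mpr fun k => hpow k ((Finsupp.lapply b).comp s) w
    rwa [Ideal.iInf_pow_eq_bot_of_isLocalRing _ (IsLocalRing.maximalIdeal.isMaximal R).ne_top]
      at h3
  rw [← hs w, h2, map_zero]

theorem bandComplex_d {R Λ : Type u} [CommRing R] [Ring Λ] [Algebra R Λ] {Q₀ Q₁ : Type*}
    [Fintype Q₀] (𝔓 : Presentation R Λ Q₀ Q₁) {c : ℤ → Letter (NPath Q₁)} {p : ℤ}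
    (hc : 𝔓.IsGWord (.bi c)) (hp : IsPeriod Q₀ c p) (W : Type u) [AddCommGroup W]
    [Module R[T;T⁻¹] W] (n : ℤ) : (bandComplex 𝔓 hc hp W).d n (n + 1) =
      ModuleCat.ofHom (Presentation.bandD hp hc n W) :=
  CochainComplex.of_d (fun n => ModuleCat.of Λ (Laurent R (𝔓.strShift hp n) ⊗[R[T;T⁻¹]] W))
    (fun n => ModuleCat.ofHom (Presentation.bandD hp hc n W)) n

/-- A module with a projective resolution of length one which is not projective has projective
dimension one. -/
theorem projectiveDimension_eq_one {Λ : Type u} [Ring Λ] {A B M : Type u} [AddCommGroup A]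
    [Module Λ A] [AddCommGroup B] [Module Λ B] [AddCommGroup M] [Module Λ M]
    [Module.Projective Λ A] [Module.Projective Λ B] (f : A →ₗ[Λ] B) (g : B →ₗ[Λ] M)
    (hf : Function.Injective f) (hg : Function.Surjective g) (hfg : Function.Exact f g)
    (hr : ∀ r : B →ₗ[Λ] A, r.comp f ≠ LinearMap.id) :
    projectiveDimension (ModuleCat.of Λ M) = 1 := by
  refine le_antisymm ?_ ?_
  · refine (projectiveDimension_le_iff _ 1).mpr ?_
    let S : ShortComplex (ModuleCat.{u} Λ) := ShortComplex.mk (ModuleCat.ofHom f)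
      (ModuleCat.ofHom g) (by
        ext x
        exact hfg.apply_apply_eq_zero x)
    have hS : S.ShortExact :=
      { exact := (ShortComplex.ShortExact.moduleCat_exact_iff_function_exact _).mpr hfg
        mono_f := (ModuleCat.mono_iff_injective _).mpr hf
        epi_g := (ModuleCat.epi_iff_surjective _).mpr hg }
    have hA : Projective S.X₁ := (IsProjective.iff_projective _).mp ‹Module.Projective Λ A›
    have hB : Projective S.X₂ := (IsProjective.iff_projective _).mp ‹Module.Projective Λ B›
    exact (hS.hasProjectiveDimensionLT_X₃_iff 0 hB).mpr
      (projective_iff_hasProjectiveDimensionLT_one.mp hA)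
  · refine (projectiveDimension_ge_iff _ 1).mpr fun h => ?_
    have hM : Module.Projective Λ M := (IsProjective.iff_projective _).mpr
      (projective_iff_hasProjectiveDimensionLT_one.mpr h)
    obtain ⟨i, hi⟩ := Module.projective_lifting_property g LinearMap.id hg
    -- A section of `g` corresponds to a retraction of `f`, which is excluded.
    have hsplit : (∃ i, g ∘ₗ i = LinearMap.id) ↔ ∃ r, r ∘ₗ f = LinearMap.id :=
      (hfg.split_tfae hf hg).out 0 1
    obtain ⟨r, hr'⟩ := hsplit.mp ⟨i, hi⟩
    exact hr r hr'

namespace Presentation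

section Radical

variable {R Λ : Type*} [CommRing R] [Ring Λ] [Algebra R Λ] {Q₀ Q₁ : Type*} [Fintype Q₀]
variable {𝔓 : Presentation R Λ Q₀ Q₁}

/-- By definition the radical is only a left ideal, and here the path multiplies elements of `Λe_v`
that may lie outside it. Such an element is a scalar multiple of `e_v` modulo the radical, the
scalar is central, and `γ e_v` is in the radical. -/
theorem path_mul_mem_rad (γ : NPath Q₁) {v : Q₀} {a : Λ} (ha : a ∈ leftIdeal (𝔓.e v)) :
    𝔓.path γ * a ∈ 𝔓.rad v := by
  obtain ⟨r, hr⟩ := 𝔓.exists_scalar a v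
  rw [𝔓.mem_leftIdeal_e.mp ha] at hr
  have h1 : 𝔓.path γ * 𝔓.e v ∈ 𝔓.rad v := by
    rw [path_eq_first, mul_assoc]
    refine Submodule.smul_mem _ _ ?_
    by_cases hv : 𝔓.Q.tail γ.first = v
    · subst hv
      rw [mul_e_tail]
      exact 𝔓.arrow_mem_rad _
    · rw [𝔓.arrow_mul_e_of_ne hv]
      exact zero_mem _
  have h2 : 𝔓.path γ * a = 𝔓.path γ * (a - algebraMap R Λ r * 𝔓.e v) +
      algebraMap R Λ r * (𝔓.path γ * 𝔓.e v) := by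
    rw [mul_sub, ← mul_assoc, ← mul_assoc, Algebra.commutes r (𝔓.path γ), sub_add_cancel]
  rw [h2]
  exact add_mem (Submodule.smul_mem _ _ hr) (Submodule.smul_mem _ _ h1)

end Radical

namespace IsBandWord

section Retraction

variable {R Λ : Type*} [CommRing R] [IsLocalRing R] [IsNoetherianRing R] [Ring Λ] [Algebra R Λ]
variable {Q₀ Q₁ : Type*} [Fintype Q₀] {𝔓 : Presentation R Λ Q₀ Q₁}
variable {C : Word Q₀ Q₁} {bs : List (NPath Q₁ × NPath Q₁)} {h : bs ≠ []}
variable {U : Type*} [AddCommGroup U] [Module R U] [Module R[T;T⁻¹] U] [IsScalarTower R R[T;T⁻¹] U]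

/-- The differential of a nonzero band complex does not split. -/
theorem bandD_not_split [Module.Projective R U] [Nontrivial U] (h𝔓 : 𝔓.IsCompleteGentle)
    (hw : 𝔓.IsBandWord C bs h) {m : ℤ} (hm : m + 1 = 0)
    (r : BandX hw.isPeriod 𝔓 (m + 1) U →ₗ[Λ] BandX hw.isPeriod 𝔓 m U) :
    r.comp (bandD hw.isPeriod hw.isGWord m U) ≠ LinearMap.id := by
  intro hr
  obtain ⟨φ, w, hφ⟩ := exists_isUnit_linearForm (R := R) (W := U)
  have h1 := LinearMap.congr_fun hr (hw.bandGen m w (2 * 0 + 1))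
  rw [LinearMap.comp_apply, bandD_bandGen hw hm, map_add, map_smul, map_smul,
    LinearMap.id_apply] at h1
  -- The coordinate of `g_1 ⊗ w` at its own position is `φ(w)e`, with `φ(w)` a unit, while the other
  -- side is a sum of two elements of the form path times an element of `Λe`.
  have h2 := congrFun (congrArg (bandCoord hw.isPeriod φ m 𝔓) h1) (2 * 0 + 1)
  have h3 : (2 * bs.length : ℤ) ∣ (2 * 0 + 1) - (2 * 0 + 1) := by simp
  have hht : (resBand Q₀ bs h).ht (2 * 0 + 1) = m := (resBand_ht_odd Q₀ h 0).trans (by omega)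
  rw [map_add, map_smul, map_smul, Pi.add_apply, Pi.smul_apply, Pi.smul_apply, bandGen,
    bandCoord_mk hw.isPeriod φ hht, famFun_of_dvd φ h3, sub_self, Int.zero_ediv, mulT_apply,
    LaurentPolynomial.T_zero, one_smul, gIdem_resBand_odd (h := h)] at h2
  have hmem : ∀ z, bandCoord hw.isPeriod φ m 𝔓 z (2 * 0 + 1) ∈
      leftIdeal (𝔓.e (𝔓.Q.phead (blockAt bs h 0).1)) := fun z => by
    have := bandCoord_mem hw.isPeriod φ m (2 * 0 + 1) z
    rwa [gIdem_resBand_odd (h := h)] at this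
  have h4 : algebraMap R Λ (φ w) * 𝔓.e (𝔓.Q.phead (blockAt bs h 0).1) ∈
      𝔓.rad (𝔓.Q.phead (blockAt bs h 0).1) := by
    rw [← h2]
    exact add_mem (path_mul_mem_rad _ (hmem _)) (path_mul_mem_rad _ (hmem _))
  obtain ⟨t, ht⟩ := hφ.exists_left_inv
  refine e_notMem_rad h𝔓 (𝔓.Q.phead (blockAt bs h 0).1) ?_
  have h5 := Submodule.smul_mem _ (algebraMap R Λ t) h4
  rwa [smul_eq_mul, ← mul_assoc, ← map_mul, ht, map_one, one_mul] at h5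

theorem bandD_injective [Module.Projective R U] (h𝔓 : 𝔓.IsCompleteGentle)
    (hw : 𝔓.IsBandWord C bs h) {m : ℤ} (hm : m + 1 = 0) :
    Function.Injective (bandD hw.isPeriod hw.isGWord m U) := by
  refine Presentation.bandD_injective hw.isPeriod h𝔓 hw.isGWord fun i hi => ?_
  obtain ⟨k, rfl⟩ := eq_two_mul_add_one_of_ht (h := h) (hi.trans (by omega))
  refine ⟨_, (blockAt bs h k).2, periodic_blockGLetters_dir h k, ?_⟩
  rw [add_assoc]
  exact periodic_blockGLetters_inv h k

end Retraction

variable {R Λ : Type u} [CommRing R] [IsLocalRing R] [IsNoetherianRing R] [Ring Λ] [Algebra R Λ]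
variable {Q₀ Q₁ : Type*} [Fintype Q₀] {𝔓 : Presentation R Λ Q₀ Q₁}
variable {C : Word Q₀ Q₁} {bs : List (NPath Q₁ × NPath Q₁)} {h : bs ≠ []}
variable {W : Type u} [AddCommGroup W] [Module R W] [Module R[T;T⁻¹] W]
variable [IsScalarTower R R[T;T⁻¹] W] [Module.Projective R W]

theorem isProjectiveResolution (h𝔓 : 𝔓.IsCompleteGentle) (hw : 𝔓.IsBandWord C bs h) :
    IsProjectiveResolution (bandComplex 𝔓 hw.isGWord hw.isPeriod (SignTwist R bs.length W))
      (ModuleCat.of Λ (𝔓.BandModule (R := R) bs h W)) := by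
  have hht : ∀ i, (resBand Q₀ bs h).ht i = 0 ∨ (resBand Q₀ bs h).ht i = -1 := fun i => by
    rcases Int.even_or_odd' i with ⟨k, rfl | rfl⟩
    · exact Or.inl (resBand_ht_even Q₀ h k)
    · exact Or.inr (resBand_ht_odd Q₀ h k)
  have hsub : ∀ n, n ≠ 0 → n ≠ -1 →
      Subsingleton (BandX hw.isPeriod 𝔓 n (SignTwist R bs.length W)) := fun n h0 h1 =>
    bandX_subsingleton fun i hi => by
      rcases hht i with h2 | h2
      · exact h0 (hi.symm.trans h2)
      · exact h1 (hi.symm.trans h2)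
  have hd := bandComplex_d 𝔓 hw.isGWord hw.isPeriod (SignTwist R bs.length W)
  refine isProjectiveResolution_of_exact _ _ (fun n => bandX_projective hw.isPeriod n)
    (fun n hn => hsub n (by omega) (by omega)) (fun n hn => ?_)
    (ModuleCat.ofHom (toBandModule hw 0 W)) (toBandModule_surjective hw rfl) ?_
  · rw [hd, hd]
    have := hsub n (by omega) (by omega)
    -- In degree `-1` exactness means injectivity of the differential, as the preceding term is
    -- zero. In lower degrees the term itself is zero.
    by_cases hn' : n + 1 = -1
    · have hinj : Function.Injective (bandD hw.isPeriod hw.isGWord (n + 1)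
          (SignTwist R bs.length W)) := bandD_injective h𝔓 hw (by omega)
      intro x
      constructor
      · intro hx
        exact ⟨0, (map_zero _).trans (hinj (hx.trans (map_zero _).symm)).symm⟩
      · rintro ⟨y, rfl⟩
        have hy : y = 0 := Subsingleton.elim (α := BandX hw.isPeriod 𝔓 n _) _ _
        subst hy
        simp
    · have := hsub (n + 1) (by omega) hn'
      intro x
      have hx : x = 0 := Subsingleton.elim (α := BandX hw.isPeriod 𝔓 (n + 1) _) _ _
      subst hx
      simp only [map_zero, true_iff]
      exact ⟨0, map_zero _⟩
  · have key : ∀ (t m : ℤ) (_ : m + 1 = t) (_ : t = 0), Function.Exact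
        ((bandComplex 𝔓 hw.isGWord hw.isPeriod (SignTwist R bs.length W)).d m t)
        (toBandModule hw t W) := by
      rintro t m rfl ht
      rw [hd]
      exact hw.exact_toBandModule ht
    exact key 0 (-1) (by simp) rfl

theorem projectiveDimension_bandModule [Nontrivial W] (h𝔓 : 𝔓.IsCompleteGentle)
    (hw : 𝔓.IsBandWord C bs h) :
    projectiveDimension (ModuleCat.of Λ (𝔓.BandModule (R := R) bs h W)) = 1 := by
  have hm : (-1 : ℤ) + 1 = 0 := by simp
  have : Nontrivial (SignTwist R bs.length W) := ‹Nontrivial W›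
  have := bandX_projective (𝔓 := 𝔓) (W := SignTwist R bs.length W) hw.isPeriod (-1)
  have := bandX_projective (𝔓 := 𝔓) (W := SignTwist R bs.length W) hw.isPeriod (-1 + 1)
  exact projectiveDimension_eq_one (bandD hw.isPeriod hw.isGWord (-1) (SignTwist R bs.length W))
    (toBandModule hw (-1 + 1) W) (bandD_injective h𝔓 hw hm) (toBandModule_surjective hw hm)
    (hw.exact_toBandModule hm) (bandD_not_split h𝔓 hw hm)

end IsBandWord

end Presentation

end Gentle

/-! ### The main theorem. -/

theorem theorem1p4 {R Λ : Type u} [CommRing R] [IsLocalRing R] [IsNoetherianRing R]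
    [IsAdicComplete (IsLocalRing.maximalIdeal R) R] [Ring Λ] [Algebra R Λ]
    {Q₀ Q₁ : Type*} [Fintype Q₀] [Finite Q₁]
    (𝔓 : Gentle.Presentation R Λ Q₀ Q₁) (h𝔓 : 𝔓.IsCompleteGentle)
    (s : Gentle.Letter Q₁ → ℤˣ) (hs : 𝔓.IsSign s) :
    -- string words: `P(𝓡_C)[t]`, where `t = ℋ(ι(-))`, is a projective resolution of `M(C)`
    (∀ (C B : Gentle.Word Q₀ Q₁) (A : Gentle.Core Q₀ Q₁) (D : Gentle.Word Q₀ Q₁),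
      𝔓.IsStringWord s C B A D →
      ∃ hC : 𝔓.IsGWord (𝔓.resString s B A D),
        Gentle.IsProjectiveResolution
          ((CategoryTheory.shiftFunctor (CochainComplex (ModuleCat.{u} Λ) ℤ)
            ((𝔓.resString s B A D).ht (𝔓.resStringStart s B A D))).obj
              (Gentle.stringComplex 𝔓 (𝔓.resString s B A D) hC))
          (ModuleCat.of Λ (𝔓.StringModule s B A D))) ∧
    -- band words: `P(𝓡_C, W')` is a projective resolution of `M(C, W)`, where `W'` is `W` with `T`
    -- acting as `(-1)ⁿ T`; and `M(C, W)` has projective dimension one if `W` is nonzero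
    (∀ (C : Gentle.Word Q₀ Q₁) (bs : List (Gentle.NPath Q₁ × Gentle.NPath Q₁)) (h : bs ≠ []),
      𝔓.IsBandWord C bs h →
      ∃ (hC : 𝔓.IsGWord (.bi (Gentle.Seq.periodic (Gentle.blockGLetters bs)
            (Gentle.blockGLetters_ne_nil h))))
        (hp : Gentle.IsPeriod Q₀ (Gentle.Seq.periodic (Gentle.blockGLetters bs)
            (Gentle.blockGLetters_ne_nil h)) (2 * bs.length)),
        ∀ (W : Type u) [AddCommGroup W] [Module R W] [Module R[T;T⁻¹] W]
          [IsScalarTower R R[T;T⁻¹] W] [Module.Projective R W],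
          Gentle.IsProjectiveResolution
            (Gentle.bandComplex 𝔓 hC hp (Gentle.SignTwist R bs.length W))
            (ModuleCat.of Λ (𝔓.BandModule bs h W)) ∧
          (Nontrivial W →
            CategoryTheory.projectiveDimension (ModuleCat.of Λ (𝔓.BandModule bs h W)) = 1)) := by
  exact ⟨fun C B A D hw => ⟨hw.isGWord h𝔓, hw.isProjectiveResolution h𝔓 hs⟩,
    fun C bs h hw => ⟨hw.isGWord, hw.isPeriod, fun W _ _ _ _ _ =>
      ⟨hw.isProjectiveResolution h𝔓, fun _ => hw.projectiveDimension_bandModule h𝔓⟩⟩⟩
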